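/- **Corollary (Asymptotics of the Weyl tensor).** Let $D=\{(x,y): x\ge 0,\ y\ge 0,\ x+y<1\}$, let $N\ge 1$ be an integer and $\alpha\in[0,1)$. Let $V_0,V_1:[0,1)\to\mathbb R$ satisfy $V_i\in C([0,1))\cap C^{N+2}((0,1))$, $V_i(0)=0$, and suppose that $t^{\alpha}V_i'(t)$ and $t^{\alpha+1}V_i''(t)$ extend continuously from $(0,1)$ to $[0,1)$ ($i=0,1$). Let $V$ be the $C^{N+1}$-solution of the Goursat problem with data $\{V_0,V_1\}$ for the Euler–Darboux equation $$V_{xy}-\frac{V_x+V_y}{2(1-x-y)}=0,$$ that is: $V\in C(D)\cap C^{N+1}(\operatorname{Int}D)$ satisfies the equation in $\operatorname{Int}D$; for some $\beta\in[0,1)$ the functions $x^\beta V_x$, $y^\beta V_y$, $x^\beta y^\beta V_{xy}$ extend continuously from $\operatorname{Int}D$ to $D$; and $V(x,0)=V_0(x)$, $V(0,y)=V_1(y)$ for $x,y\in[0,1)$. *Weyl components.* Let $c_1,c_2,n_1,n_2>0$ be real constants, $f(u)=\frac12-(c_1u)^{n_1}$, $g(v)=\frac12-(c_2v)^{n_2}$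 for $u,v>0$ with $f(u)+g(v)>0$, and $x=\frac12-g(v)=(c_2v)^{n_2}$, $y=\frac12-f(u)=(c_1u)^{n_1}$. Regarding $V$ as a function of $(f,g)$ through $x=\frac12-g$, $y=\frac12-f$, the components of the Weyl tensor are $$\Psi_0=-\frac{g'(v)^2}{4}\Big(2V_{gg}+\frac{3}{f+g}V_g-(f+g)V_g^3\Big),\qquad \Psi_2=f'(u)g'(v)\Big(V_fV_g-\frac1{(f+g)^2}\Big),$$ $$\Psi_4=-\frac{f'(u)^2}{4}\Big(2V_{ff}+\frac{3}{f+g}V_f-(f+g)V_f^3\Big).$$ *Coefficients.* Put $$h_0(k)=\sqrt{1-k}\int_0^k\frac{V_0'(t)}{\sqrt{k-t}}\,dt,\quad h_1(k)=\sqrt k\int_0^{1-k}\frac{V_1'(t)}{\sqrt{1-k-t}}\,dt,\quad \mathsf c_j=2^{-j}\prod_{l=0}^{j-1}(2l+1),$$ $$H_0^j(x,k)=h_0(k)-\sum_{l=0}^j\frac{(-1)^lh_0^{(l)}(x)}{l!}(x-k)^l,\qquad H_1^j(x,k)=h_1(k)-\sum_{l=0}^j\frac{h_1^{(l)}(x)}{l!}(k-x)^l,$$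 $$\begin{aligned}A_j(x)={}&\frac{\mathsf c_j}{j!}\Big(\int_0^x\frac{H_0^j(x,k)}{(x-k)^{j+1}}dk+\sum_{l=0}^{j-1}\frac{(-1)^l}{l!(l-j)}h_0^{(l)}(x)x^{l-j}+\frac{(-1)^jh_0^{(j)}(x)}{j!}\ln x\Big)\\&+\frac{h_0^{(j)}(x)}{j!}\Big(\int_0^1\frac{v^j\,dv}{\sqrt{v+1}\sqrt v}+\int_1^\infty v^j\Big(\frac1{\sqrt{v+1}\sqrt v}-\sum_{l=0}^j\frac{(-1)^l\mathsf c_l}{l!}v^{-l-1}\Big)dv+\sum_{l=0}^{j-1}\frac{(-1)^l\mathsf c_l}{l!(l-j)}\Big),\end{aligned}$$ $$\begin{aligned}B_j(x)={}&\frac{\mathsf c_j}{j!}\Big(\int_x^1\frac{H_1^j(x,k)}{(k-x)^{j+1}}dk+\sum_{l=0}^{j-1}\frac{1}{l!(l-j)}h_1^{(l)}(x)(1-x)^{l-j}+\frac{h_1^{(j)}(x)}{j!}\ln(1-x)\Big)\\&+\frac{h_1^{(j)}(x)}{j!}\Big(\int_1^\infty v^j\Big(\frac1{\sqrt{v-1}\sqrt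 v}-\sum_{l=0}^j\frac{\mathsf c_l}{l!}v^{-l-1}\Big)dv+\sum_{l=0}^{j-1}\frac{\mathsf c_l}{l!(l-j)}\Big),\end{aligned}$$ $$f_j=-\frac{\mathsf c_j}{\pi (j!)^2}\big(h_0^{(j)}+h_1^{(j)}\big),\quad g_j=\frac1\pi\big((-1)^jA_j+B_j\big),\quad \gamma_j=jg_j+f_j,\quad G_j=(j-1)\gamma_j+jf_j .$$ Let $\hat f_j,\hat g_j,\hat\gamma_j,\hat G_j$ be the functions obtained by the same formulas from the interchanged data $\{V_1,V_0\}$ (that is, with $V_0$ and $V_1$ exchanged; in particular $\hat f_j(y)=(-1)^jf_j(1-y)$). *Claim.* There are functions $R_0,R_2,R_4$ of $(x,y)$, independent of $c_1,c_2,n_1,n_2$, such that for all $u,v$ as above, with $\epsilon=1-x-y$, $$\begin{aligned}\Psi_0={}&-\frac{(c_2n_2x^{1-1/n_2})^2}{4}\Big[\sum_{j=0}^N(2\hat G_j(y)+3\hat\gamma_j(y))\epsilon^{j-2}+\sum_{j=0}^N(2j+1)j\hat f_j(y)\epsilon^{j-2}\ln\epsilon\\&-\epsilon\Big(\sum_{j=0}^Nj\hat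 f_j(y)\epsilon^{j-1}\ln\epsilon+\sum_{j=0}^N\hat\gamma_j(y)\epsilon^{j-1}\Big)^3+R_0(x,y)\Big],\end{aligned}$$ $$\begin{aligned}\Psi_2={}&c_1n_1c_2n_2\,y^{1-1/n_1}x^{1-1/n_2}\Big[\sum_{j=0}^N\Big(\sum_{k+l=j}\gamma_k(x)\hat\gamma_l(y)\Big)\epsilon^{j-2}-\frac1{\epsilon^2}\\&+\sum_{j=0}^N\Big(\sum_{k+l=j}kf_k(x)\hat\gamma_l(y)+k\hat f_k(y)\gamma_l(x)\Big)\epsilon^{j-2}\ln\epsilon\\&+\sum_{j=0}^N\Big(\sum_{k+l=j}kl\,f_k(x)\hat f_l(y)\Big)\epsilon^{j-2}(\ln\epsilon)^2+R_2(x,y)\Big],\end{aligned}$$ $$\begin{aligned}\Psi_4={}&-\frac{(c_1n_1y^{1-1/n_1})^2}{4}\Big[\sum_{j=0}^N(2G_j(x)+3\gamma_j(x))\epsilon^{j-2}+\sum_{j=0}^N(2j+1)jf_j(x)\epsilon^{j-2}\ln\epsilon\\&-\epsilon\Big(\sum_{j=0}^Njf_j(x)\epsilon^{j-1}\ln\epsilon+\sum_{j=0}^N\gamma_j(x)\epsilon^{j-1}\Big)^3+R_4(x,y)\Big],\end{aligned}$$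 where, as $\epsilon\to0$, $R_0,R_4=O(\epsilon^{N-1}|\ln\epsilon|^3)$ and $R_2=O(\epsilon^{N-1}|\ln\epsilon|^2)$, uniformly for $(x,y)\in D$ bounded away from the corners of $D$: for every $\delta>0$ there are $C,\epsilon_0>0$ such that the bounds hold with constant $C$ at all $(x,y)\in D$ at distance at least $\delta$ from $(0,0),(1,0),(0,1)$ with $1-x-y<\epsilon_0$. -/

import Mathlib

noncomputable section

namespace CollidingWaves

open Set

/-- The triangle `D = {x ≥ 0, y ≥ 0, x + y < 1}`. -/
def triangle : Set (ℝ × ℝ) := {p | 0 ≤ p.1 ∧ 0 ≤ p.2 ∧ p.1 + p.2 < 1}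

/-- The partial derivative `V_x`. -/
def partialX (V : ℝ → ℝ → ℝ) (x y : ℝ) : ℝ := deriv (fun s => V s y) x

/-- The partial derivative `V_y`. -/
def partialY (V : ℝ → ℝ → ℝ) (x y : ℝ) : ℝ := deriv (fun t => V x t) y

/-- `f`, given on `A`, is (the restriction of) a continuous function on `S`: this is the meaning of
"`x ^ α V_x ∈ C(D)`" for expressions that are only defined in the interior. -/
def ExtendsContinuously {X : Type*} [TopologicalSpace X] (f : X → ℝ) (A S : Set X) : Prop :=
  ∃ φ : X → ℝ, ContinuousOn φ S ∧ EqOn φ f A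

/-- One boundary function: `U ∈ C([0,1)) ∩ C^n((0,1))`, `x^α U', x^(α+1) U'' ∈ C([0,1))`,
`U(0) = 0`. -/
structure IsBoundaryFunction (n : ℕ) (α : ℝ) (U : ℝ → ℝ) : Prop where
  continuousOn : ContinuousOn U (Ico 0 1)
  contDiffOn : ContDiffOn ℝ n U (Ioo 0 1)
  deriv_weighted : ExtendsContinuously (fun x => x ^ α * deriv U x) (Ioo 0 1) (Ico 0 1)
  deriv2_weighted :
    ExtendsContinuously (fun x => x ^ (α + 1) * iteratedDeriv 2 U x) (Ioo 0 1) (Ico 0 1)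
  map_zero : U 0 = 0

/-- `V` is a `C^n`-solution in `D` of the Goursat problem for the Euler--Darboux equation
`V_xy - (V_x + V_y) / (2 (1 - x - y)) = 0` with data `V(x,0) = V₀(x)`, `V(0,y) = V₁(y)`. -/
def IsGoursatSolution (n : ℕ) (V₀ V₁ : ℝ → ℝ) (V : ℝ → ℝ → ℝ) : Prop :=
  ∃ α : ℝ, 0 ≤ α ∧ α < 1 ∧
    ContinuousOn (fun p : ℝ × ℝ => V p.1 p.2) triangle ∧
    ContDiffOn ℝ n (fun p : ℝ × ℝ => V p.1 p.2) (interior triangle) ∧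
    (∀ x y : ℝ, (x, y) ∈ interior triangle →
      partialY (partialX V) x y - (partialX V x y + partialY V x y) / (2 * (1 - x - y)) = 0) ∧
    ExtendsContinuously (fun p : ℝ × ℝ => p.1 ^ α * partialX V p.1 p.2)
      (interior triangle) triangle ∧
    ExtendsContinuously (fun p : ℝ × ℝ => p.2 ^ α * partialY V p.1 p.2)
      (interior triangle) triangle ∧
    ExtendsContinuously (fun p : ℝ × ℝ => p.1 ^ α * p.2 ^ α * partialY (partialX V) p.1 p.2)
      (interior triangle) triangle ∧
    (∀ x ∈ Ico (0 : ℝ) 1, V x 0 = V₀ x) ∧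
    (∀ y ∈ Ico (0 : ℝ) 1, V 0 y = V₁ y)

/-! ### The coefficients of the expansion of `V(x, 1 - x - ε)` -/

/-- `h₀(k) = √(1-k) ∫_0^k V₀'(t) / √(k-t) dt`. -/
def h₀ (V₀ : ℝ → ℝ) (k : ℝ) : ℝ := √(1 - k) * ∫ t in (0 : ℝ)..k, deriv V₀ t / √(k - t)

/-- `h₁(k) = √k ∫_0^(1-k) V₁'(t) / √(1-k-t) dt`. -/
def h₁ (V₁ : ℝ → ℝ) (k : ℝ) : ℝ := √k * ∫ t in (0 : ℝ)..(1 - k), deriv V₁ t / √(1 - k - t)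

/-- `c_j = 2^(-j) ∏_{l<j} (2l+1)`. -/
def cst (j : ℕ) : ℝ := 1 / 2 ^ j * ∏ l ∈ Finset.range j, (2 * (l : ℝ) + 1)

/-- `H₀^j(x,k)` (the Taylor remainder of `h` about `x`). -/
def taylorRem₀ (h : ℝ → ℝ) (j : ℕ) (x k : ℝ) : ℝ :=
  h k - ∑ l ∈ Finset.range (j + 1),
    iteratedDeriv l h x * (-1) ^ l / (l.factorial : ℝ) * (x - k) ^ l

/-- `H₁^j(x,k)` (the Taylor remainder of `h` about `x`). -/
def taylorRem₁ (h : ℝ → ℝ) (j : ℕ) (x k : ℝ) : ℝ :=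
  h k - ∑ l ∈ Finset.range (j + 1), iteratedDeriv l h x / (l.factorial : ℝ) * (k - x) ^ l

/-- `A_j(x)`, for `h = h₀`. -/
def coeffA (h : ℝ → ℝ) (j : ℕ) (x : ℝ) : ℝ :=
  cst j / (j.factorial : ℝ) *
      ((∫ k in (0 : ℝ)..x, taylorRem₀ h j x k / (x - k) ^ (j + 1))
        + ∑ l ∈ Finset.range j,
            (-1) ^ l / ((l.factorial : ℝ) * ((l : ℝ) - j)) * iteratedDeriv l h x
              * x ^ ((l : ℤ) - j)
        + (-1) ^ j * iteratedDeriv j h x / (j.factorial : ℝ) * Real.log x)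
    + iteratedDeriv j h x / (j.factorial : ℝ) *
      ((∫ v in (0 : ℝ)..1, v ^ j / (√(v + 1) * √v))
        + ∫ v in Ioi (1 : ℝ), v ^ j * (1 / (√(v + 1) * √v)
            - ∑ l ∈ Finset.range (j + 1),
                1 / (l.factorial : ℝ) * (-1) ^ l * cst l * v ^ (-(l : ℤ) - 1)))
    + iteratedDeriv j h x / (j.factorial : ℝ) *
      ∑ l ∈ Finset.range j, (-1) ^ l * (cst l / ((l.factorial : ℝ) * ((l : ℝ) - j)))

/-- `B_j(x)`, for `h = h₁`. -/
def coeffB (h : ℝ → ℝ) (j : ℕ) (x : ℝ) : ℝ :=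
  cst j / (j.factorial : ℝ) *
      ((∫ k in x..(1 : ℝ), taylorRem₁ h j x k / (k - x) ^ (j + 1))
        + ∑ l ∈ Finset.range j,
            1 / ((l.factorial : ℝ) * ((l : ℝ) - j)) * iteratedDeriv l h x
              * (1 - x) ^ ((l : ℤ) - j)
        + iteratedDeriv j h x / (j.factorial : ℝ) * Real.log (1 - x))
    + iteratedDeriv j h x / (j.factorial : ℝ) *
      ((∫ v in Ioi (1 : ℝ), v ^ j * (1 / (√(v - 1) * √v)
            - ∑ l ∈ Finset.range (j + 1), cst l / (l.factorial : ℝ) * v ^ (-(l : ℤ) - 1)))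
        + ∑ l ∈ Finset.range j, cst l / ((l.factorial : ℝ) * ((l : ℝ) - j)))

/-- `f_j(x)`, the coefficient of `ε^j ln ε` in the expansion of `V(x, 1 - x - ε)`. The coefficients of
the expansion of `V(1 - y - ε, y)` at fixed `y` are those of the reflected solution `V(y, x)`, whose
data are `(V₁, V₀)`; thus `coeffF V₁ V₀ j y` is `(-1)^j` times `coeffF V₀ V₁ j (1 - y)`. -/
def coeffF (V₀ V₁ : ℝ → ℝ) (j : ℕ) (x : ℝ) : ℝ :=
  -cst j / (Real.pi * (j.factorial : ℝ) ^ 2) *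
    (iteratedDeriv j (h₀ V₀) x + iteratedDeriv j (h₁ V₁) x)

/-- `g_j(x)`, the coefficient of `ε^j` in the expansion of `V(x, 1 - x - ε)`. -/
def coeffG (V₀ V₁ : ℝ → ℝ) (j : ℕ) (x : ℝ) : ℝ :=
  1 / Real.pi * ((-1) ^ j * coeffA (h₀ V₀) j x + coeffB (h₁ V₁) j x)

/-- `γ_j = j g_j + f_j`. -/
def coeffγ (V₀ V₁ : ℝ → ℝ) (j : ℕ) (x : ℝ) : ℝ :=
  (j : ℝ) * coeffG V₀ V₁ j x + coeffF V₀ V₁ j x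

/-- `G_j = (j - 1) γ_j + j f_j`. -/
def coeffGG (V₀ V₁ : ℝ → ℝ) (j : ℕ) (x : ℝ) : ℝ :=
  ((j : ℝ) - 1) * coeffγ V₀ V₁ j x + (j : ℝ) * coeffF V₀ V₁ j x

/-! ### The Weyl components -/

/-- The function `w ↦ 1/2 - (c w)^n`: this is `f(u)` for `(c₁, n₁)` and `g(v)` for `(c₂, n₂)`. -/
def profile (c n w : ℝ) : ℝ := 1 / 2 - (c * w) ^ n

/-- `V` as a function of `(f, g)`, where `x = 1/2 - g`, `y = 1/2 - f`. -/
def inFG (V : ℝ → ℝ → ℝ) (f g : ℝ) : ℝ := V (1 / 2 - g) (1 / 2 - f)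

/-- `Ψ₀ = -(g'(v)²/4) (2 V_gg + 3/(f+g) V_g - (f+g) V_g³)`. -/
def weylΨ₀ (V : ℝ → ℝ → ℝ) (f g : ℝ → ℝ) (u v : ℝ) : ℝ :=
  -((deriv g v) ^ 2 / 4) *
    (2 * partialY (partialY (inFG V)) (f u) (g v)
      + 3 / (f u + g v) * partialY (inFG V) (f u) (g v)
      - (f u + g v) * partialY (inFG V) (f u) (g v) ^ 3)

/-- `Ψ₂ = f'(u) g'(v) (V_f V_g - 1/(f+g)²)`. -/
def weylΨ₂ (V : ℝ → ℝ → ℝ) (f g : ℝ → ℝ) (u v : ℝ) : ℝ :=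
  deriv f u * deriv g v *
    (partialX (inFG V) (f u) (g v) * partialY (inFG V) (f u) (g v) - 1 / (f u + g v) ^ 2)

/-- `Ψ₄ = -(f'(u)²/4) (2 V_ff + 3/(f+g) V_f - (f+g) V_f³)`. -/
def weylΨ₄ (V : ℝ → ℝ → ℝ) (f g : ℝ → ℝ) (u v : ℝ) : ℝ :=
  -((deriv f u) ^ 2 / 4) *
    (2 * partialX (partialX (inFG V)) (f u) (g v)
      + 3 / (f u + g v) * partialX (inFG V) (f u) (g v)
      - (f u + g v) * partialX (inFG V) (f u) (g v) ^ 3)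

/-- `R(x,y) = O(b(ε))` as `ε = 1 - x - y → 0`, uniformly for `(x,y) ∈ D` bounded away from the
corners of `D`. -/
def UniformBigO (R : ℝ → ℝ → ℝ) (b : ℝ → ℝ) : Prop :=
  ∀ δ > (0 : ℝ), ∃ C > (0 : ℝ), ∃ ε₀ > (0 : ℝ), ∀ x y : ℝ, (x, y) ∈ triangle →
    δ ≤ dist (x, y) ((0 : ℝ), (0 : ℝ)) → δ ≤ dist (x, y) ((1 : ℝ), (0 : ℝ)) →
    δ ≤ dist (x, y) ((0 : ℝ), (1 : ℝ)) → 1 - x - y < ε₀ →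
    |R x y| ≤ C * b (1 - x - y)

end CollidingWaves

end

open CollidingWaves

/-! The Euler–Darboux equation has the elementary solutions `1 / √((x - k) (1 - y - k))`. The
solution of the Goursat problem is a superposition of these and of their mirror images, with
densities that are Abel transforms of the derivatives of the data (`eq_superpos`). To avoid
differentiating singular integrals, this is proved in integrated form. With `ρ = 1 - x - y` the
equation says that the field `(ρ V_y, ρ V_x)` is divergence free; integrating over a rectangle, and
by parts along its sides, leaves an identity between values of `V` only
(`IsClassicalSolution.weak`). Superpositions obey the same identity (`superpos_weak`), Abel
inversion gives their values on the axes (`integral_abelInt_mul`), and a bounded solution with zero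
data vanishes (`eq_zero_of_weak`).

On a normal line, `x` fixed and `y = 1 - x - ε`, both superpositions take the form `∫_0^X a(t) / √(t
(t - σ ε)) dt` with `σ = -1` or `σ = 1` and `a` smooth near `t = 0`. Their expansion is
`exists_expansion`. Write `a` as a Taylor polynomial plus a flat tail, and the kernel as a
polynomial in `ε` plus a tail. Monomials against the full kernel are integrated exactly by scaling;
the resonant products `t^j t^(-j-1)` produce `ε^j ln ε`. The flat tail of `a` against the polynomial
part of the kernel completes the finite-part integrals in the coefficients. Tail against tail is a
remainder. Since the Weyl components contain two normal derivatives of `V`, remainders are estimated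
together with two derivatives (`IsSmall`). For tail against tail a cutoff isolates `t = 0`: there `t
= ε v` moves `ε` into the flat smooth factor, and elsewhere the kernel itself is smooth in `ε`.

`V_f` and `V_g` are the derivatives of `V` and of its reflection along normal lines, so the
expansions can be substituted into the Weyl components. The `1/ε` term of `V_f` carries no
logarithm, so `ε V_f` is bounded, which controls the cubic term; in `V_f V_g` the terms beyond the
truncation order join the remainder. Data in `C^(N+2)` give densities in `C^(N+1)`, hence `N + 1`
terms, and two derivatives leave an error of order `ε^(N-1)` up to logarithms. All constants are
uniform for `x` in `[δ, 1 - δ]`. -/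

noncomputable section

namespace CollidingWaves

open Set MeasureTheory Filter Topology

/-! ### Taylor remainders of a chain of derivatives -/

/-- The Taylor remainder at `0` of order `n` of the first function of a chain
`ad 0, ad 1, …` of successive derivatives. -/
def taylorTail (ad : ℕ → ℝ → ℝ) (n : ℕ) (t : ℝ) : ℝ :=
  ad 0 t - ∑ m ∈ Finset.range n, ad m 0 / (m.factorial : ℝ) * t ^ m

lemma hasDerivAt_taylorTail {ad : ℕ → ℝ → ℝ} {n : ℕ} {t : ℝ}
    (h : HasDerivAt (ad 0) (ad 1 t) t) :
    HasDerivAt (taylorTail ad (n + 1)) (taylorTail (fun i => ad (i + 1)) n t) t := by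
  have h1 : HasDerivAt (fun t : ℝ => ∑ m ∈ Finset.range (n + 1), ad m 0 / (m.factorial : ℝ) * t ^ m)
      (∑ m ∈ Finset.range (n + 1), ad m 0 / (m.factorial : ℝ) * ((m : ℝ) * t ^ (m - 1))) t := by
    apply HasDerivAt.fun_sum
    intro m _
    exact (hasDerivAt_pow m t).const_mul _
  have h2 := h.sub h1
  refine h2.congr_deriv ?_
  unfold taylorTail
  rw [Finset.sum_range_succ']
  simp only [zero_add, Nat.cast_zero, zero_mul, mul_zero, add_zero, Nat.add_sub_cancel]
  congr 1
  apply Finset.sum_congr rfl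
  intro m _
  have : ((m + 1).factorial : ℝ) = (m + 1) * m.factorial := by
    rw [Nat.factorial_succ]; push_cast; ring
  rw [this]
  have : (m.factorial : ℝ) ≠ 0 := by positivity
  have : (m : ℝ) + 1 ≠ 0 := by positivity
  push_cast
  field_simp

lemma taylorTail_succ_zero (ad : ℕ → ℝ → ℝ) (n : ℕ) : taylorTail ad (n + 1) 0 = 0 := by
  unfold taylorTail
  rw [Finset.sum_range_succ']
  simp

/-- Induction on the order: the tail of order `n + 1` vanishes at `0` and its derivative is the tail
of order `n` of the shifted chain, so the mean value inequality gains one power of `t`. The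
factorial is given away. -/
lemma abs_taylorTail_le {c M : ℝ} (n : ℕ) : ∀ {ad : ℕ → ℝ → ℝ},
    (∀ i < n, ∀ t ∈ Icc 0 c, HasDerivAt (ad i) (ad (i + 1) t) t) →
    (∀ t ∈ Icc 0 c, |ad n t| ≤ M) → ∀ t ∈ Icc 0 c, |taylorTail ad n t| ≤ M * t ^ n := by
  induction n with
  | zero =>
    intro ad _ hb t ht
    simpa [taylorTail] using hb t ht
  | succ n ih =>
    intro ad h hb t ht
    have hM : 0 ≤ M := (abs_nonneg _).trans (hb t ht)
    have h1 := ih (ad := fun i => ad (i + 1)) (fun i hi t ht => h (i + 1) (by omega) t ht) hb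
    have h2 : ∀ s ∈ Icc 0 t, HasDerivWithinAt (taylorTail ad (n + 1))
        (taylorTail (fun i => ad (i + 1)) n s) (Icc 0 t) s := fun s hs =>
      (hasDerivAt_taylorTail (h 0 (by omega) s ⟨hs.1, hs.2.trans ht.2⟩)).hasDerivWithinAt
    have h3 := (convex_Icc 0 t).norm_image_sub_le_of_norm_hasDerivWithin_le (C := M * t ^ n) h2
      (fun s hs => by
        refine (h1 s ⟨hs.1, hs.2.trans ht.2⟩).trans ?_
        have := hs.1
        have := hs.2
        gcongr)
      (left_mem_Icc.2 ht.1) (right_mem_Icc.2 ht.1)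
    rw [taylorTail_succ_zero, sub_zero, sub_zero, Real.norm_eq_abs, Real.norm_eq_abs,
      abs_of_nonneg ht.1] at h3
    rw [pow_succ, ← mul_assoc]
    exact h3

/-! ### The kernel `(1 - σ z)^(-1/2)` and its Taylor remainders -/

lemma cst_succ (j : ℕ) : cst (j + 1) = cst j * (1 / 2 + j) := by
  unfold cst
  rw [Finset.prod_range_succ, pow_succ]
  field_simp
  ring

lemma cst_pos (j : ℕ) : 0 < cst j := by
  unfold cst
  positivity

/-- The `i`-th derivative of `(1 - σ z)^(-1/2)`. -/
def kerDeriv (σ : ℝ) (i : ℕ) (z : ℝ) : ℝ := σ ^ i * cst i * (1 - σ * z) ^ (-(1 / 2 : ℝ) - i)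

lemma hasDerivAt_kerDeriv {σ z : ℝ} (h : 0 < 1 - σ * z) (i : ℕ) :
    HasDerivAt (kerDeriv σ i) (kerDeriv σ (i + 1) z) z := by
  have h1 : HasDerivAt (fun z : ℝ => 1 - σ * z) (-σ) z := by
    simpa using ((hasDerivAt_id z).const_mul σ).const_sub 1
  have h2 := (h1.rpow_const (p := -(1 / 2 : ℝ) - i) (Or.inl h.ne')).const_mul (σ ^ i * cst i)
  refine h2.congr_deriv ?_
  unfold kerDeriv
  rw [cst_succ, show (-(1 / 2 : ℝ) - ((i + 1 : ℕ) : ℝ)) = -(1 / 2 : ℝ) - i - 1 by push_cast; ring]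
  ring

lemma abs_kerDeriv_le {σ z : ℝ} (hσ : |σ| ≤ 1) (hz : z ∈ Icc (0 : ℝ) (1 / 2)) (i : ℕ) :
    |kerDeriv σ i z| ≤ cst i * (1 / 2) ^ (-(1 / 2 : ℝ) - i) := by
  unfold kerDeriv
  have h1 : σ * z ≤ 1 / 2 := by
    have := (abs_le.1 hσ).2
    nlinarith [hz.1, hz.2]
  have h2 : (1 - σ * z) ^ (-(1 / 2 : ℝ) - i) ≤ (1 / 2) ^ (-(1 / 2 : ℝ) - i) :=
    Real.rpow_le_rpow_of_nonpos (by norm_num) (by linarith)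
      (by have : (0 : ℝ) ≤ i := by positivity
          linarith)
  rw [abs_mul, abs_mul, abs_pow, abs_of_pos (cst_pos i),
    abs_of_nonneg (Real.rpow_nonneg (by linarith) _)]
  have h3 : |σ| ^ i ≤ 1 := pow_le_one₀ (abs_nonneg _) hσ
  have := cst_pos i
  have h4 : 0 ≤ (1 - σ * z) ^ (-(1 / 2 : ℝ) - i) := Real.rpow_nonneg (by linarith) _
  calc |σ| ^ i * cst i * (1 - σ * z) ^ (-(1 / 2 : ℝ) - i)
      ≤ 1 * cst i * (1 / 2) ^ (-(1 / 2 : ℝ) - i) := by gcongr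
    _ = _ := by ring

/-- The `m`-th derivative of the Taylor remainder of order `n + m` of `(1 - σ z)^(-1/2)`. -/
def kerTail (σ : ℝ) (m n : ℕ) : ℝ → ℝ := taylorTail (fun i => kerDeriv σ (i + m)) n

lemma one_sub_pos {σ z : ℝ} (hσ : |σ| ≤ 1) (hz : z ∈ Icc (0 : ℝ) (1 / 2)) : 0 < 1 - σ * z := by
  have := (abs_le.1 hσ).2
  nlinarith [hz.1, hz.2]

lemma hasDerivAt_kerTail {σ z : ℝ} (hσ : |σ| ≤ 1) (hz : z ∈ Icc (0 : ℝ) (1 / 2)) (m n : ℕ) :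
    HasDerivAt (kerTail σ m (n + 1)) (kerTail σ (m + 1) n z) z := by
  have := hasDerivAt_taylorTail (ad := fun i => kerDeriv σ (i + m)) (n := n) (t := z)
    (by simpa [add_comm] using hasDerivAt_kerDeriv (one_sub_pos hσ hz) m)
  refine this.congr_deriv ?_
  unfold kerTail
  simp only [add_assoc, add_comm 1 m]

/-- On `[0, 1/2]` the quantity `1 - σ z` stays at least `1/2`, so all derivatives of the kernel are
bounded there. -/
lemma exists_abs_kerTail_le {σ : ℝ} (hσ : |σ| ≤ 1) (m n : ℕ) :
    ∃ C : ℝ, 0 ≤ C ∧ ∀ z ∈ Icc (0 : ℝ) (1 / 2), |kerTail σ m n z| ≤ C * z ^ n := by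
  refine ⟨cst (n + m) * (1 / 2) ^ (-(1 / 2 : ℝ) - (n + m : ℕ)),
    mul_nonneg (cst_pos _).le (by positivity), ?_⟩
  apply abs_taylorTail_le
  · intro i _ t ht
    have := hasDerivAt_kerDeriv (one_sub_pos hσ ht) (i + m)
    rw [show i + 1 + m = i + m + 1 by omega]
    exact this
  · intro t ht
    exact abs_kerDeriv_le hσ ht (n + m)

lemma measurable_kerTail (σ : ℝ) (m n : ℕ) : Measurable (kerTail σ m n) := by
  unfold kerTail taylorTail kerDeriv
  fun_prop

/-- The coefficients of the binomial series of `(1 - σ z)^(-1/2)`. -/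
def binCoeff (σ : ℝ) (l : ℕ) : ℝ := σ ^ l * (cst l / (l.factorial : ℝ))

lemma kerTail_zero (σ : ℝ) (n : ℕ) (z : ℝ) :
    kerTail σ 0 n z = (1 - σ * z) ^ (-(1 / 2 : ℝ)) - ∑ l ∈ Finset.range n, binCoeff σ l * z ^ l := by
  unfold kerTail taylorTail kerDeriv binCoeff
  simp [cst]
  apply Finset.sum_congr rfl
  intro l _
  ring

/-- The weight `1 / √(v (v - σ))`. -/
def weight (σ v : ℝ) : ℝ := 1 / (√(v - σ) * √v)

/-- The weight minus the first `n` terms of its expansion at infinity. -/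
def weightTail (σ : ℝ) (n : ℕ) (v : ℝ) : ℝ :=
  weight σ v - ∑ l ∈ Finset.range n, binCoeff σ l * v⁻¹ ^ (l + 1)

lemma inv_sqrt_mul_sqrt {σ t ε : ℝ} (ht : 0 < t) (h : 0 < 1 - σ * (ε / t)) :
    1 / (√(t - σ * ε) * √t) = t⁻¹ * (1 - σ * (ε / t)) ^ (-(1 / 2 : ℝ)) := by
  have h1 : t - σ * ε = t * (1 - σ * (ε / t)) := by field_simp
  rw [h1, Real.sqrt_mul ht.le, Real.rpow_neg h.le, ← Real.sqrt_eq_rpow]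
  have := Real.mul_self_sqrt ht.le
  have h2 : √t ≠ 0 := by positivity
  have h3 : √(1 - σ * (ε / t)) ≠ 0 := by positivity
  generalize √(1 - σ * (ε / t)) = u at *
  generalize √t = s at *
  rw [← this]
  field_simp

/-- Up to the factor `1/t` the kernel depends on `z = ε / t` only, so its remainder in powers of `ε`
is a Taylor remainder in `z`. Estimates on the kernel thereby reduce to `z ∈ [0, 1/2]`. -/
lemma inv_sqrt_sub_sum {σ t ε : ℝ} (ht : 0 < t) (h : 0 < 1 - σ * (ε / t)) (n : ℕ) :
    1 / (√(t - σ * ε) * √t) - ∑ l ∈ Finset.range n, binCoeff σ l * ε ^ l * t⁻¹ ^ (l + 1)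
      = t⁻¹ * kerTail σ 0 n (ε / t) := by
  rw [inv_sqrt_mul_sqrt ht h, kerTail_zero, mul_sub, Finset.mul_sum]
  congr 1
  apply Finset.sum_congr rfl
  intro l _
  rw [div_eq_mul_inv, mul_pow, pow_succ]
  ring

lemma mem_Icc_inv {v : ℝ} (hv : 2 ≤ v) : 1 / v ∈ Icc (0 : ℝ) (1 / 2) :=
  ⟨by positivity, one_div_le_one_div_of_le (by norm_num) hv⟩

lemma weightTail_eq {σ v : ℝ} (hσ : |σ| ≤ 1) (hv : 2 ≤ v) (n : ℕ) :
    weightTail σ n v = v⁻¹ * kerTail σ 0 n (1 / v) := by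
  rw [← inv_sqrt_sub_sum (by linarith) (one_sub_pos hσ (mem_Icc_inv hv))]
  simp [weightTail, weight]

lemma exists_abs_weightTail_le {σ : ℝ} (hσ : |σ| ≤ 1) (n : ℕ) :
    ∃ C : ℝ, 0 ≤ C ∧ ∀ v : ℝ, 2 ≤ v → |weightTail σ n v| ≤ C * v⁻¹ ^ (n + 1) := by
  obtain ⟨C, hC, h⟩ := exists_abs_kerTail_le hσ 0 n
  refine ⟨C, hC, fun v hv => ?_⟩
  rw [weightTail_eq hσ hv, abs_mul, abs_of_pos (by positivity)]
  have := h _ (mem_Icc_inv hv)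
  have h2 : 0 < v⁻¹ := by positivity
  calc v⁻¹ * |kerTail σ 0 n (1 / v)| ≤ v⁻¹ * (C * (1 / v) ^ n) := by gcongr
    _ = _ := by rw [one_div, pow_succ]; ring

lemma measurable_weight (σ : ℝ) : Measurable (weight σ) := by
  unfold weight
  fun_prop

lemma measurable_weightTail (σ : ℝ) (n : ℕ) : Measurable (weightTail σ n) := by
  unfold weightTail
  have := measurable_weight σ
  fun_prop

lemma integrableOn_inv_sqrt (V : ℝ) : IntegrableOn (fun v : ℝ => 1 / √v) (Ioc 0 V) := by
  rcases le_or_gt V 0 with h | h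
  · simp [Ioc_eq_empty_of_le h]
  · have h1 := intervalIntegral.intervalIntegrable_rpow' (a := 0) (b := V)
      (r := -(1 / 2 : ℝ)) (by norm_num)
    rw [intervalIntegrable_iff_integrableOn_Ioc_of_le h.le] at h1
    refine h1.congr_fun (fun v hv => ?_) measurableSet_Ioc
    simp only
    rw [Real.rpow_neg hv.1.le, ← Real.sqrt_eq_rpow, one_div]

lemma integrableOn_weight {σ : ℝ} (hσ : σ = 1 ∨ σ = -1) (V : ℝ) :
    IntegrableOn (weight σ) (Ioc 0 V) := by
  rcases hσ with rfl | rfl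
  · have h1 : IntegrableOn (fun v : ℝ => 1 / √(v - 1)) (Ioc 1 V) := by
      have := (integrableOn_inv_sqrt (V - 1))
      rcases le_or_gt V 1 with h | h
      · simp [Ioc_eq_empty_of_le h]
      · rw [← intervalIntegrable_iff_integrableOn_Ioc_of_le (by linarith)] at this ⊢
        simpa using this.comp_sub_right 1
    have h2 : IntegrableOn (weight 1) (Ioc 1 V) := by
      refine Integrable.mono' h1 (measurable_weight 1).aestronglyMeasurable ?_
      filter_upwards [ae_restrict_mem measurableSet_Ioc] with v hv
      unfold weight
      have h3 : 1 ≤ √v := Real.one_le_sqrt.2 hv.1.le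
      have h4 : 0 < √(v - 1) := Real.sqrt_pos.2 (by linarith [hv.1])
      rw [Real.norm_eq_abs, abs_of_nonneg (by positivity)]
      apply one_div_le_one_div_of_le h4
      nlinarith
    -- For `v ≤ 1` the square root of a nonpositive number is `0`, and so is the quotient by it. The
    -- weight for `σ = 1` vanishes there, so the lower limit `v = 1` of its integrals is built in.
    have h3 : IntegrableOn (weight 1) (Ioc 0 1) := by
      refine (integrableOn_zero (s := Ioc (0 : ℝ) 1) (μ := volume)).congr_fun
        (fun v hv => ?_) measurableSet_Ioc
      unfold weight
      rw [Real.sqrt_eq_zero_of_nonpos (x := v - 1) (by linarith [hv.2])]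
      simp
    refine (h3.union h2).mono_set ?_
    intro v hv
    rcases le_or_gt v 1 with h | h
    · exact Or.inl ⟨hv.1, h⟩
    · exact Or.inr ⟨h, hv.2⟩
  · refine Integrable.mono' (integrableOn_inv_sqrt V) (measurable_weight _).aestronglyMeasurable ?_
    filter_upwards [ae_restrict_mem measurableSet_Ioc] with v hv
    unfold weight
    have h3 : 1 ≤ √(v - -1) := Real.one_le_sqrt.2 (by linarith [hv.1])
    have h4 : 0 < √v := Real.sqrt_pos.2 hv.1
    rw [Real.norm_eq_abs, abs_of_nonneg (by positivity)]
    apply one_div_le_one_div_of_le h4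
    nlinarith

end CollidingWaves

end

noncomputable section

namespace CollidingWaves

open Set MeasureTheory Filter Topology

/-! ### Monomials against the weight -/

lemma integrableOn_inv_pow {p : ℕ} (hp : 2 ≤ p) {Y : ℝ} (hY : 0 < Y) :
    IntegrableOn (fun v : ℝ => v⁻¹ ^ p) (Ioi Y) := by
  have hp' : (2 : ℝ) ≤ p := by exact_mod_cast hp
  refine (integrableOn_Ioi_rpow_of_lt (a := -(p : ℝ)) (by linarith) hY).congr_fun
    (fun v hv => ?_) measurableSet_Ioi
  simp only
  rw [Real.rpow_neg (hY.trans hv).le, Real.rpow_natCast, inv_pow]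

lemma integral_inv_pow {p : ℕ} (hp : 2 ≤ p) {Y : ℝ} (hY : 0 < Y) :
    ∫ v in Ioi Y, v⁻¹ ^ p = Y⁻¹ ^ (p - 1) / ((p : ℝ) - 1) := by
  have hp' : (2 : ℝ) ≤ p := by exact_mod_cast hp
  have h := integral_Ioi_rpow_of_lt (a := -(p : ℝ)) (by linarith) hY
  rw [setIntegral_congr_fun (g := fun v : ℝ => v ^ (-(p : ℝ))) measurableSet_Ioi, h]
  · rw [show -(p : ℝ) + 1 = -(((p - 1 : ℕ)) : ℝ) by
      rw [Nat.cast_sub (by omega)]; push_cast; ring, Real.rpow_neg hY.le, Real.rpow_natCast,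
      inv_pow, Nat.cast_sub (by omega), neg_div_neg_eq]
    simp
  · intro v hv
    simp only
    rw [Real.rpow_neg (hY.trans hv).le, Real.rpow_natCast, inv_pow]

lemma pow_mul_inv_pow {v : ℝ} (hv : 0 < v) (i l : ℕ) :
    v ^ i * v⁻¹ ^ (l + 1) = v ^ ((i : ℤ) - l - 1) := by
  rw [inv_pow, ← zpow_natCast, ← zpow_natCast, ← zpow_neg, ← zpow_add₀ hv.ne']
  congr 1
  push_cast
  ring

/-- The antiderivative of `v ^ (i - l - 1)`. -/
def powPrim (i l : ℕ) (v : ℝ) : ℝ :=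
  if l = i then Real.log v else v ^ ((i : ℤ) - l) / ((i : ℝ) - l)

lemma integral_powPrim {Y : ℝ} (hY : 1 ≤ Y) (i l : ℕ) :
    ∫ v in (1 : ℝ)..Y, v ^ i * v⁻¹ ^ (l + 1) = powPrim i l Y - powPrim i l 1 := by
  have h0 : (0 : ℝ) ∉ uIcc 1 Y := by
    rw [uIcc_of_le hY]; intro h; linarith [h.1]
  have h1 : ∫ v in (1 : ℝ)..Y, v ^ i * v⁻¹ ^ (l + 1) = ∫ v in (1 : ℝ)..Y, v ^ ((i : ℤ) - l - 1) := by
    apply intervalIntegral.integral_congr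
    intro v hv
    rw [uIcc_of_le hY] at hv
    exact pow_mul_inv_pow (by linarith [hv.1]) i l
  rw [h1]
  unfold powPrim
  split_ifs with h
  · subst h
    simp only [sub_self, zero_sub, zpow_neg_one]
    rw [integral_inv h0, div_one]
    simp
  · have h2 : (i : ℤ) - l ≠ 0 := by omega
    rw [integral_zpow (Or.inr ⟨by omega, h0⟩)]
    rw [show (i : ℤ) - l - 1 + 1 = i - l by ring]
    push_cast
    rw [sub_div]
    ring_nf

lemma integral_Ioi_powPrim {Y : ℝ} (hY : 0 < Y) {i l : ℕ} (h : i < l) :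
    IntegrableOn (fun v : ℝ => v ^ i * v⁻¹ ^ (l + 1)) (Ioi Y) ∧
    ∫ v in Ioi Y, v ^ i * v⁻¹ ^ (l + 1) = -powPrim i l Y := by
  have h1 : ∀ v ∈ Ioi Y, v⁻¹ ^ (l - i + 1) = v ^ i * v⁻¹ ^ (l + 1) := by
    intro v hv
    have : v ≠ 0 := (hY.trans hv).ne'
    rw [show l + 1 = i + (l - i + 1) by omega, pow_add v⁻¹ i, ← mul_assoc, ← mul_pow,
      mul_inv_cancel₀ this, one_pow, one_mul]
  refine ⟨(integrableOn_inv_pow (by omega) hY).congr_fun h1 measurableSet_Ioi, ?_⟩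
  rw [← setIntegral_congr_fun measurableSet_Ioi h1, integral_inv_pow (by omega) hY]
  unfold powPrim
  rw [if_neg (by omega), inv_pow, ← zpow_natCast, ← zpow_neg, Nat.add_sub_cancel,
    Nat.cast_sub h.le, Nat.cast_add, Nat.cast_sub h.le, neg_sub, ← div_neg, neg_sub]
  simp

lemma integrableOn_pow_mul_weight {σ : ℝ} (hσ : σ = 1 ∨ σ = -1) (i : ℕ) (V : ℝ) :
    IntegrableOn (fun v => v ^ i * weight σ v) (Ioc 0 V) := by
  have h := integrableOn_weight hσ V
  rw [← integrableOn_Icc_iff_integrableOn_Ioc] at h ⊢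
  exact h.continuousOn_mul (by fun_prop) isCompact_Icc

lemma abs_sign {σ : ℝ} (hσ : σ = 1 ∨ σ = -1) : |σ| ≤ 1 := by
  rcases hσ with rfl | rfl <;> simp

lemma integrableOn_pow_mul_weightTail {σ : ℝ} (hσ : σ = 1 ∨ σ = -1) {i n : ℕ} (h : i < n)
    {Y : ℝ} (hY : 1 ≤ Y) : IntegrableOn (fun v => v ^ i * weightTail σ n v) (Ioi Y) := by
  obtain ⟨C, hC, hb⟩ := exists_abs_weightTail_le (abs_sign hσ) n
  have h2 : IntegrableOn (fun v => v ^ i * weightTail σ n v) (Ioi 2) := by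
    have h3 := ((integral_Ioi_powPrim (Y := 2) (by norm_num) h).1).const_mul C
    refine Integrable.mono' h3
      ((measurable_id.pow_const i).mul (measurable_weightTail σ n)).aestronglyMeasurable ?_
    filter_upwards [ae_restrict_mem measurableSet_Ioi] with v hv
    have hv' : (2 : ℝ) < v := hv
    have h4 := hb v hv'.le
    rw [Real.norm_eq_abs, abs_mul, abs_of_pos (by positivity)]
    calc v ^ i * |weightTail σ n v| ≤ v ^ i * (C * v⁻¹ ^ (n + 1)) := by gcongr
      _ = _ := by ring
  have h1 : IntegrableOn (fun v => v ^ i * weightTail σ n v) (Icc 1 2) := by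
    refine IntegrableOn.continuousOn_mul (by fun_prop) ?_ isCompact_Icc
    unfold weightTail
    apply Integrable.sub
    · change IntegrableOn (fun v => weight σ v) (Icc 1 2)
      rw [integrableOn_Icc_iff_integrableOn_Ioc]
      exact (integrableOn_weight hσ 2).mono_set (Ioc_subset_Ioc_left (by norm_num))
    · apply ContinuousOn.integrableOn_Icc
      have : ∀ v ∈ Icc (1 : ℝ) 2, v ≠ 0 := fun v hv => by linarith [hv.1]
      fun_prop (disch := assumption)
  refine (h1.union h2).mono_set ?_
  intro v hv
  rcases le_or_gt v 2 with h | h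
  · exact Or.inl ⟨hY.trans (le_of_lt hv), h⟩
  · exact Or.inr h

/-- The constant term of `∫_0^Y v^j / √(v (v - σ)) dv` as `Y → ∞`. -/
def weightConst (σ : ℝ) (j : ℕ) : ℝ :=
  (∫ v in (0 : ℝ)..1, v ^ j * weight σ v) + (∫ v in Ioi (1 : ℝ), v ^ j * weightTail σ (j + 1) v)
    + ∑ l ∈ Finset.range j, binCoeff σ l / ((l : ℝ) - j)

/-- The tail integral `∫_Y^∞ v^i κ(v) dv`. -/
def tailIntegral (σ : ℝ) (n i : ℕ) (Y : ℝ) : ℝ := ∫ v in Ioi Y, v ^ i * weightTail σ n v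

lemma weightTail_split (σ : ℝ) {i n : ℕ} (h : i < n) (v : ℝ) :
    weightTail σ (i + 1) v = weightTail σ n v
      + ∑ l ∈ Finset.Ico (i + 1) n, binCoeff σ l * v⁻¹ ^ (l + 1) := by
  unfold weightTail
  rw [← Finset.sum_range_add_sum_Ico _ (show i + 1 ≤ n by omega)]
  ring

/-- Subtracting `i + 1` terms is just enough for convergence at infinity. The terms of index `l > i`
are integrable there, so subtracting `n` terms instead costs only explicit powers of `Y`. -/
lemma tailIntegral_split {σ : ℝ} (hσ : σ = 1 ∨ σ = -1) {i n : ℕ} (h : i < n) {Y : ℝ}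
    (hY : 1 ≤ Y) : ∫ v in Ioi Y, v ^ i * weightTail σ (i + 1) v = tailIntegral σ n i Y
      - ∑ l ∈ Finset.Ico (i + 1) n, binCoeff σ l * powPrim i l Y := by
  have h0 : 0 < Y := by linarith
  have h1 : ∀ v, v ^ i * weightTail σ (i + 1) v = v ^ i * weightTail σ n v
      + ∑ l ∈ Finset.Ico (i + 1) n, binCoeff σ l * (v ^ i * v⁻¹ ^ (l + 1)) := by
    intro v
    rw [weightTail_split σ h, mul_add, Finset.mul_sum]
    congr 1
    apply Finset.sum_congr rfl
    intro l _
    ring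
  have h2 : ∀ l ∈ Finset.Ico (i + 1) n,
      Integrable (fun v : ℝ => binCoeff σ l * (v ^ i * v⁻¹ ^ (l + 1))) (volume.restrict (Ioi Y)) := by
    intro l hl
    rw [Finset.mem_Ico] at hl
    exact (integral_Ioi_powPrim h0 (by omega)).1.const_mul _
  simp_rw [h1]
  rw [integral_add (integrableOn_pow_mul_weightTail hσ h hY) (integrable_finsetSum _ h2),
    integral_finsetSum _ h2, sub_eq_add_neg, ← Finset.sum_neg_distrib]
  unfold tailIntegral
  congr 1
  apply Finset.sum_congr rfl
  intro l hl
  rw [Finset.mem_Ico] at hl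
  rw [integral_const_mul, (integral_Ioi_powPrim h0 (by omega)).2]
  ring

/-- This is an exact identity, not just an asymptotic one, so that the remainder can be
differentiated later. The integral is cut at `v = 1`; beyond it the first `i + 1` terms of the
weight are integrated explicitly (`l = i` gives the logarithm) and the rest is the full integral
over `(1, ∞)` minus the tail beyond `Y`. -/
lemma integral_pow_mul_weight {σ : ℝ} (hσ : σ = 1 ∨ σ = -1) {i n : ℕ} (h : i < n) {Y : ℝ}
    (hY : 1 ≤ Y) : ∫ v in (0 : ℝ)..Y, v ^ i * weight σ v
      = ∑ l ∈ Finset.range n, binCoeff σ l * powPrim i l Y + weightConst σ i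
        - tailIntegral σ n i Y := by
  have h0 : 0 < Y := by linarith
  have hI : ∀ a b : ℝ, 0 ≤ a → a ≤ b →
      IntervalIntegrable (fun v => v ^ i * weight σ v) volume a b := by
    intro a b ha hab
    rw [intervalIntegrable_iff_integrableOn_Ioc_of_le hab]
    exact (integrableOn_pow_mul_weight hσ i b).mono_set (Ioc_subset_Ioc_left ha)
  have h1 := intervalIntegral.integral_add_adjacent_intervals
    (hI 0 1 le_rfl zero_le_one) (hI 1 Y zero_le_one hY)
  have h2 := intervalIntegral.integral_interval_add_Ioi
    (integrableOn_pow_mul_weightTail hσ (Nat.lt_succ_self i) le_rfl)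
    (integrableOn_pow_mul_weightTail hσ (Nat.lt_succ_self i) hY)
  rw [tailIntegral_split hσ h hY] at h2
  have hJ : ∀ l : ℕ, IntervalIntegrable (fun v : ℝ => binCoeff σ l * (v ^ i * v⁻¹ ^ (l + 1)))
      volume 1 Y := by
    intro l
    apply ContinuousOn.intervalIntegrable
    have : ∀ v ∈ uIcc (1 : ℝ) Y, v ≠ 0 := fun v hv => by
      rw [uIcc_of_le hY] at hv
      linarith [hv.1]
    fun_prop (disch := assumption)
  have h3 : ∫ v in (1 : ℝ)..Y, v ^ i * weightTail σ (i + 1) v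
      = (∫ v in (1 : ℝ)..Y, v ^ i * weight σ v)
        - ∑ l ∈ Finset.range (i + 1), binCoeff σ l * (powPrim i l Y - powPrim i l 1) := by
    have h4 : ∀ v, v ^ i * weightTail σ (i + 1) v = v ^ i * weight σ v
        - ∑ l ∈ Finset.range (i + 1), binCoeff σ l * (v ^ i * v⁻¹ ^ (l + 1)) := by
      intro v
      unfold weightTail
      rw [mul_sub, Finset.mul_sum]
      congr 1
      apply Finset.sum_congr rfl
      intro l _
      ring
    simp_rw [h4]
    rw [intervalIntegral.integral_sub (hI 1 Y zero_le_one hY)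
      (by
        have := IntervalIntegrable.sum (Finset.range (i + 1)) (fun l _ => hJ l)
        simpa [Finset.sum_fn] using this),
      intervalIntegral.integral_finsetSum (fun l _ => hJ l)]
    congr 1
    apply Finset.sum_congr rfl
    intro l _
    rw [intervalIntegral.integral_const_mul, integral_powPrim hY]
  have h5 : ∑ l ∈ Finset.range (i + 1), binCoeff σ l * powPrim i l 1
      = - ∑ l ∈ Finset.range i, binCoeff σ l / ((l : ℝ) - i) := by
    rw [Finset.sum_range_succ, ← Finset.sum_neg_distrib]
    simp only [powPrim, if_true, Real.log_one, mul_zero, add_zero]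
    apply Finset.sum_congr rfl
    intro l hl
    rw [Finset.mem_range] at hl
    rw [if_neg (by omega), one_zpow, ← div_neg, neg_sub]
    ring
  have h6 := Finset.sum_range_add_sum_Ico (fun l => binCoeff σ l * powPrim i l Y)
    (show i + 1 ≤ n by omega)
  simp_rw [mul_sub, Finset.sum_sub_distrib] at h3
  unfold weightConst
  linarith

lemma continuousAt_weightTail {σ v : ℝ} (hσ : |σ| ≤ 1) (hv : 1 < v) (n : ℕ) :
    ContinuousAt (weightTail σ n) v := by
  have h1 : 0 < v - σ := by linarith [(abs_le.1 hσ).2]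
  have h2 : √(v - σ) * √v ≠ 0 := by
    have : 0 < v := by linarith
    positivity
  have h3 : v ≠ 0 := by linarith
  unfold weightTail weight
  fun_prop (disch := assumption)

lemma hasDerivAt_tailIntegral {σ : ℝ} (hσ : σ = 1 ∨ σ = -1) {i n : ℕ} (h : i < n) {Y : ℝ}
    (hY : 1 < Y) : HasDerivAt (tailIntegral σ n i) (-(Y ^ i * weightTail σ n Y)) Y := by
  have hc : ContinuousAt (fun v => v ^ i * weightTail σ n v) Y :=
    (continuousAt_id.pow i).mul (continuousAt_weightTail (abs_sign hσ) hY n)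
  have hI := integrableOn_pow_mul_weightTail hσ h le_rfl
  have h1 : HasDerivAt (fun u => ∫ v in (1 : ℝ)..u, v ^ i * weightTail σ n v)
      (Y ^ i * weightTail σ n Y) Y := by
    apply intervalIntegral.integral_hasDerivAt_right _ _ hc
    · rw [intervalIntegrable_iff_integrableOn_Ioc_of_le hY.le]
      exact hI.mono_set Ioc_subset_Ioi_self
    · exact ((measurable_id.pow_const i).mul
        (measurable_weightTail σ n)).stronglyMeasurable.stronglyMeasurableAtFilter
  refine (h1.const_sub (tailIntegral σ n i 1)).congr_of_eventuallyEq ?_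
  filter_upwards [lt_mem_nhds hY] with u hu
  have := intervalIntegral.integral_interval_add_Ioi hI
    (integrableOn_pow_mul_weightTail hσ h hu.le)
  unfold tailIntegral
  linarith

lemma exists_abs_tailIntegral_le {σ : ℝ} (hσ : σ = 1 ∨ σ = -1) {i n : ℕ} (h : i < n) :
    ∃ C : ℝ, 0 ≤ C ∧ ∀ Y : ℝ, 2 ≤ Y → |tailIntegral σ n i Y| ≤ C * Y⁻¹ ^ (n - i) := by
  obtain ⟨C, hC, hb⟩ := exists_abs_weightTail_le (abs_sign hσ) n
  have hni : 0 < (n : ℝ) - i := by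
    have : (i : ℝ) < n := by exact_mod_cast h
    linarith
  refine ⟨C / ((n : ℝ) - i), by positivity, fun Y hY => ?_⟩
  have h0 : 0 < Y := by linarith
  have h1 := (integral_Ioi_powPrim h0 h)
  have h2 : ‖tailIntegral σ n i Y‖ ≤ ∫ v in Ioi Y, C * (v ^ i * v⁻¹ ^ (n + 1)) := by
    apply norm_integral_le_of_norm_le (h1.1.const_mul C)
    filter_upwards [ae_restrict_mem measurableSet_Ioi] with v hv
    have hv' : Y < v := hv
    have hv0 : 0 < v := by linarith
    have h4 := hb v (by linarith)
    rw [Real.norm_eq_abs, abs_mul, abs_of_pos (by positivity)]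
    calc v ^ i * |weightTail σ n v| ≤ v ^ i * (C * v⁻¹ ^ (n + 1)) := by gcongr
      _ = _ := by ring
  rw [integral_const_mul, h1.2, Real.norm_eq_abs] at h2
  refine h2.trans (le_of_eq ?_)
  unfold powPrim
  rw [if_neg (by omega), inv_pow, ← zpow_natCast, ← zpow_neg, Nat.cast_sub h.le, neg_sub]
  have : (i : ℝ) - n ≠ 0 := by linarith
  field_simp
  ring

end CollidingWaves

end

noncomputable section

namespace CollidingWaves

open Set MeasureTheory Filter Topology

/-! ### Remainders with two controlled derivatives -/

/-- `r' = O(ε^(M+1) |ln ε|)` and `r'' = O(ε^M |ln ε|)` on `(0, ε₀)`, with constant `C`. -/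
def IsSmall (M : ℕ) (C ε₀ : ℝ) (r : ℝ → ℝ) : Prop :=
  ∃ r1 r2 : ℝ → ℝ, ∀ ε ∈ Ioo 0 ε₀, HasDerivAt r (r1 ε) ε ∧ HasDerivAt r1 (r2 ε) ε ∧
    |r1 ε| ≤ C * (ε ^ (M + 1) * |Real.log ε|) ∧ |r2 ε| ≤ C * (ε ^ M * |Real.log ε|)

lemma IsSmall.add {M : ℕ} {C C' ε₀ : ℝ} {r r' : ℝ → ℝ} (h : IsSmall M C ε₀ r)
    (h' : IsSmall M C' ε₀ r') : IsSmall M (C + C') ε₀ (fun ε => r ε + r' ε) := by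
  obtain ⟨r1, r2, hr⟩ := h
  obtain ⟨s1, s2, hs⟩ := h'
  refine ⟨fun ε => r1 ε + s1 ε, fun ε => r2 ε + s2 ε, fun ε hε => ?_⟩
  obtain ⟨a1, a2, a3, a4⟩ := hr ε hε
  obtain ⟨b1, b2, b3, b4⟩ := hs ε hε
  refine ⟨a1.add b1, a2.add b2, ?_, ?_⟩
  · rw [add_mul]; exact (abs_add_le _ _).trans (add_le_add a3 b3)
  · rw [add_mul]; exact (abs_add_le _ _).trans (add_le_add a4 b4)

lemma IsSmall.const_mul {M : ℕ} {C ε₀ A k : ℝ} {r : ℝ → ℝ} (h : IsSmall M C ε₀ r)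
    (hk : |k| ≤ A) : IsSmall M (A * C) ε₀ (fun ε => k * r ε) := by
  obtain ⟨r1, r2, hr⟩ := h
  refine ⟨fun ε => k * r1 ε, fun ε => k * r2 ε, fun ε hε => ?_⟩
  obtain ⟨a1, a2, a3, a4⟩ := hr ε hε
  have hA : 0 ≤ A := (abs_nonneg _).trans hk
  refine ⟨a1.const_mul k, a2.const_mul k, ?_, ?_⟩
  · rw [abs_mul, mul_assoc]; gcongr
  · rw [abs_mul, mul_assoc]; gcongr

lemma IsSmall.mono {M : ℕ} {C C' ε₀ ε₁ : ℝ} {r : ℝ → ℝ} (h : IsSmall M C ε₀ r)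
    (hC : C ≤ C') (hε : ε₁ ≤ ε₀) : IsSmall M C' ε₁ r := by
  obtain ⟨r1, r2, hr⟩ := h
  refine ⟨r1, r2, fun ε hε' => ?_⟩
  obtain ⟨a1, a2, a3, a4⟩ := hr ε ⟨hε'.1, hε'.2.trans_le hε⟩
  have := hε'.1
  exact ⟨a1, a2, a3.trans (by gcongr), a4.trans (by gcongr)⟩

lemma IsSmall.congr {M : ℕ} {C ε₀ : ℝ} {r r' : ℝ → ℝ} (h : IsSmall M C ε₀ r)
    (hr' : ∀ ε ∈ Ioo 0 ε₀, r' ε = r ε) : IsSmall M C ε₀ r' := by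
  obtain ⟨r1, r2, hr⟩ := h
  refine ⟨r1, r2, fun ε hε => ?_⟩
  obtain ⟨a1, a2, a3, a4⟩ := hr ε hε
  refine ⟨a1.congr_of_eventuallyEq ?_, a2, a3, a4⟩
  filter_upwards [Ioo_mem_nhds hε.1 hε.2] with x hx using hr' x hx

lemma IsSmall.zero {M : ℕ} {ε₀ : ℝ} : IsSmall M 0 ε₀ (fun _ => 0) :=
  ⟨fun _ => 0, fun _ => 0, fun ε _ => ⟨hasDerivAt_const _ _, hasDerivAt_const _ _, by simp, by simp⟩⟩

lemma IsSmall.sum {M : ℕ} {ε₀ : ℝ} {C : ℕ → ℝ} {r : ℕ → ℝ → ℝ} (n : ℕ)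
    (h : ∀ i < n, IsSmall M (C i) ε₀ (r i)) :
    IsSmall M (∑ i ∈ Finset.range n, C i) ε₀ (fun ε => ∑ i ∈ Finset.range n, r i ε) := by
  induction n with
  | zero => simpa using IsSmall.zero
  | succ n ih =>
    simp_rw [Finset.sum_range_succ]
    exact (ih fun i hi => h i (by omega)).add (h n (by omega))

lemma one_le_abs_log {ε : ℝ} (h0 : 0 < ε) (h : ε ≤ Real.exp (-1)) : 1 ≤ |Real.log ε| := by
  have h1 : Real.log ε ≤ -1 := (Real.log_le_iff_le_exp h0).2 h
  rw [abs_of_neg (by linarith)]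
  linarith

/-- Below `exp (-1)` one has `|ln ε| ≥ 1`, so bounds without a logarithm fit the common format. -/
lemma isSmall_of_le {M : ℕ} {C ε₀ : ℝ} (hε₀ : ε₀ ≤ Real.exp (-1)) (hC : 0 ≤ C) {r r1 r2 : ℝ → ℝ}
    (h1 : ∀ ε ∈ Ioo 0 ε₀, HasDerivAt r (r1 ε) ε) (h2 : ∀ ε ∈ Ioo 0 ε₀, HasDerivAt r1 (r2 ε) ε)
    (h3 : ∀ ε ∈ Ioo 0 ε₀, |r1 ε| ≤ C * ε ^ (M + 1)) (h4 : ∀ ε ∈ Ioo 0 ε₀, |r2 ε| ≤ C * ε ^ M) :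
    IsSmall M C ε₀ r := by
  refine ⟨r1, r2, fun ε hε => ⟨h1 ε hε, h2 ε hε, (h3 ε hε).trans ?_, (h4 ε hε).trans ?_⟩⟩
  · have := one_le_abs_log hε.1 (hε.2.le.trans hε₀)
    have h0 := hε.1
    calc C * ε ^ (M + 1) = C * (ε ^ (M + 1) * 1) := by ring
      _ ≤ _ := by gcongr
  · have := one_le_abs_log hε.1 (hε.2.le.trans hε₀)
    have h0 := hε.1
    calc C * ε ^ M = C * (ε ^ M * 1) := by ring
      _ ≤ _ := by gcongr

/-- The derivative of the tail integral is its integrand, which at `X / ε` is a kernel remainder at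
`ε / X`. Both derivatives of `r` are therefore explicit in `r`, `q0` and `q1`, and each
differentiation costs one power of `ε`. -/
lemma isSmall_tailIntegral {σ : ℝ} (hσ : σ = 1 ∨ σ = -1) {M i : ℕ} (hi : i < M + 2) {c ε₀ : ℝ}
    (hc : 0 < c) (hε₀ : ε₀ ≤ Real.exp (-1)) (hε₀' : ε₀ ≤ c / 2) :
    ∃ C : ℝ, 0 ≤ C ∧ ∀ X : ℝ, c ≤ X → X ≤ 1 →
      IsSmall M C ε₀ (fun ε => ε ^ i * tailIntegral σ (M + 2) i (X / ε)) := by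
  obtain ⟨C, hC, hT⟩ := exists_abs_tailIntegral_le hσ hi
  obtain ⟨C0, hC0, hk0⟩ := exists_abs_kerTail_le (abs_sign hσ) 0 (M + 2)
  obtain ⟨C1, hC1, hk1⟩ := exists_abs_kerTail_le (abs_sign hσ) 1 (M + 1)
  -- Because `c ≤ X ≤ 1`, this power dominates `X⁻¹ ^ k` for every `k ≤ M + 2`, which makes the
  -- constant independent of `X`.
  set D := c⁻¹ ^ (M + 2) with hD
  have hDpos : 0 < D := by positivity
  refine ⟨(i * C + C0) * D + (i * (i * C + C0) + i * C + C1 + C0) * D, by positivity,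
    fun X hX hX1 => ?_⟩
  have hX0 : 0 < X := hc.trans_le hX
  have hc1 : 1 ≤ c⁻¹ := (one_le_inv₀ hc).2 (hX.trans hX1)
  have hXc : X⁻¹ ≤ c⁻¹ := inv_anti₀ hc hX
  set T := tailIntegral σ (M + 2) i with hTdef
  have hz : ∀ ε ∈ Ioo 0 ε₀, ε / X ∈ Icc (0 : ℝ) (1 / 2) := by
    intro ε hε
    refine ⟨(div_pos hε.1 hX0).le, ?_⟩
    rw [div_le_iff₀ hX0]
    linarith [hε.2]
  have hY : ∀ ε ∈ Ioo 0 ε₀, 2 ≤ X / ε := by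
    intro ε hε
    rw [le_div_iff₀ hε.1]
    linarith [hε.2]
  set r : ℝ → ℝ := fun ε => ε ^ i * T (X / ε) with hr
  set q0 : ℝ → ℝ := fun ε => X ^ i * kerTail σ 0 (M + 2) (ε / X) with hq0
  set q1 : ℝ → ℝ := fun ε => X ^ i * (kerTail σ 1 (M + 1) (ε / X) / X) with hq1
  set r1 : ℝ → ℝ := fun ε => i * r ε / ε + q0 ε / ε with hr1
  have hdr : ∀ ε ∈ Ioo 0 ε₀, HasDerivAt r (r1 ε) ε := by
    intro ε hε
    have hε0 := hε.1
    have h1 : HasDerivAt (fun ε : ℝ => X / ε) (X * (-(ε ^ 2)⁻¹)) ε := by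
      simpa [div_eq_mul_inv] using (hasDerivAt_inv hε0.ne').const_mul X
    have h2 := (hasDerivAt_tailIntegral hσ hi (Y := X / ε) (by linarith [hY ε hε])).comp ε h1
    have h3 := (hasDerivAt_pow i ε).mul h2
    refine h3.congr_deriv ?_
    rw [weightTail_eq (abs_sign hσ) (hY ε hε)]
    simp only [hr1, hr, hq0, Function.comp, one_div, inv_div, div_pow]
    have hpow : (i : ℝ) * ε ^ (i - 1) = i * ε ^ i / ε := by
      rcases i with _ | k
      · simp
      · rw [Nat.add_sub_cancel, pow_succ]; field_simp
    rw [hpow, hTdef]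
    field_simp
  have hdq : ∀ ε ∈ Ioo 0 ε₀, HasDerivAt q0 (q1 ε) ε := by
    intro ε hε
    have h1 : HasDerivAt (fun ε : ℝ => ε / X) (1 / X) ε := (hasDerivAt_id ε).div_const X
    have h2 := ((hasDerivAt_kerTail (abs_sign hσ) (hz ε hε) 0 (M + 1)).comp ε h1).const_mul (X ^ i)
    refine h2.congr_deriv ?_
    simp only [hq1]
    ring_nf
  set r2 : ℝ → ℝ := fun ε => i * r1 ε / ε - i * r ε / ε ^ 2 + q1 ε / ε - q0 ε / ε ^ 2 with hr2
  have hdr1 : ∀ ε ∈ Ioo 0 ε₀, HasDerivAt r1 (r2 ε) ε := by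
    intro ε hε
    have hε0 : ε ≠ 0 := hε.1.ne'
    have h1 := (((hdr ε hε).const_mul (i : ℝ)).div (hasDerivAt_id ε) hε0).add
      ((hdq ε hε).div (hasDerivAt_id ε) hε0)
    refine h1.congr_deriv ?_
    simp only [hr2, id]
    field_simp
    ring
  have hb : ∀ ε ∈ Ioo 0 ε₀, |r ε| ≤ C * D * ε ^ (M + 2) := by
    intro ε hε
    have hε0 := hε.1
    have h1 := hT _ (hY ε hε)
    simp only [hr]
    rw [abs_mul, abs_of_pos (by positivity)]
    calc ε ^ i * |T (X / ε)| ≤ ε ^ i * (C * (X / ε)⁻¹ ^ (M + 2 - i)) := by gcongr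
      _ = C * ε ^ (i + (M + 2 - i)) * X⁻¹ ^ (M + 2 - i) := by
        rw [inv_div, div_eq_mul_inv, mul_pow, pow_add]; ring
      _ ≤ C * ε ^ (M + 2) * c⁻¹ ^ (M + 2) := by
        rw [show i + (M + 2 - i) = M + 2 by omega]
        have : X⁻¹ ^ (M + 2 - i) ≤ c⁻¹ ^ (M + 2) :=
          (pow_le_pow_left₀ (by positivity) hXc _).trans (pow_le_pow_right₀ hc1 (by omega))
        gcongr
      _ = _ := by rw [hD]; ring
  have hXi : X ^ i ≤ 1 := pow_le_one₀ hX0.le hX1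
  have hb0 : ∀ ε ∈ Ioo 0 ε₀, |q0 ε| ≤ C0 * D * ε ^ (M + 2) := by
    intro ε hε
    have hε0 := hε.1
    simp only [hq0]
    rw [abs_mul, abs_of_pos (by positivity)]
    calc X ^ i * |kerTail σ 0 (M + 2) (ε / X)| ≤ 1 * (C0 * (ε / X) ^ (M + 2)) := by
          gcongr
          exact hk0 _ (hz ε hε)
      _ = C0 * ε ^ (M + 2) * X⁻¹ ^ (M + 2) := by rw [div_eq_mul_inv, mul_pow]; ring
      _ ≤ C0 * ε ^ (M + 2) * c⁻¹ ^ (M + 2) := by gcongr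
      _ = _ := by rw [hD]; ring
  have hb1 : ∀ ε ∈ Ioo 0 ε₀, |q1 ε| ≤ C1 * D * ε ^ (M + 1) := by
    intro ε hε
    have hε0 := hε.1
    simp only [hq1]
    rw [abs_mul, abs_of_pos (by positivity), abs_div, abs_of_pos hX0, div_eq_mul_inv]
    calc X ^ i * (|kerTail σ 1 (M + 1) (ε / X)| * X⁻¹)
        ≤ 1 * ((C1 * (ε / X) ^ (M + 1)) * X⁻¹) := by
          gcongr
          exact hk1 _ (hz ε hε)
      _ = C1 * ε ^ (M + 1) * X⁻¹ ^ (M + 2) := by rw [div_eq_mul_inv, mul_pow]; ring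
      _ ≤ C1 * ε ^ (M + 1) * c⁻¹ ^ (M + 2) := by gcongr
      _ = _ := by rw [hD]; ring
  have hbr1 : ∀ ε ∈ Ioo 0 ε₀, |r1 ε| ≤ (i * C + C0) * D * ε ^ (M + 1) := by
    intro ε hε
    have hε0 := hε.1
    simp only [hr1]
    refine (abs_add_le _ _).trans ?_
    rw [abs_div, abs_div, abs_mul, abs_of_pos hε0, Nat.abs_cast]
    calc i * |r ε| / ε + |q0 ε| / ε
        ≤ i * (C * D * ε ^ (M + 2)) / ε + (C0 * D * ε ^ (M + 2)) / ε := by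
          gcongr
          · exact hb ε hε
          · exact hb0 ε hε
      _ = _ := by field_simp; ring
  refine isSmall_of_le hε₀ (by positivity) hdr hdr1 ?_ ?_
  · intro ε hε
    have hε0 := hε.1
    refine (hbr1 ε hε).trans ?_
    gcongr
    have : 0 ≤ (i * (i * C + C0) + i * C + C1 + C0) * D := by positivity
    linarith
  · intro ε hε
    have hε0 := hε.1
    have h1 : |r2 ε| ≤ i * |r1 ε| / ε + i * |r ε| / ε ^ 2 + |q1 ε| / ε + |q0 ε| / ε ^ 2 := by
      simp only [hr2]
      refine (abs_sub _ _).trans (add_le_add ((abs_add_le _ _).trans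
        (add_le_add ((abs_sub _ _).trans (add_le_add ?_ ?_)) ?_)) ?_)
      all_goals
        simp only [abs_div, abs_mul, abs_pow, Nat.abs_cast, abs_of_pos hε0]
        exact le_rfl
    refine h1.trans ?_
    calc _ ≤ i * ((i * C + C0) * D * ε ^ (M + 1)) / ε + i * (C * D * ε ^ (M + 2)) / ε ^ 2
          + (C1 * D * ε ^ (M + 1)) / ε + (C0 * D * ε ^ (M + 2)) / ε ^ 2 := by
          gcongr
          · exact hbr1 ε hε
          · exact hb ε hε
          · exact hb1 ε hε
          · exact hb0 ε hε
      _ = (i * (i * C + C0) + i * C + C1 + C0) * D * ε ^ M := by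
        field_simp
        ring
      _ ≤ _ := by
        gcongr
        have : 0 ≤ (i * C + C0) * D := by positivity
        linarith

end CollidingWaves

end

noncomputable section

namespace CollidingWaves

open Set MeasureTheory Filter Topology

/-! ### Differentiation of scaled integrals -/

/-- The subtracted terms have poles of order at most `n` at `0`, and the factor `v ^ p` with `p ≥ n`
cancels them. -/
lemma integrableOn_pow_mul_weightTail_Ioc {σ : ℝ} (hσ : σ = 1 ∨ σ = -1) {n p : ℕ} (h : n ≤ p)
    (V : ℝ) : IntegrableOn (fun v => v ^ p * weightTail σ n v) (Ioc 0 V) := by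
  have h1 : IntegrableOn (fun v => v ^ p * weight σ v
      - ∑ l ∈ Finset.range n, binCoeff σ l * v ^ (p - (l + 1))) (Ioc 0 V) := by
    apply (integrableOn_pow_mul_weight hσ p V).sub
    apply IntegrableOn.mono_set _ Ioc_subset_Icc_self
    apply ContinuousOn.integrableOn_Icc
    fun_prop
  refine h1.congr_fun (fun v hv => ?_) measurableSet_Ioc
  have hv0 : v ≠ 0 := hv.1.ne'
  simp only [weightTail, mul_sub, Finset.mul_sum]
  congr 1
  apply Finset.sum_congr rfl
  intro l hl
  rw [Finset.mem_range] at hl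
  rw [show v ^ p = v ^ (p - (l + 1)) * v ^ (l + 1) by rw [← pow_add]; congr 1; omega]
  rw [inv_pow]
  field_simp

/-- This is the borderline power: at infinity the integrand is only `O(1/v)`. With `V = c / ε` it is
the origin of the factor `|ln ε|` in `IsSmall`. -/
lemma exists_integral_weightTail_le {σ : ℝ} (hσ : σ = 1 ∨ σ = -1) (n : ℕ) :
    ∃ C : ℝ, 0 ≤ C ∧ ∀ V : ℝ, 2 ≤ V →
      ∫ v in Ioc 0 V, v ^ n * |weightTail σ n v| ≤ C * (1 + Real.log V) := by
  obtain ⟨C, hC, hb⟩ := exists_abs_weightTail_le (abs_sign hσ) n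
  have hI : ∀ V : ℝ, IntegrableOn (fun v => v ^ n * |weightTail σ n v|) (Ioc 0 V) := by
    intro V
    have h1 : IntegrableOn (fun v => ‖v ^ n * weightTail σ n v‖) (Ioc 0 V) :=
      (integrableOn_pow_mul_weightTail_Ioc hσ (le_refl n) V).norm
    refine h1.congr_fun (fun v hv => ?_) measurableSet_Ioc
    simp only [Real.norm_eq_abs, abs_mul, abs_of_pos (pow_pos hv.1 n)]
  set I2 := ∫ v in Ioc 0 2, v ^ n * |weightTail σ n v| with hI2
  have hI2' : 0 ≤ I2 := by
    apply setIntegral_nonneg measurableSet_Ioc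
    intro v hv
    have := hv.1
    positivity
  refine ⟨I2 + C, by positivity, fun V hV => ?_⟩
  have h1 : Ioc (0 : ℝ) V = Ioc 0 2 ∪ Ioc 2 V := (Ioc_union_Ioc_eq_Ioc (by norm_num) hV).symm
  rw [h1, setIntegral_union (Ioc_disjoint_Ioc_of_le le_rfl) measurableSet_Ioc (hI 2)
    ((hI V).mono_set (Ioc_subset_Ioc_left (by norm_num)))]
  have h0 : ∀ v ∈ uIcc (2 : ℝ) V, v ≠ 0 := fun v hv => by
    rw [uIcc_of_le hV] at hv; linarith [hv.1]
  have hJ : IntegrableOn (fun v : ℝ => C * v⁻¹) (Ioc 2 V) := by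
    rw [← intervalIntegrable_iff_integrableOn_Ioc_of_le hV]
    apply ContinuousOn.intervalIntegrable
    fun_prop (disch := assumption)
  have h2 : ∫ v in Ioc 2 V, v ^ n * |weightTail σ n v| ≤ ∫ v in Ioc 2 V, C * v⁻¹ := by
    apply setIntegral_mono_on ((hI V).mono_set (Ioc_subset_Ioc_left (by norm_num))) hJ
      measurableSet_Ioc
    intro v hv
    have hv0 : 0 < v := by linarith [hv.1]
    calc v ^ n * |weightTail σ n v| ≤ v ^ n * (C * v⁻¹ ^ (n + 1)) := by
          gcongr
          exact hb v hv.1.le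
      _ = C * v⁻¹ := by rw [inv_pow, pow_succ]; field_simp
  rw [integral_const_mul, ← intervalIntegral.integral_of_le (f := fun v : ℝ => v⁻¹) hV,
    integral_inv (fun h => h0 0 h rfl), Real.log_div (by linarith) (by norm_num)] at h2
  have h3 : 0 ≤ Real.log 2 := Real.log_nonneg (by norm_num)
  have h4 : 0 ≤ Real.log V := Real.log_nonneg (by linarith)
  rw [← hI2]
  nlinarith

/-- The hypotheses on a function `f` with derivative `f'` supported in `(0, c]` and flat at `0`. -/
structure FlatPair (c A : ℝ) (p : ℕ) (f f' : ℝ → ℝ) : Prop where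
  hasDerivAt : ∀ t > 0, HasDerivAt f (f' t) t
  bound : ∀ t ∈ Ioc 0 c, |f t| ≤ A * t ^ (p + 1)
  bound' : ∀ t ∈ Ioc 0 c, |f' t| ≤ A * t ^ p
  eq_zero : ∀ t > c, f t = 0
  eq_zero' : ∀ t > c, f' t = 0

lemma aestronglyMeasurable_comp_mul {f f' : ℝ → ℝ} (hd : ∀ t > 0, HasDerivAt f (f' t) t) {ε : ℝ}
    (hε : 0 < ε) :
    AEStronglyMeasurable (fun v => f (ε * v)) (volume.restrict (Ioi 0)) := by
  apply ContinuousOn.aestronglyMeasurable _ measurableSet_Ioi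
  intro v hv
  have : ContinuousAt (fun v => f (ε * v)) v :=
    ContinuousAt.comp (hd (ε * v) (mul_pos hε hv)).continuousAt (by fun_prop)
  exact this.continuousWithinAt

lemma aestronglyMeasurable_deriv_comp_mul {f f' : ℝ → ℝ} (hd : ∀ t > 0, HasDerivAt f (f' t) t)
    {ε : ℝ} (hε : 0 < ε) :
    AEStronglyMeasurable (fun v => f' (ε * v)) (volume.restrict (Ioi 0)) := by
  have h1 : Measurable (fun v => deriv f (ε * v)) :=
    (measurable_deriv f).comp (measurable_const_mul ε)
  refine h1.aestronglyMeasurable.congr ?_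
  filter_upwards [ae_restrict_mem measurableSet_Ioi] with v hv
  exact (hd (ε * v) (mul_pos hε hv)).deriv

/-- Flatness of order `p` turns into `ε ^ p v ^ p`, which raises the power of `v` to exactly `n`;
the support of `f` confines `v` to `(0, c / ε]`. The same dominating function serves the integral
and its derivatives. -/
lemma abs_scaled_le {σ c A ε : ℝ} {m p n : ℕ} (hn : m + p = n)
    (hε : 0 < ε) {f : ℝ → ℝ} (hb : ∀ t ∈ Ioc 0 c, |f t| ≤ A * t ^ p) (hz : ∀ t > c, f t = 0)
    {v : ℝ} (hv : 0 < v) :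
    |v ^ m * f (ε * v) * weightTail σ n v| ≤
      (Ioc 0 (c / ε)).indicator (fun v => A * ε ^ p * (v ^ n * |weightTail σ n v|)) v := by
  by_cases h : v ≤ c / ε
  · rw [indicator_of_mem (show v ∈ Ioc 0 (c / ε) from ⟨hv, h⟩)]
    have h1 : ε * v ≤ c := by rwa [le_div_iff₀' hε] at h
    rw [abs_mul, abs_mul, abs_of_pos (pow_pos hv m)]
    calc v ^ m * |f (ε * v)| * |weightTail σ n v|
        ≤ v ^ m * (A * (ε * v) ^ p) * |weightTail σ n v| := by
          gcongr
          exact hb _ ⟨by positivity, h1⟩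
      _ = _ := by rw [← hn, mul_pow, pow_add]; ring
  · have h1 : c < ε * v := by rwa [not_le, div_lt_iff₀' hε] at h
    rw [hz _ h1, indicator_of_notMem (fun h' => h h'.2)]
    simp

lemma integrable_scaled_bound {σ : ℝ} (hσ : σ = 1 ∨ σ = -1) (n : ℕ) (K V : ℝ) :
    Integrable ((Ioc 0 V).indicator (fun v => K * (v ^ n * |weightTail σ n v|)))
      (volume.restrict (Ioi 0)) := by
  have h1 : IntegrableOn (fun v => K * ‖v ^ n * weightTail σ n v‖) (Ioc 0 V) :=
    (integrableOn_pow_mul_weightTail_Ioc hσ (le_refl n) V).norm.const_mul K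
  have h2 : IntegrableOn (fun v => K * (v ^ n * |weightTail σ n v|)) (Ioc 0 V) := by
    refine h1.congr_fun (fun v hv => ?_) measurableSet_Ioc
    simp only [Real.norm_eq_abs, abs_mul, abs_of_pos (pow_pos hv.1 n)]
  exact ((integrable_indicator_iff measurableSet_Ioc).2 h2).restrict

/-- After scaling, `ε` sits only in the smooth factor. Each derivative trades one order of flatness
for one power of `v`, so the total order `m + 1 + p = n` is preserved and dominated differentiation
applies. -/
lemma hasDerivAt_scaled {σ c A ε : ℝ} (hσ : σ = 1 ∨ σ = -1) {m p n : ℕ} (hn : m + 1 + p = n)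
    (hc : 0 < c) (hA : 0 ≤ A) {f f' : ℝ → ℝ} (hf : FlatPair c A p f f') (hε : 0 < ε) :
    HasDerivAt (fun x => ∫ v in Ioi 0, v ^ m * f (x * v) * weightTail σ n v)
      (∫ v in Ioi 0, v ^ (m + 1) * f' (ε * v) * weightTail σ n v) ε := by
  have hm : ∀ x > 0, AEStronglyMeasurable (fun v => v ^ m * f (x * v) * weightTail σ n v)
      (volume.restrict (Ioi 0)) := fun x hx =>
    ((by fun_prop : AEStronglyMeasurable (fun v : ℝ => v ^ m) (volume.restrict (Ioi 0))).mul
      (aestronglyMeasurable_comp_mul hf.hasDerivAt hx)).mul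
      (measurable_weightTail σ n).aestronglyMeasurable
  have hm' : AEStronglyMeasurable (fun v => v ^ (m + 1) * f' (ε * v) * weightTail σ n v)
      (volume.restrict (Ioi 0)) :=
    ((by fun_prop : AEStronglyMeasurable (fun v : ℝ => v ^ (m + 1)) (volume.restrict (Ioi 0))).mul
      (aestronglyMeasurable_deriv_comp_mul hf.hasDerivAt hε)).mul
      (measurable_weightTail σ n).aestronglyMeasurable
  -- For parameters between `ε / 2` and `2 ε` the supports lie in `(0, c / (ε / 2)]` and the powers
  -- are at most `(2 ε) ^ p`, which gives one bound for the whole neighbourhood.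
  refine (hasDerivAt_integral_of_dominated_loc_of_deriv_le (s := Ioo (ε / 2) (2 * ε))
    (F' := fun x v => v ^ (m + 1) * f' (x * v) * weightTail σ n v)
    (bound := (Ioc 0 (c / (ε / 2))).indicator
      (fun v => A * (2 * ε) ^ p * (v ^ n * |weightTail σ n v|)))
    (Ioo_mem_nhds (by linarith) (by linarith)) ?_ ?_ hm' ?_
    (integrable_scaled_bound hσ n _ _) ?_).2
  · filter_upwards [lt_mem_nhds hε] with x hx using hm x hx
  · refine Integrable.mono' (integrable_scaled_bound hσ n (A * ε ^ (p + 1)) (c / ε)) (hm ε hε) ?_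
    filter_upwards [ae_restrict_mem measurableSet_Ioi] with v hv
    exact abs_scaled_le (by omega) hε hf.bound hf.eq_zero hv
  · filter_upwards [ae_restrict_mem measurableSet_Ioi] with v hv x hx
    have hx0 : 0 < x := by linarith [hx.1]
    refine (abs_scaled_le hn hx0 hf.bound' hf.eq_zero' hv).trans ?_
    have h1 : c / x ≤ c / (ε / 2) := by
      have := hx.1.le
      gcongr
    have hv0 : (0 : ℝ) < v := hv
    have h2 := hx.2.le
    by_cases h : v ≤ c / x
    · rw [indicator_of_mem (show v ∈ Ioc 0 (c / x) from ⟨hv, h⟩),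
        indicator_of_mem (show v ∈ Ioc 0 (c / (ε / 2)) from ⟨hv, h.trans h1⟩)]
      gcongr
    · rw [indicator_of_notMem (fun h' => h h'.2)]
      apply indicator_apply_nonneg
      intro _
      positivity
  · filter_upwards [ae_restrict_mem measurableSet_Ioi] with v hv x hx
    have hx0 : 0 < x := by linarith [hx.1]
    have h1 : HasDerivAt (fun x : ℝ => x * v) v x := by simpa using (hasDerivAt_id x).mul_const v
    have h2 := (hf.hasDerivAt (x * v) (mul_pos hx0 hv)).comp x h1
    refine ((h2.const_mul (v ^ m)).mul_const (weightTail σ n v)).congr_deriv ?_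
    rw [pow_succ]
    ring

lemma abs_integral_scaled_le {σ c A ε : ℝ} (hσ : σ = 1 ∨ σ = -1) {m p n : ℕ} (hn : m + p = n)
    (hε : 0 < ε) {f : ℝ → ℝ} (hb : ∀ t ∈ Ioc 0 c, |f t| ≤ A * t ^ p) (hz : ∀ t > c, f t = 0) :
    |∫ v in Ioi 0, v ^ m * f (ε * v) * weightTail σ n v| ≤
      A * ε ^ p * ∫ v in Ioc 0 (c / ε), v ^ n * |weightTail σ n v| := by
  have h := norm_integral_le_of_norm_le (integrable_scaled_bound hσ n (A * ε ^ p) (c / ε))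
    (f := fun v => v ^ m * f (ε * v) * weightTail σ n v) (by
      filter_upwards [ae_restrict_mem measurableSet_Ioi] with v hv
      exact abs_scaled_le hn hε hb hz hv)
  refine h.trans (le_of_eq ?_)
  rw [integral_indicator measurableSet_Ioc, Measure.restrict_restrict measurableSet_Ioc,
    inter_eq_left.2 (fun v hv => hv.1), integral_const_mul]

lemma exists_isSmall_inner {σ c A ε₀ : ℝ} (hσ : σ = 1 ∨ σ = -1) (M : ℕ) (hc : 0 < c) (hc1 : c ≤ 1)
    (hA : 0 ≤ A) (hε₀ : ε₀ ≤ Real.exp (-1)) (hε₀' : ε₀ ≤ c / 2) :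
    ∃ C : ℝ, 0 ≤ C ∧ ∀ f f' f'' : ℝ → ℝ, FlatPair c A (M + 1) f f' → FlatPair c A M f' f'' →
      IsSmall M C ε₀ (fun ε => ∫ v in Ioi 0, f (ε * v) * weightTail σ (M + 2) v) := by
  obtain ⟨C, hC, hb⟩ := exists_integral_weightTail_le hσ (M + 2)
  refine ⟨A * (C * 2), by positivity, fun f f' f'' hf hf' => ?_⟩
  have hL : ∀ ε ∈ Ioo 0 ε₀, ∫ v in Ioc 0 (c / ε), v ^ (M + 2) * |weightTail σ (M + 2) v|
      ≤ C * 2 * |Real.log ε| := by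
    intro ε hε
    have hε0 := hε.1
    have h1 : 2 ≤ c / ε := by rw [le_div_iff₀ hε0]; linarith [hε.2]
    refine (hb _ h1).trans ?_
    have h2 := one_le_abs_log hε.1 (hε.2.le.trans hε₀)
    have h3 : Real.log (c / ε) ≤ |Real.log ε| := by
      rw [Real.log_div hc.ne' hε0.ne']
      have := Real.log_nonpos hc.le hc1
      have := neg_le_abs (Real.log ε)
      linarith
    calc C * (1 + Real.log (c / ε)) ≤ C * (|Real.log ε| + |Real.log ε|) := by gcongr
      _ = _ := by ring
  refine ⟨fun ε => ∫ v in Ioi 0, v ^ 1 * f' (ε * v) * weightTail σ (M + 2) v,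
    fun ε => ∫ v in Ioi 0, v ^ 2 * f'' (ε * v) * weightTail σ (M + 2) v, fun ε hε => ⟨?_, ?_, ?_, ?_⟩⟩
  · have := hasDerivAt_scaled hσ (m := 0) (n := M + 2) (by omega) hc hA hf hε.1
    simpa using this
  · exact hasDerivAt_scaled hσ (m := 1) (n := M + 2) (by omega) hc hA hf' hε.1
  · have h0 := hε.1
    refine (abs_integral_scaled_le hσ (by omega) hε.1 hf'.bound hf'.eq_zero).trans ?_
    calc _ ≤ A * ε ^ (M + 1) * (C * 2 * |Real.log ε|) := by
          gcongr
          exact hL ε hε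
      _ = _ := by ring
  · have h0 := hε.1
    refine (abs_integral_scaled_le hσ (by omega) hε.1 hf'.bound' hf'.eq_zero').trans ?_
    calc _ ≤ A * ε ^ M * (C * 2 * |Real.log ε|) := by
          gcongr
          exact hL ε hε
      _ = _ := by ring

/-! ### Integrals away from the singularity -/

/-- `∫ g(t) t^(-s) κ(ε/t) dt`, where `κ` is a Taylor remainder of the kernel. -/
def outerIntegral (σ X : ℝ) (g : ℝ → ℝ) (s m n : ℕ) (ε : ℝ) : ℝ :=
  ∫ t in Ioc 0 X, g t * t⁻¹ ^ s * kerTail σ m n (ε / t)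

lemma abs_outer_le {σ c C ε t : ℝ} {g : ℝ → ℝ} {s m n : ℕ} (hc : 0 < c)
    (hC : ∀ z ∈ Icc (0 : ℝ) (1 / 2), |kerTail σ m n z| ≤ C * z ^ n) (hC0 : 0 ≤ C)
    (hg : ∀ t < c, g t = 0) (hε : ε ∈ Ioo 0 (c / 2)) :
    ‖g t * t⁻¹ ^ s * kerTail σ m n (ε / t)‖ ≤ |g t| * (c⁻¹ ^ (s + n) * C * ε ^ n) := by
  rcases lt_or_ge t c with h | h
  · simp [hg t h]
  · have ht : 0 < t := hc.trans_le h
    have hε0 := hε.1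
    have h1 : ε / t ∈ Icc (0 : ℝ) (1 / 2) := by
      refine ⟨by positivity, ?_⟩
      rw [div_le_iff₀ ht]
      linarith [hε.2]
    have h2 : t⁻¹ ≤ c⁻¹ := inv_anti₀ hc h
    rw [Real.norm_eq_abs, abs_mul, abs_mul, abs_of_pos (a := t⁻¹ ^ s) (by positivity), mul_assoc]
    refine mul_le_mul_of_nonneg_left ?_ (abs_nonneg _)
    calc t⁻¹ ^ s * |kerTail σ m n (ε / t)| ≤ t⁻¹ ^ s * (C * (ε / t) ^ n) := by
          gcongr
          exact hC _ h1
      _ = t⁻¹ ^ (s + n) * C * ε ^ n := by rw [div_eq_mul_inv, mul_pow, pow_add]; ring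
      _ ≤ _ := by gcongr

/-- Where `g` does not vanish, `t ≥ c` keeps `ε / t` in `[0, 1/2]`, so the kernel remainder may be
differentiated in `ε`. No smoothness of `g` is involved: one order of the remainder is exchanged for
a factor `1/t`. -/
lemma hasDerivAt_outerIntegral {σ c X ε : ℝ} {g : ℝ → ℝ} {s m n : ℕ} (hσ : |σ| ≤ 1) (hc : 0 < c)
    (hI : IntegrableOn g (Ioc 0 X)) (hg : ∀ t < c, g t = 0) (hε : ε ∈ Ioo 0 (c / 2)) :
    HasDerivAt (outerIntegral σ X g s m (n + 1)) (outerIntegral σ X g (s + 1) (m + 1) n ε) ε := by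
  obtain ⟨C, hC0, hC⟩ := exists_abs_kerTail_le hσ m (n + 1)
  obtain ⟨C', hC0', hC'⟩ := exists_abs_kerTail_le hσ (m + 1) n
  have hm : ∀ x : ℝ, ∀ s m n : ℕ, AEStronglyMeasurable
      (fun t => g t * t⁻¹ ^ s * kerTail σ m n (x / t)) (volume.restrict (Ioc 0 X)) := by
    intro x s m n
    refine (hI.aestronglyMeasurable.mul (by fun_prop)).mul ?_
    exact ((measurable_kerTail σ m n).comp (by fun_prop)).aestronglyMeasurable
  refine (hasDerivAt_integral_of_dominated_loc_of_deriv_le (s := Ioo 0 (c / 2))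
    (F' := fun x t => g t * t⁻¹ ^ (s + 1) * kerTail σ (m + 1) n (x / t))
    (bound := fun t => |g t| * (c⁻¹ ^ (s + 1 + n) * C' * (c / 2) ^ n))
    (Ioo_mem_nhds hε.1 hε.2) (Eventually.of_forall fun x => hm x s m (n + 1)) ?_
    (hm ε (s + 1) (m + 1) n) ?_ (hI.norm.mul_const _) ?_).2
  · refine Integrable.mono' (hI.norm.mul_const (c⁻¹ ^ (s + (n + 1)) * C * ε ^ (n + 1)))
      (hm ε s m (n + 1)) (Eventually.of_forall fun t => abs_outer_le hc hC hC0 hg hε)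
  · refine Eventually.of_forall fun t x hx => (abs_outer_le hc hC' hC0' hg hx).trans ?_
    have := hx.1
    have := hx.2.le
    gcongr
  · refine Eventually.of_forall fun t x hx => ?_
    rcases lt_or_ge t c with h | h
    · simp only [hg t h, zero_mul]
      exact hasDerivAt_const _ _
    · have ht : 0 < t := hc.trans_le h
      have h1 : x / t ∈ Icc (0 : ℝ) (1 / 2) := by
        refine ⟨(div_pos hx.1 ht).le, ?_⟩
        rw [div_le_iff₀ ht]
        linarith [hx.2]
      have h2 := (hasDerivAt_kerTail hσ h1 m n).comp x ((hasDerivAt_id x).div_const t)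
      refine (h2.const_mul (g t * t⁻¹ ^ s)).congr_deriv ?_
      rw [pow_succ, one_div]
      ring

lemma exists_isSmall_outer {σ c B ε₀ : ℝ} (hσ : |σ| ≤ 1) (M : ℕ) (hc : 0 < c)
    (hB : 0 ≤ B) (hε₀ : ε₀ ≤ Real.exp (-1)) (hε₀' : ε₀ ≤ c / 2) :
    ∃ C : ℝ, 0 ≤ C ∧ ∀ (X : ℝ) (g : ℝ → ℝ), IntegrableOn g (Ioc 0 X) → (∀ t < c, g t = 0) →
      ∫ t in Ioc 0 X, |g t| ≤ B → IsSmall M C ε₀ (outerIntegral σ X g 1 0 (M + 2)) := by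
  obtain ⟨C1, hC1, h1⟩ := exists_abs_kerTail_le hσ 1 (M + 1)
  obtain ⟨C2, hC2, h2⟩ := exists_abs_kerTail_le hσ 2 M
  refine ⟨B * (c⁻¹ ^ (M + 3) * C1) + B * (c⁻¹ ^ (M + 3) * C2), by positivity,
    fun X g hI hg hgB => ?_⟩
  have hmem : ∀ ε ∈ Ioo 0 ε₀, ε ∈ Ioo 0 (c / 2) := fun ε hε => ⟨hε.1, hε.2.trans_le hε₀'⟩
  have hbd : ∀ (s m n : ℕ) (C : ℝ), 0 ≤ C →
      (∀ z ∈ Icc (0 : ℝ) (1 / 2), |kerTail σ m n z| ≤ C * z ^ n) → ∀ ε ∈ Ioo 0 ε₀,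
      |outerIntegral σ X g s m n ε| ≤ B * (c⁻¹ ^ (s + n) * C) * ε ^ n := by
    intro s m n C hC h ε hε
    have hε0 := hε.1
    have h3 := norm_integral_le_of_norm_le (hI.norm.mul_const (c⁻¹ ^ (s + n) * C * ε ^ n))
      (f := fun t => g t * t⁻¹ ^ s * kerTail σ m n (ε / t))
      (Eventually.of_forall fun t => abs_outer_le hc h hC hg (hmem ε hε))
    rw [integral_mul_const] at h3
    refine h3.trans ?_
    calc _ ≤ B * (c⁻¹ ^ (s + n) * C * ε ^ n) := by gcongr; exact hgB
      _ = _ := by ring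
  refine isSmall_of_le hε₀ (by positivity)
    (r1 := outerIntegral σ X g 2 1 (M + 1)) (r2 := outerIntegral σ X g 3 2 M)
    (fun ε hε => hasDerivAt_outerIntegral hσ hc hI hg (hmem ε hε))
    (fun ε hε => hasDerivAt_outerIntegral hσ hc hI hg (hmem ε hε)) ?_ ?_
  · intro ε hε
    have hε0 := hε.1
    refine (hbd 2 1 (M + 1) C1 hC1 h1 ε hε).trans ?_
    rw [show 2 + (M + 1) = M + 3 by omega]
    gcongr
    have : 0 ≤ B * (c⁻¹ ^ (M + 3) * C2) := by positivity
    linarith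
  · intro ε hε
    have hε0 := hε.1
    refine (hbd 3 2 M C2 hC2 h2 ε hε).trans ?_
    rw [show 3 + M = M + 3 by omega]
    gcongr
    have : 0 ≤ B * (c⁻¹ ^ (M + 3) * C1) := by positivity
    linarith

end CollidingWaves

end

noncomputable section

namespace CollidingWaves

open Set MeasureTheory Filter Topology

/-! ### The expansion of `∫ a(t) / √(t (t - σ ε)) dt` -/

/-- The kernel `1 / √(t (t - σ ε))`. -/
def kern (σ ε t : ℝ) : ℝ := 1 / (√(t - σ * ε) * √t)

/-- The kernel minus the first `n` terms of its expansion in powers of `ε`. -/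
def kernTail (σ : ℝ) (n : ℕ) (ε t : ℝ) : ℝ :=
  kern σ ε t - ∑ l ∈ Finset.range n, binCoeff σ l * ε ^ l * t⁻¹ ^ (l + 1)

lemma measurable_kern (σ ε : ℝ) : Measurable (kern σ ε) := by
  unfold kern
  fun_prop

lemma kern_scale {ε : ℝ} (hε : 0 < ε) (σ v : ℝ) : kern σ ε (ε * v) = ε⁻¹ * weight σ v := by
  unfold kern weight
  rw [show ε * v - σ * ε = ε * (v - σ) by ring, Real.sqrt_mul hε.le, Real.sqrt_mul hε.le]
  have := Real.mul_self_sqrt hε.le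
  rw [show √ε * √(v - σ) * (√ε * √v) = (√ε * √ε) * (√(v - σ) * √v) by ring, this,
    one_div, one_div, mul_inv]

lemma kernTail_scale {ε v : ℝ} (hε : 0 < ε) (σ : ℝ) (n : ℕ) :
    kernTail σ n ε (ε * v) = ε⁻¹ * weightTail σ n v := by
  unfold kernTail weightTail
  rw [kern_scale hε, mul_sub, Finset.mul_sum]
  congr 1
  apply Finset.sum_congr rfl
  intro l _
  rw [mul_inv, mul_pow, pow_succ ε⁻¹ l, inv_pow ε l]
  field_simp

lemma integrableOn_kern {σ ε : ℝ} (hσ : σ = 1 ∨ σ = -1) (hε : 0 < ε) {V : ℝ} (hV : 0 < V) :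
    IntegrableOn (kern σ ε) (Ioc 0 V) := by
  have h1 := integrableOn_weight hσ (V / ε)
  rw [← intervalIntegrable_iff_integrableOn_Ioc_of_le (by positivity)] at h1 ⊢
  have h2 := (h1.comp_mul_left (c := ε⁻¹)).const_mul ε⁻¹
  rw [zero_div, div_inv_eq_mul, div_mul_cancel₀ _ hε.ne'] at h2
  refine h2.congr (fun t _ => ?_)
  rw [← kern_scale hε, mul_inv_cancel_left₀ hε.ne']

lemma integral_pow_mul_kern {σ ε X : ℝ} (hε : 0 < ε) (hX : 0 < X) (i : ℕ) :
    ∫ t in Ioc 0 X, t ^ i * kern σ ε t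
      = ε ^ i * ∫ v in (0 : ℝ)..(X / ε), v ^ i * weight σ v := by
  have h1 := intervalIntegral.integral_comp_mul_left (a := 0) (b := X / ε)
    (fun t => t ^ i * kern σ ε t) hε.ne'
  rw [mul_zero, mul_div_cancel₀ _ hε.ne', smul_eq_mul] at h1
  rw [← intervalIntegral.integral_of_le hX.le]
  have h2 : ∀ v : ℝ, (ε * v) ^ i * kern σ ε (ε * v) = (ε ^ i * ε⁻¹) * (v ^ i * weight σ v) := by
    intro v
    rw [kern_scale hε, mul_pow]
    ring
  simp_rw [h2] at h1
  rw [intervalIntegral.integral_const_mul] at h1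
  field_simp at h1
  linarith

/-! ### Taylor data at the singular endpoint and finite-part integrals. -/

/-- A function `ad 0` on `(0, X]` with `n` derivatives bounded by `B` on `[0, c]`. -/
structure TaylorData (n : ℕ) (c B X : ℝ) (ad : ℕ → ℝ → ℝ) : Prop where
  le_X : c ≤ X
  X_le : X ≤ 1
  integrableOn : IntegrableOn (ad 0) (Ioc 0 X)
  integral_le : ∫ t in Ioc 0 X, |ad 0 t| ≤ B
  hasDerivAt : ∀ i < n, ∀ t ∈ Icc 0 c, HasDerivAt (ad i) (ad (i + 1) t) t
  bound : ∀ i ≤ n, ∀ t ∈ Icc 0 c, |ad i t| ≤ B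

/-- The Taylor coefficients at `0`. -/
def taylorCoef (ad : ℕ → ℝ → ℝ) (l : ℕ) : ℝ := ad l 0 / (l.factorial : ℝ)

/-- The finite part of `∫_0^X a(t) t^(-j-1) dt`, where `ac` are the Taylor coefficients of `a`. -/
def finitePart (a : ℝ → ℝ) (ac : ℕ → ℝ) (X : ℝ) (j : ℕ) : ℝ :=
  (∫ t in Ioc 0 X, (a t - ∑ l ∈ Finset.range (j + 1), ac l * t ^ l) * t⁻¹ ^ (j + 1))
    + ∑ l ∈ Finset.range (j + 1), ac l * powPrim l j X

/-- The coefficient of `ε^j` in the expansion. -/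
def regCoef (σ : ℝ) (a : ℝ → ℝ) (ac : ℕ → ℝ) (X : ℝ) (j : ℕ) : ℝ :=
  binCoeff σ j * finitePart a ac X j + ac j * weightConst σ j

/-- The coefficient of `ε^j ln ε` in the expansion. -/
def logCoef (σ : ℝ) (ac : ℕ → ℝ) (j : ℕ) : ℝ := -(binCoeff σ j * ac j)

namespace TaylorData

variable {n : ℕ} {c B X : ℝ} {ad : ℕ → ℝ → ℝ}

lemma abs_tail_le (h : TaylorData n c B X ad) {m k : ℕ} (hmk : m + k = n) {t : ℝ}
    (ht : t ∈ Icc 0 c) : |taylorTail (fun i => ad (i + m)) k t| ≤ B * t ^ k := by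
  refine abs_taylorTail_le k (fun i hi t ht => ?_) (fun t ht => h.bound (k + m) (by omega) t ht) t ht
  have := h.hasDerivAt (i + m) (by omega) t ht
  rwa [show i + m + 1 = i + 1 + m by omega] at this

lemma hasDerivAt_tail (h : TaylorData n c B X ad) {m k : ℕ} (hmk : m < n) {t : ℝ}
    (ht : t ∈ Icc 0 c) : HasDerivAt (taylorTail (fun i => ad (i + m)) (k + 1))
      (taylorTail (fun i => ad (i + (m + 1))) k t) t := by
  have := hasDerivAt_taylorTail (ad := fun i => ad (i + m)) (n := k) (t := t)
    (by simpa [add_comm] using h.hasDerivAt m hmk t ht)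
  refine this.congr_deriv ?_
  simp only [add_assoc, add_comm 1 m]

lemma abs_taylorCoef_le (h : TaylorData n c B X ad) (hc : 0 ≤ c) {l : ℕ} (hl : l ≤ n) :
    |taylorCoef ad l| ≤ B := by
  have h1 := h.bound l hl 0 ⟨le_rfl, hc⟩
  unfold taylorCoef
  rw [abs_div, Nat.abs_cast]
  have h2 : (1 : ℝ) ≤ l.factorial := by exact_mod_cast Nat.succ_le_of_lt l.factorial_pos
  exact (div_le_self (abs_nonneg _) h2).trans h1

lemma tail_eq (ad : ℕ → ℝ → ℝ) (n : ℕ) (t : ℝ) :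
    taylorTail ad n t = ad 0 t - ∑ l ∈ Finset.range n, taylorCoef ad l * t ^ l := rfl

lemma integrableOn_tail (h : TaylorData n c B X ad) : IntegrableOn (taylorTail ad n) (Ioc 0 X) := by
  apply h.integrableOn.sub
  apply IntegrableOn.mono_set _ Ioc_subset_Icc_self
  apply ContinuousOn.integrableOn_Icc
  fun_prop

lemma integral_tail_le (h : TaylorData n c B X ad) (hc : 0 < c) (hB : 0 ≤ B) :
    ∫ t in Ioc 0 X, |taylorTail ad n t| ≤ (n + 1) * B := by
  have hX : 0 < X := hc.trans_le h.le_X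
  have h1 : ∫ t in Ioc 0 X, |taylorTail ad n t| ≤ ∫ t in Ioc 0 X, (|ad 0 t| + n * B) := by
    refine setIntegral_mono_on h.integrableOn_tail.abs
      (h.integrableOn.abs.add (integrableOn_const (by simp))) measurableSet_Ioc (fun t ht => ?_)
    rw [tail_eq]
    refine (abs_sub _ _).trans (add_le_add_right ?_ _)
    refine (Finset.abs_sum_le_sum_abs _ _).trans ?_
    calc _ ≤ ∑ l ∈ Finset.range n, B := by
          apply Finset.sum_le_sum
          intro l hl
          rw [Finset.mem_range] at hl
          rw [abs_mul, abs_pow, abs_of_pos ht.1]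
          have h2 : t ^ l ≤ 1 := pow_le_one₀ ht.1.le (ht.2.trans h.X_le)
          have h3 := h.abs_taylorCoef_le hc.le hl.le
          have := ht.1
          calc _ ≤ B * 1 := by gcongr
            _ = B := mul_one B
      _ = n * B := by simp
  refine h1.trans ?_
  have h4 := h.integral_le
  have h5 : X * (n * B) ≤ 1 * (n * B) := by
    have := h.X_le
    gcongr
  rw [integral_add h.integrableOn.abs (integrableOn_const (by simp)), setIntegral_const]
  simp only [measureReal_def, Real.volume_Ioc, sub_zero, smul_eq_mul, ENNReal.toReal_ofReal hX.le]
  linarith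

/-- On `(0, c]` the order `n` of flatness absorbs the pole; beyond `c` the pole is at most `c⁻¹ ^
n`, since `c ≤ 1`. -/
lemma abs_tail_mul_inv_le (h : TaylorData n c B X ad) (hc : 0 < c) (hB : 0 ≤ B)
    {j : ℕ} (hj : j < n) {t : ℝ} (ht : 0 < t) :
    ‖taylorTail ad n t * t⁻¹ ^ (j + 1)‖ ≤ B + c⁻¹ ^ n * |taylorTail ad n t| := by
  have hc1 : c ≤ 1 := h.le_X.trans h.X_le
  have hc2 : 1 ≤ c⁻¹ := (one_le_inv₀ hc).2 hc1
  rw [Real.norm_eq_abs, abs_mul, abs_of_pos (a := t⁻¹ ^ (j + 1)) (by positivity)]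
  rcases le_or_gt t c with h1 | h1
  · have h2 : |taylorTail ad n t| ≤ B * t ^ n := h.abs_tail_le (m := 0) (zero_add n) ⟨ht.le, h1⟩
    have h3 : |taylorTail ad n t| * t⁻¹ ^ (j + 1) ≤ B := by
      calc |taylorTail ad n t| * t⁻¹ ^ (j + 1) ≤ (B * t ^ n) * t⁻¹ ^ (j + 1) := by gcongr
        _ = B * t ^ (n - (j + 1)) := by
          rw [show t ^ n = t ^ (n - (j + 1)) * t ^ (j + 1) by rw [← pow_add]; congr 1; omega,
            inv_pow]
          field_simp
        _ ≤ B * 1 := by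
          gcongr
          exact pow_le_one₀ ht.le (h1.trans hc1)
        _ = B := mul_one B
    have : 0 ≤ c⁻¹ ^ n * |taylorTail ad n t| := by positivity
    linarith
  · have h2 : t⁻¹ ^ (j + 1) ≤ c⁻¹ ^ n :=
      (pow_le_pow_left₀ (by positivity) (inv_anti₀ hc h1.le) _).trans
        (pow_le_pow_right₀ hc2 (by omega))
    have : |taylorTail ad n t| * t⁻¹ ^ (j + 1) ≤ |taylorTail ad n t| * c⁻¹ ^ n := by gcongr
    linarith

lemma integrableOn_tail_mul_inv (h : TaylorData n c B X ad) (hc : 0 < c) (hB : 0 ≤ B)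
    {j : ℕ} (hj : j < n) :
    IntegrableOn (fun t => taylorTail ad n t * t⁻¹ ^ (j + 1)) (Ioc 0 X) := by
  refine Integrable.mono' (g := fun t => B + c⁻¹ ^ n * |taylorTail ad n t|)
    ((integrableOn_const (by simp)).add (h.integrableOn_tail.abs.const_mul _))
    (h.integrableOn_tail.aestronglyMeasurable.mul (by fun_prop)) ?_
  filter_upwards [ae_restrict_mem measurableSet_Ioc] with t ht
  exact h.abs_tail_mul_inv_le hc hB hj ht.1

lemma abs_integral_tail_mul_inv_le (h : TaylorData n c B X ad) (hc : 0 < c) (hB : 0 ≤ B)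
    {j : ℕ} (hj : j < n) :
    |∫ t in Ioc 0 X, taylorTail ad n t * t⁻¹ ^ (j + 1)| ≤ B + c⁻¹ ^ n * ((n + 1) * B) := by
  have hX : 0 < X := hc.trans_le h.le_X
  have h1 := norm_integral_le_of_norm_le (μ := volume.restrict (Ioc 0 X))
    (f := fun t => taylorTail ad n t * t⁻¹ ^ (j + 1))
    (g := fun t => B + c⁻¹ ^ n * |taylorTail ad n t|)
    ((integrableOn_const (by simp)).add (h.integrableOn_tail.abs.const_mul _)) (by
      filter_upwards [ae_restrict_mem measurableSet_Ioc] with t ht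
      exact h.abs_tail_mul_inv_le hc hB hj ht.1)
  refine h1.trans ?_
  have hconst : Integrable (fun _ : ℝ => B) (volume.restrict (Ioc 0 X)) :=
    integrableOn_const (by simp)
  rw [integral_add hconst (h.integrableOn_tail.abs.const_mul _),
    setIntegral_const, integral_const_mul]
  simp only [measureReal_def, Real.volume_Ioc, sub_zero, smul_eq_mul, ENNReal.toReal_ofReal hX.le]
  have h2 := h.integral_tail_le hc hB
  have h3 : X * B ≤ 1 * B := by
    have := h.X_le
    gcongr
  have h4 : c⁻¹ ^ n * ∫ t in Ioc 0 X, |taylorTail ad n t| ≤ c⁻¹ ^ n * ((n + 1) * B) := by gcongr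
  linarith

/-- A finite part does not depend on how many Taylor terms are subtracted, provided there are
enough: those of index above `j` leave nonnegative powers, whose integrals over `(0, X]` are the
values of `powPrim`. One tail of order `n` then serves all `j`. -/
lemma finitePart_eq (h : TaylorData n c B X ad) (hc : 0 < c) (hB : 0 ≤ B) {j : ℕ} (hj : j < n) :
    finitePart (ad 0) (taylorCoef ad) X j = (∫ t in Ioc 0 X, taylorTail ad n t * t⁻¹ ^ (j + 1))
      + ∑ l ∈ Finset.range n, taylorCoef ad l * powPrim l j X := by
  have hX : 0 < X := hc.trans_le h.le_X
  have h1 : ∀ t ∈ Ioc 0 X, (ad 0 t - ∑ l ∈ Finset.range (j + 1), taylorCoef ad l * t ^ l)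
      * t⁻¹ ^ (j + 1) = taylorTail ad n t * t⁻¹ ^ (j + 1)
        + ∑ l ∈ Finset.Ico (j + 1) n, taylorCoef ad l * t ^ (l - (j + 1)) := by
    intro t ht
    have ht0 : t ≠ 0 := ht.1.ne'
    rw [tail_eq, ← Finset.sum_range_add_sum_Ico _ (show j + 1 ≤ n by omega)]
    have h2 : ∑ l ∈ Finset.Ico (j + 1) n, taylorCoef ad l * t ^ (l - (j + 1))
        = (∑ l ∈ Finset.Ico (j + 1) n, taylorCoef ad l * t ^ l) * t⁻¹ ^ (j + 1) := by
      rw [Finset.sum_mul]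
      apply Finset.sum_congr rfl
      intro l hl
      rw [Finset.mem_Ico] at hl
      rw [show t ^ l = t ^ (l - (j + 1)) * t ^ (j + 1) by rw [← pow_add]; congr 1; omega, inv_pow]
      field_simp
    rw [h2]
    ring
  have hI : ∀ l ∈ Finset.Ico (j + 1) n,
      Integrable (fun t : ℝ => taylorCoef ad l * t ^ (l - (j + 1))) (volume.restrict (Ioc 0 X)) := by
    intro l _
    apply IntegrableOn.mono_set _ Ioc_subset_Icc_self
    apply ContinuousOn.integrableOn_Icc
    fun_prop
  unfold finitePart
  rw [setIntegral_congr_fun measurableSet_Ioc h1,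
    integral_add (h.integrableOn_tail_mul_inv hc hB hj) (integrable_finsetSum _ hI),
    integral_finsetSum _ hI, ← Finset.sum_range_add_sum_Ico _ (show j + 1 ≤ n by omega)]
  have h3 : ∀ l ∈ Finset.Ico (j + 1) n,
      ∫ t in Ioc 0 X, taylorCoef ad l * t ^ (l - (j + 1)) = taylorCoef ad l * powPrim l j X := by
    intro l hl
    rw [Finset.mem_Ico] at hl
    rw [integral_const_mul, ← intervalIntegral.integral_of_le hX.le, integral_pow]
    unfold powPrim
    rw [if_neg (by omega), zero_pow (by omega), sub_zero, ← zpow_natCast]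
    have e1 : ((l - (j + 1) + 1 : ℕ) : ℤ) = (l : ℤ) - j := by omega
    have e2 : ((l - (j + 1) : ℕ) : ℝ) + 1 = (l : ℝ) - j := by
      rw [Nat.cast_sub (by omega)]; push_cast; ring
    rw [e1, e2]
  rw [Finset.sum_congr rfl h3]
  ring

end TaylorData

end CollidingWaves

end

noncomputable section

namespace CollidingWaves

open Set MeasureTheory Filter Topology

/-! ### Cutoff splitting of the remainder and the expansion of the singular integral. -/

/-- A cutoff function at scale `c` with its first two derivatives. -/
structure IsCutoff (c D : ℝ) (χ χ1 χ2 : ℝ → ℝ) : Prop where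
  hasDerivAt : ∀ t, HasDerivAt χ (χ1 t) t
  hasDerivAt1 : ∀ t, HasDerivAt χ1 (χ2 t) t
  eq_one : ∀ t < c / 4, χ t = 1
  eq_zero : ∀ t > c / 2, χ t = 0
  eq_zero1 : ∀ t > c / 2, χ1 t = 0
  eq_zero2 : ∀ t > c / 2, χ2 t = 0
  mem : ∀ t, χ t ∈ Icc (0 : ℝ) 1
  bound1 : ∀ t ∈ Icc 0 c, |χ1 t| ≤ D
  bound2 : ∀ t ∈ Icc 0 c, |χ2 t| ≤ D

lemma exists_isCutoff {c : ℝ} (hc : 0 < c) :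
    ∃ (D : ℝ) (χ χ1 χ2 : ℝ → ℝ), 1 ≤ D ∧ IsCutoff c D χ χ1 χ2 := by
  -- The affine argument is at least `1` for `t ≤ c / 4` and at most `0` for `t ≥ c / 2`.
  set χ : ℝ → ℝ := fun t => Real.smoothTransition (2 - 4 * t / c) with hχ
  have hs : ContDiff ℝ 3 χ := by
    have h1 : ContDiff ℝ 3 (fun t : ℝ => 2 - 4 * t / c) := by fun_prop
    exact Real.smoothTransition.contDiff.comp h1
  have hs1 : ContDiff ℝ 2 (deriv χ) := by
    have : ContDiff ℝ (2 + 1) χ := by norm_num; exact hs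
    exact (contDiff_succ_iff_deriv.1 this).2.2
  have hs2 : ContDiff ℝ 1 (deriv (deriv χ)) := by
    have : ContDiff ℝ (1 + 1) (deriv χ) := by norm_num; exact hs1
    exact (contDiff_succ_iff_deriv.1 this).2.2
  obtain ⟨D1, hD1⟩ := isCompact_Icc.exists_bound_of_continuousOn (s := Icc 0 c)
    hs1.continuous.continuousOn
  obtain ⟨D2, hD2⟩ := isCompact_Icc.exists_bound_of_continuousOn (s := Icc 0 c)
    hs2.continuous.continuousOn
  have hz : ∀ t > c / 2, χ t = 0 := by
    intro t ht
    apply Real.smoothTransition.zero_of_nonpos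
    have : 2 ≤ 4 * t / c := by
      rw [le_div_iff₀ hc]; linarith
    linarith
  have hz1 : ∀ t > c / 2, deriv χ t = 0 := by
    intro t ht
    have : χ =ᶠ[𝓝 t] fun _ => 0 := by
      filter_upwards [lt_mem_nhds ht] with s hs using hz s hs
    rw [this.deriv_eq]
    simp
  refine ⟨max 1 (max D1 D2), χ, deriv χ, deriv (deriv χ), le_max_left _ _,
    fun t => (hs.differentiable (by norm_num) t).hasDerivAt,
    fun t => (hs1.differentiable (by norm_num) t).hasDerivAt, ?_, hz, hz1, ?_,
    fun t => ⟨Real.smoothTransition.nonneg _, Real.smoothTransition.le_one _⟩,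
    fun t ht => (hD1 t ht).trans ((le_max_left _ _).trans (le_max_right _ _)),
    fun t ht => (hD2 t ht).trans ((le_max_right _ _).trans (le_max_right _ _))⟩
  · intro t ht
    apply Real.smoothTransition.one_of_one_le
    have : 4 * t / c ≤ 1 := by
      rw [div_le_iff₀ hc]; linarith
    linarith
  · intro t ht
    have : deriv χ =ᶠ[𝓝 t] fun _ => 0 := by
      filter_upwards [lt_mem_nhds ht] with s hs using hz1 s hs
    rw [this.deriv_eq]
    simp

namespace TaylorData

variable {M : ℕ} {c B X D : ℝ} {ad : ℕ → ℝ → ℝ} {χ χ1 χ2 : ℝ → ℝ}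

/-- The product rule applied to tail times cutoff. The constant `4 B D` comes from the weights `1 +
2 + 1` in the second derivative, the higher powers of `t` being absorbed by `t ≤ 1`. From `t = c`
on, where the Taylor data no longer give derivatives, the product vanishes in a neighbourhood. -/
lemma flatPair (h : TaylorData (M + 2) c B X ad) (hχ : IsCutoff c D χ χ1 χ2) (hc : 0 < c)
    (hB : 0 ≤ B) (hD : 1 ≤ D) :
    FlatPair c (4 * B * D) (M + 1) (fun t => taylorTail ad (M + 2) t * χ t)
      (fun t => taylorTail (fun i => ad (i + 1)) (M + 1) t * χ t
        + taylorTail ad (M + 2) t * χ1 t) ∧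
    FlatPair c (4 * B * D) M (fun t => taylorTail (fun i => ad (i + 1)) (M + 1) t * χ t
        + taylorTail ad (M + 2) t * χ1 t)
      (fun t => taylorTail (fun i => ad (i + 2)) M t * χ t
        + 2 * (taylorTail (fun i => ad (i + 1)) (M + 1) t * χ1 t)
        + taylorTail ad (M + 2) t * χ2 t) := by
  set H0 := taylorTail ad (M + 2) with hH0
  set H1 := taylorTail (fun i => ad (i + 1)) (M + 1) with hH1
  set H2 := taylorTail (fun i => ad (i + 2)) M with hH2
  have hc1 : c ≤ 1 := h.le_X.trans h.X_le
  have b0 : ∀ t ∈ Icc 0 c, |H0 t| ≤ B * t ^ (M + 2) := fun t ht =>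
    h.abs_tail_le (m := 0) (by omega) ht
  have b1 : ∀ t ∈ Icc 0 c, |H1 t| ≤ B * t ^ (M + 1) := fun t ht =>
    h.abs_tail_le (m := 1) (by omega) ht
  have b2 : ∀ t ∈ Icc 0 c, |H2 t| ≤ B * t ^ M := fun t ht =>
    h.abs_tail_le (m := 2) (by omega) ht
  have d0 : ∀ t ∈ Icc 0 c, HasDerivAt H0 (H1 t) t := fun t ht =>
    h.hasDerivAt_tail (m := 0) (by omega) ht
  have d1 : ∀ t ∈ Icc 0 c, HasDerivAt H1 (H2 t) t := fun t ht =>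
    h.hasDerivAt_tail (m := 1) (by omega) ht
  have c0 : ∀ t, |χ t| ≤ D := fun t => by
    rw [abs_of_nonneg (hχ.mem t).1]
    exact (hχ.mem t).2.trans hD
  have zc : ∀ t ≥ c, t > c / 2 := fun t ht => by linarith
  have hp : ∀ t ∈ Icc 0 c, ∀ k l : ℕ, k ≤ l → t ^ l ≤ t ^ k := fun t ht k l hkl =>
    pow_le_pow_of_le_one ht.1 (ht.2.trans hc1) hkl
  have z1 : ∀ t > c / 2, H1 t * χ t + H0 t * χ1 t = 0 := fun t ht => by
    rw [hχ.eq_zero t ht, hχ.eq_zero1 t ht]; ring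
  have bd1 : ∀ t ∈ Ioc 0 c, |H1 t * χ t + H0 t * χ1 t| ≤ 4 * B * D * t ^ (M + 1) := by
    intro t ht
    have ht' : t ∈ Icc 0 c := ⟨ht.1.le, ht.2⟩
    have ht0 := ht.1
    refine (abs_add_le _ _).trans ?_
    rw [abs_mul, abs_mul]
    calc _ ≤ B * t ^ (M + 1) * D + B * t ^ (M + 1) * D := by
          gcongr
          · exact b1 t ht'
          · exact c0 t
          · exact (b0 t ht').trans (mul_le_mul_of_nonneg_left (hp t ht' _ _ (by omega)) hB)
          · exact hχ.bound1 t ht'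
      _ ≤ _ := by
        have : 0 ≤ B * t ^ (M + 1) * D := by positivity
        linarith
  refine ⟨⟨?_, ?_, bd1, ?_, fun t ht => z1 t (zc t (le_of_lt ht))⟩,
    ⟨?_, bd1, ?_, fun t ht => z1 t (zc t (le_of_lt ht)), ?_⟩⟩
  · intro t ht
    rcases lt_or_ge t c with h1 | h1
    · exact (d0 t ⟨ht.le, h1.le⟩).mul (hχ.hasDerivAt t)
    · rw [z1 t (zc t h1)]
      refine (hasDerivAt_const t (0 : ℝ)).congr_of_eventuallyEq ?_
      filter_upwards [lt_mem_nhds (zc t h1)] with s hs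
      simp [hχ.eq_zero s hs]
  · intro t ht
    have ht' : t ∈ Icc 0 c := ⟨ht.1.le, ht.2⟩
    have ht0 := ht.1
    rw [abs_mul]
    calc _ ≤ B * t ^ (M + 1 + 1) * D := by
          gcongr
          · exact b0 t ht'
          · exact c0 t
      _ ≤ _ := by
        have : 0 ≤ B * t ^ (M + 1 + 1) * D := by positivity
        linarith
  · intro t ht
    simp [hχ.eq_zero t (zc t (le_of_lt ht))]
  · intro t ht
    rcases lt_or_ge t c with h1 | h1
    · have ht' : t ∈ Icc 0 c := ⟨ht.le, h1.le⟩
      refine (((d1 t ht').mul (hχ.hasDerivAt t)).add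
        ((d0 t ht').mul (hχ.hasDerivAt1 t))).congr_deriv ?_
      ring
    · rw [hχ.eq_zero t (zc t h1), hχ.eq_zero1 t (zc t h1), hχ.eq_zero2 t (zc t h1)]
      simp only [mul_zero, add_zero]
      refine (hasDerivAt_const t (0 : ℝ)).congr_of_eventuallyEq ?_
      filter_upwards [lt_mem_nhds (zc t h1)] with s hs
      exact z1 s hs
  · intro t ht
    have ht' : t ∈ Icc 0 c := ⟨ht.1.le, ht.2⟩
    have ht0 := ht.1
    refine (abs_add_three _ _ _).trans ?_
    rw [abs_mul, abs_mul, abs_mul, abs_mul, abs_two]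
    calc _ ≤ B * t ^ M * D + 2 * (B * t ^ M * D) + B * t ^ M * D := by
          gcongr
          · exact b2 t ht'
          · exact c0 t
          · exact (b1 t ht').trans (mul_le_mul_of_nonneg_left (hp t ht' _ _ (by omega)) hB)
          · exact hχ.bound1 t ht'
          · exact (b0 t ht').trans (mul_le_mul_of_nonneg_left (hp t ht' _ _ (by omega)) hB)
          · exact hχ.bound2 t ht'
      _ = _ := by ring
  · intro t ht
    rw [hχ.eq_zero t (zc t (le_of_lt ht)), hχ.eq_zero1 t (zc t (le_of_lt ht)),
      hχ.eq_zero2 t (zc t (le_of_lt ht))]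
    simp

/-- On `(0, c]` the tail is bounded and the kernel integrable; beyond `c` the roles are reversed,
because `ε / t ≤ 1/2`. -/
lemma integrableOn_tail_mul_kern {n : ℕ} {σ ε : ℝ} (h : TaylorData n c B X ad)
    (hσ : σ = 1 ∨ σ = -1) (hc : 0 < c) (hε : 0 < ε) (hε' : ε ≤ c / 2) :
    IntegrableOn (fun t => taylorTail ad n t * kern σ ε t) (Ioc 0 X) := by
  have hX : 0 < X := hc.trans_le h.le_X
  have hc1 : c ≤ 1 := h.le_X.trans h.X_le
  -- The bound of `abs_kerDeriv_le` on `(1 - σ z)^(-1/2)` itself.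
  set A := cst 0 * (1 / 2) ^ (-(1 / 2 : ℝ) - (0 : ℕ)) with hA
  have hB : 0 ≤ B := (abs_nonneg _).trans (h.bound 0 (by omega) 0 ⟨le_rfl, hc.le⟩)
  have hA0 : 0 ≤ A := mul_nonneg (cst_pos 0).le (by positivity)
  refine Integrable.mono' (g := fun t => B * |kern σ ε t| + c⁻¹ * A * |taylorTail ad n t|)
    (((integrableOn_kern hσ hε hX).abs.const_mul B).add (h.integrableOn_tail.abs.const_mul _))
    (h.integrableOn_tail.aestronglyMeasurable.mul (measurable_kern σ ε).aestronglyMeasurable) ?_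
  filter_upwards [ae_restrict_mem measurableSet_Ioc] with t ht
  have ht0 := ht.1
  rw [Real.norm_eq_abs, abs_mul]
  rcases le_or_gt t c with h1 | h1
  · have h2 : |taylorTail ad n t| ≤ B * t ^ n := h.abs_tail_le (m := 0) (zero_add n) ⟨ht.1.le, h1⟩
    have h3 : |taylorTail ad n t| ≤ B * 1 := h2.trans (by
      gcongr
      exact pow_le_one₀ ht0.le (h1.trans hc1))
    have h4 : |taylorTail ad n t| * |kern σ ε t| ≤ B * 1 * |kern σ ε t| := by gcongr
    have : 0 ≤ c⁻¹ * A * |taylorTail ad n t| := by positivity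
    linarith
  · have hz : ε / t ∈ Icc (0 : ℝ) (1 / 2) := by
      refine ⟨by positivity, ?_⟩
      rw [div_le_iff₀ ht0]
      linarith
    have h2 := abs_kerDeriv_le (abs_sign hσ) hz 0
    have h3 : kern σ ε t = t⁻¹ * kerDeriv σ 0 (ε / t) := by
      unfold kern kerDeriv
      rw [inv_sqrt_mul_sqrt ht0 (one_sub_pos (abs_sign hσ) hz)]
      simp [cst]
    have h4 : |kern σ ε t| ≤ c⁻¹ * A := by
      rw [h3, abs_mul, abs_of_pos (by positivity)]
      have := inv_anti₀ hc h1.le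
      gcongr
    have h5 : |taylorTail ad n t| * |kern σ ε t| ≤ |taylorTail ad n t| * (c⁻¹ * A) := by gcongr
    have : 0 ≤ B * |kern σ ε t| := by positivity
    linarith

/-- The two pieces carry `ε` in different places. Near `0`, where the kernel is singular, the
substitution `t = ε v` puts `ε` into the flat factor; away from `0` it stays in the kernel, which is
smooth there. -/
lemma integral_tail_mul_kernTail {n : ℕ} {σ ε : ℝ} (h : TaylorData n c B X ad)
    (hχ : IsCutoff c D χ χ1 χ2) (hσ : σ = 1 ∨ σ = -1) (hc : 0 < c) (hε : 0 < ε)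
    (hε' : ε < c / 8) :
    IntegrableOn (fun t => taylorTail ad n t * kernTail σ n ε t) (Ioc 0 X) ∧
    ∫ t in Ioc 0 X, taylorTail ad n t * kernTail σ n ε t
      = (∫ v in Ioi 0, taylorTail ad n (ε * v) * χ (ε * v) * weightTail σ n v)
        + outerIntegral σ X (fun t => taylorTail ad n t * (1 - χ t)) 1 0 n ε := by
  have hX : 0 < X := hc.trans_le h.le_X
  have hB : 0 ≤ B := (abs_nonneg _).trans (h.bound 0 (by omega) 0 ⟨le_rfl, hc.le⟩)
  have hcont : Continuous χ := continuous_iff_continuousAt.2 fun t => (hχ.hasDerivAt t).continuousAt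
  have hI : IntegrableOn (fun t => taylorTail ad n t * kernTail σ n ε t) (Ioc 0 X) := by
    have h1 : IntegrableOn (fun t => taylorTail ad n t * kern σ ε t
        - ∑ l ∈ Finset.range n, binCoeff σ l * ε ^ l * (taylorTail ad n t * t⁻¹ ^ (l + 1)))
        (Ioc 0 X) := by
      apply (h.integrableOn_tail_mul_kern hσ hc hε (by linarith)).sub
      apply integrable_finsetSum
      intro l hl
      rw [Finset.mem_range] at hl
      exact (h.integrableOn_tail_mul_inv hc hB hl).const_mul _
    refine h1.congr_fun (fun t _ => ?_) measurableSet_Ioc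
    simp only [kernTail, mul_sub, Finset.mul_sum]
    congr 1
    apply Finset.sum_congr rfl
    intro l _
    ring
  refine ⟨hI, ?_⟩
  have hbd : ∀ t, ‖χ t‖ ≤ 1 := fun t => by
    rw [Real.norm_eq_abs, abs_of_nonneg (hχ.mem t).1]
    exact (hχ.mem t).2
  have hbd' : ∀ t, ‖1 - χ t‖ ≤ 1 := fun t => by
    rw [Real.norm_eq_abs, abs_of_nonneg (by linarith [(hχ.mem t).2])]
    linarith [(hχ.mem t).1]
  have hI1 : IntegrableOn (fun t => χ t * (taylorTail ad n t * kernTail σ n ε t)) (Ioc 0 X) :=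
    hI.bdd_mul hcont.aestronglyMeasurable (Eventually.of_forall hbd)
  have hI2 : IntegrableOn (fun t => (1 - χ t) * (taylorTail ad n t * kernTail σ n ε t)) (Ioc 0 X) :=
    hI.bdd_mul (continuous_const.sub hcont).aestronglyMeasurable (Eventually.of_forall hbd')
  have hsplit : ∫ t in Ioc 0 X, taylorTail ad n t * kernTail σ n ε t
      = (∫ t in Ioc 0 X, χ t * (taylorTail ad n t * kernTail σ n ε t))
        + ∫ t in Ioc 0 X, (1 - χ t) * (taylorTail ad n t * kernTail σ n ε t) := by
    rw [← integral_add hI1 hI2]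
    congr 1
    ext t
    ring
  rw [hsplit]
  congr 1
  · have h1 : ∫ t in Ioc 0 X, χ t * (taylorTail ad n t * kernTail σ n ε t)
        = ∫ t in Ioi 0, χ t * (taylorTail ad n t * kernTail σ n ε t) := by
      rw [← Ioc_union_Ioi_eq_Ioi hX.le]
      refine (setIntegral_eq_of_subset_of_forall_sdiff_eq_zero
        (measurableSet_Ioc.union measurableSet_Ioi) subset_union_left ?_).symm
      rintro t ⟨ht1 | ht1, ht2⟩
      · exact absurd ht1 ht2
      · have : c ≤ X := h.le_X
        have ht1' : X < t := ht1
        rw [hχ.eq_zero t (by linarith), zero_mul]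
    have h2 := integral_comp_mul_left_Ioi
      (fun t => χ t * (taylorTail ad n t * kernTail σ n ε t)) 0 hε
    rw [mul_zero, smul_eq_mul, inv_mul_eq_div, eq_div_iff hε.ne'] at h2
    rw [h1, ← h2, ← integral_mul_const]
    congr 1
    ext v
    rw [kernTail_scale hε]
    field_simp
  · unfold outerIntegral
    refine setIntegral_congr_fun measurableSet_Ioc (fun t ht => ?_)
    simp only
    -- Either `1 - χ` vanishes, or `t ≥ c / 4` and `ε < c / 8` give `ε / t ≤ 1/2`, where the kernel
    -- remainder is `kerTail`.
    rcases lt_or_ge t (c / 4) with h1 | h1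
    · rw [hχ.eq_one t h1]
      ring
    · have ht0 := ht.1
      have hz : ε / t ∈ Icc (0 : ℝ) (1 / 2) := by
        refine ⟨by positivity, ?_⟩
        rw [div_le_iff₀ ht0]
        linarith
      have h2 := inv_sqrt_sub_sum ht0 (one_sub_pos (abs_sign hσ) hz) n
      unfold kernTail kern
      rw [h2]
      ring

end TaylorData

/-- Apart from the logarithm `powPrim` is homogeneous, so scaling turns `ε ^ i` into `ε ^ l`. The
resonance `l = i` alone breaks homogeneity and creates `ε^i ln ε`. -/
lemma pow_mul_powPrim {ε X : ℝ} (hε : 0 < ε) (hX : 0 < X) (i l : ℕ) :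
    ε ^ i * powPrim i l (X / ε) = ε ^ l * powPrim i l X - if l = i then ε ^ i * Real.log ε else 0 := by
  unfold powPrim
  split_ifs with h
  · subst h
    rw [Real.log_div hX.ne' hε.ne']
    ring
  · rw [div_zpow, zpow_sub₀ hε.ne', zpow_natCast, zpow_natCast]
    field_simp
    ring

lemma exists_abs_powPrim_le {c : ℝ} (hc : 0 < c) (n : ℕ) :
    ∃ A : ℝ, 0 ≤ A ∧ ∀ l < n, ∀ j < n, ∀ X ∈ Icc c 1, |powPrim l j X| ≤ A := by
  have h1 : ∀ l j : ℕ, ∃ A : ℝ, ∀ X ∈ Icc c 1, ‖powPrim l j X‖ ≤ A := by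
    intro l j
    apply isCompact_Icc.exists_bound_of_continuousOn
    have h0 : ∀ X ∈ Icc c 1, X ≠ 0 := fun X hX => (hc.trans_le hX.1).ne'
    unfold powPrim
    split_ifs
    · exact Real.continuousOn_log.mono h0
    · apply ContinuousOn.div_const
      exact continuousOn_id.zpow₀ _ (fun X hX => Or.inl (h0 X hX))
  choose A hA using h1
  refine ⟨∑ l ∈ Finset.range n, ∑ j ∈ Finset.range n, |A l j|,
    Finset.sum_nonneg fun l _ => Finset.sum_nonneg fun j _ => abs_nonneg _, ?_⟩
  intro l hl j hj X hX
  calc |powPrim l j X| ≤ |A l j| := (hA l j X hX).trans (le_abs_self _)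
    _ ≤ ∑ j ∈ Finset.range n, |A l j| :=
      Finset.single_le_sum (f := fun j => |A l j|) (fun _ _ => abs_nonneg _) (Finset.mem_range.2 hj)
    _ ≤ _ := Finset.single_le_sum (f := fun l => ∑ j ∈ Finset.range n, |A l j|)
      (fun _ _ => Finset.sum_nonneg fun j _ => abs_nonneg _) (Finset.mem_range.2 hl)

/-- The expansion as `ε → 0` of `∫_0^X a(t) / √(t (t - σ ε)) dt`. -/
theorem exists_expansion {σ : ℝ} (hσ : σ = 1 ∨ σ = -1) (M : ℕ) {c B ε₀ : ℝ} (hc : 0 < c)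
    (hB : 0 ≤ B) (hε₀ : ε₀ ≤ Real.exp (-1)) (hε₀' : ε₀ ≤ c / 8) :
    ∃ C : ℝ, 0 ≤ C ∧ ∀ (X : ℝ) (ad : ℕ → ℝ → ℝ), TaylorData (M + 2) c B X ad →
      IsSmall M C ε₀ (fun ε => (∫ t in Ioc 0 X, ad 0 t * kern σ ε t)
        - ∑ j ∈ Finset.range (M + 2), (regCoef σ (ad 0) (taylorCoef ad) X j * ε ^ j
          + logCoef σ (taylorCoef ad) j * (ε ^ j * Real.log ε))) ∧
      ∀ j < M + 2, |regCoef σ (ad 0) (taylorCoef ad) X j| ≤ C := by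
  -- If `c > 1` there is no Taylor data at all, since it requires `c ≤ X ≤ 1`.
  by_cases hc1 : c ≤ 1
  swap
  · exact ⟨0, le_rfl, fun X ad h => absurd (h.le_X.trans h.X_le) hc1⟩
  set n := M + 2 with hn
  obtain ⟨D, χ, χ1, χ2, hD, hχ⟩ := exists_isCutoff hc
  obtain ⟨Ci, hCi, hin⟩ := exists_isSmall_inner (A := 4 * B * D) hσ M hc hc1 (by positivity) hε₀
    (by linarith)
  -- The outer piece lives on `t ≥ c / 4`, whence the condition `ε₀ ≤ c / 8`; its mass is bounded by
  -- `integral_tail_le`.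
  obtain ⟨Co, hCo, hout⟩ := exists_isSmall_outer (B := (n + 1) * B) (c := c / 4) (abs_sign hσ) M
    (by linarith) (by positivity) hε₀ (by linarith)
  have ht : ∀ i : ℕ, ∃ C : ℝ, i < n → 0 ≤ C ∧ ∀ X : ℝ, c ≤ X → X ≤ 1 →
      IsSmall M C ε₀ (fun ε => ε ^ i * tailIntegral σ n i (X / ε)) := by
    intro i
    by_cases hi : i < n
    · obtain ⟨C, h⟩ := isSmall_tailIntegral hσ hi hc hε₀ (by linarith)
      exact ⟨C, fun _ => h⟩
    · exact ⟨0, fun h => absurd h hi⟩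
  choose Ct hCt using ht
  obtain ⟨A, hA, hAb⟩ := exists_abs_powPrim_le hc n
  set C1 := Ci + Co + ∑ i ∈ Finset.range n, B * Ct i with hC1
  have hC1' : 0 ≤ C1 := by
    have : 0 ≤ ∑ i ∈ Finset.range n, B * Ct i := Finset.sum_nonneg fun i hi =>
      mul_nonneg hB (hCt i (Finset.mem_range.1 hi)).1
    positivity
  set C2 := ∑ j ∈ Finset.range n, (|binCoeff σ j| * (B + c⁻¹ ^ n * ((n + 1) * B) + n * (B * A))
    + B * |weightConst σ j|) with hC2
  have hC2' : 0 ≤ C2 := Finset.sum_nonneg fun j _ => by positivity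
  refine ⟨C1 + C2, by positivity, fun X ad h => ⟨?_, ?_⟩⟩
  · have hX : 0 < X := hc.trans_le h.le_X
    obtain ⟨hf1, hf2⟩ := h.flatPair hχ hc hB hD
    have hcont : Continuous χ :=
      continuous_iff_continuousAt.2 fun t => (hχ.hasDerivAt t).continuousAt
    have hbd' : ∀ t, ‖1 - χ t‖ ≤ 1 := fun t => by
      rw [Real.norm_eq_abs, abs_of_nonneg (by linarith [(hχ.mem t).2])]
      linarith [(hχ.mem t).1]
    have hg : IntegrableOn (fun t => taylorTail ad n t * (1 - χ t)) (Ioc 0 X) :=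
      h.integrableOn_tail.mul_bdd (c := 1) (continuous_const.sub hcont).aestronglyMeasurable
        (Eventually.of_forall hbd')
    have hs1 := hin _ _ _ hf1 hf2
    have hs2 := hout X _ hg (fun t ht => by simp only [hχ.eq_one t ht]; ring) (by
      refine le_trans ?_ (h.integral_tail_le hc hB)
      refine setIntegral_mono_on hg.abs h.integrableOn_tail.abs measurableSet_Ioc (fun t _ => ?_)
      rw [abs_mul]
      exact mul_le_of_le_one_right (abs_nonneg _) (hbd' t))
    have hs3 : IsSmall M (∑ i ∈ Finset.range n, B * Ct i) ε₀ (fun ε => ∑ i ∈ Finset.range n,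
        -taylorCoef ad i * (ε ^ i * tailIntegral σ n i (X / ε))) := by
      apply IsSmall.sum n (r := fun i ε => -taylorCoef ad i * (ε ^ i * tailIntegral σ n i (X / ε)))
      intro i hi
      refine ((hCt i hi).2 X h.le_X h.X_le).const_mul ?_
      rw [abs_neg]
      exact h.abs_taylorCoef_le hc.le hi.le
    refine (((hs1.add hs2).add hs3).mono (by linarith) le_rfl).congr ?_
    intro ε hε
    have hε0 : 0 < ε := hε.1
    have hεc : ε < c / 8 := hε.2.trans_le hε₀'
    obtain ⟨hI, hE⟩ := h.integral_tail_mul_kernTail hχ hσ hc hε0 hεc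
    -- Pointwise, `a · K` equals tail times kernel tail, plus tail times the polynomial part of the
    -- kernel, plus the Taylor polynomial times the full kernel. The first term is the remainder
    -- handled by the cutoff.
    have e1 : ∫ t in Ioc 0 X, ad 0 t * kern σ ε t
        = (∫ t in Ioc 0 X, taylorTail ad n t * kernTail σ n ε t)
          + ∑ l ∈ Finset.range n, binCoeff σ l * ε ^ l
            * (∫ t in Ioc 0 X, taylorTail ad n t * t⁻¹ ^ (l + 1))
          + ∑ i ∈ Finset.range n, taylorCoef ad i * ∫ t in Ioc 0 X, t ^ i * kern σ ε t := by
      have p1 : ∀ l ∈ Finset.range n, Integrable (fun t => binCoeff σ l * ε ^ l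
            * (taylorTail ad n t * t⁻¹ ^ (l + 1))) (volume.restrict (Ioc 0 X)) := fun l hl =>
        (h.integrableOn_tail_mul_inv hc hB (Finset.mem_range.1 hl)).const_mul _
      have p2 : ∀ i ∈ Finset.range n, Integrable (fun t => taylorCoef ad i * (t ^ i * kern σ ε t))
          (volume.restrict (Ioc 0 X)) := by
        intro i _
        apply Integrable.const_mul
        have h1 := integrableOn_kern hσ hε0 hX
        change IntegrableOn (fun t => t ^ i * kern σ ε t) (Ioc 0 X) volume
        rw [← integrableOn_Icc_iff_integrableOn_Ioc] at h1 ⊢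
        exact h1.continuousOn_mul (by fun_prop) isCompact_Icc
      simp_rw [← integral_const_mul]
      have p3 : Integrable (fun t => taylorTail ad n t * kernTail σ n ε t
          + ∑ l ∈ Finset.range n, binCoeff σ l * ε ^ l * (taylorTail ad n t * t⁻¹ ^ (l + 1)))
          (volume.restrict (Ioc 0 X)) := hI.add (integrable_finsetSum _ p1)
      rw [← integral_finsetSum _ p1, ← integral_finsetSum _ p2,
        ← integral_add hI (integrable_finsetSum _ p1),
        ← integral_add p3 (integrable_finsetSum _ p2)]
      congr 1
      ext t
      have q1 : ∑ l ∈ Finset.range n, binCoeff σ l * ε ^ l * (taylorTail ad n t * t⁻¹ ^ (l + 1))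
          = taylorTail ad n t * ∑ l ∈ Finset.range n, binCoeff σ l * ε ^ l * t⁻¹ ^ (l + 1) := by
        rw [Finset.mul_sum]
        apply Finset.sum_congr rfl
        intro l _
        ring
      have q2 : ∑ i ∈ Finset.range n, taylorCoef ad i * (t ^ i * kern σ ε t)
          = (∑ i ∈ Finset.range n, taylorCoef ad i * t ^ i) * kern σ ε t := by
        rw [Finset.sum_mul]
        apply Finset.sum_congr rfl
        intro l _
        ring
      rw [q1, q2, kernTail, TaylorData.tail_eq]
      ring
    -- Each monomial contributes powers of `ε` of every index `l < n`, its own logarithm, a constant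
    -- times `ε ^ i`, and a small tail integral.
    have e2 : ∀ i ∈ Finset.range n, taylorCoef ad i * ∫ t in Ioc 0 X, t ^ i * kern σ ε t
        = (∑ l ∈ Finset.range n, binCoeff σ l * ε ^ l * (taylorCoef ad i * powPrim i l X))
          + logCoef σ (taylorCoef ad) i * (ε ^ i * Real.log ε)
          + taylorCoef ad i * weightConst σ i * ε ^ i
          + -taylorCoef ad i * (ε ^ i * tailIntegral σ n i (X / ε)) := by
      intro i hi
      have hi' := Finset.mem_range.1 hi
      have hY : 1 ≤ X / ε := by
        rw [one_le_div hε0]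
        have := h.le_X
        linarith
      rw [integral_pow_mul_kern hε0 hX, integral_pow_mul_weight hσ hi' hY]
      have q1 : ε ^ i * ∑ l ∈ Finset.range n, binCoeff σ l * powPrim i l (X / ε)
          = (∑ l ∈ Finset.range n, binCoeff σ l * ε ^ l * powPrim i l X)
            - binCoeff σ i * (ε ^ i * Real.log ε) := by
        rw [Finset.mul_sum]
        have : ∀ l ∈ Finset.range n, ε ^ i * (binCoeff σ l * powPrim i l (X / ε))
            = binCoeff σ l * ε ^ l * powPrim i l X
              - if l = i then binCoeff σ l * (ε ^ i * Real.log ε) else 0 := by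
          intro l _
          rw [mul_left_comm, pow_mul_powPrim hε0 hX]
          split_ifs <;> ring
        rw [Finset.sum_congr rfl this, Finset.sum_sub_distrib, Finset.sum_ite_eq', if_pos hi]
      have q2 : ∑ l ∈ Finset.range n, binCoeff σ l * ε ^ l * (taylorCoef ad i * powPrim i l X)
          = taylorCoef ad i * ∑ l ∈ Finset.range n, binCoeff σ l * ε ^ l * powPrim i l X := by
        rw [Finset.mul_sum]
        apply Finset.sum_congr rfl
        intro l _
        ring
      rw [q2, logCoef, mul_sub, mul_add, q1]
      ring
    have e3 : ∀ j ∈ Finset.range n, regCoef σ (ad 0) (taylorCoef ad) X j * ε ^ j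
          + logCoef σ (taylorCoef ad) j * (ε ^ j * Real.log ε)
        = binCoeff σ j * ε ^ j * (∫ t in Ioc 0 X, taylorTail ad n t * t⁻¹ ^ (j + 1))
          + (∑ i ∈ Finset.range n, binCoeff σ j * ε ^ j * (taylorCoef ad i * powPrim i j X))
          + logCoef σ (taylorCoef ad) j * (ε ^ j * Real.log ε)
          + taylorCoef ad j * weightConst σ j * ε ^ j := by
      intro j hj
      rw [regCoef, h.finitePart_eq hc hB (Finset.mem_range.1 hj), ← Finset.mul_sum]
      ring
    rw [e1, Finset.sum_congr rfl e2, Finset.sum_congr rfl e3, hE]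
    simp only [Finset.sum_add_distrib]
    -- The boundary terms `powPrim` of the monomials, grouped by Taylor index, are those of the
    -- finite parts, grouped by the power of `ε`; exchanging the sums makes them cancel.
    rw [Finset.sum_comm]
    ring
  · intro j hj
    refine le_trans ?_ (le_add_of_nonneg_left hC1')
    rw [regCoef, h.finitePart_eq hc hB hj]
    refine le_trans ?_ (Finset.single_le_sum (f := fun j => |binCoeff σ j| *
      (B + c⁻¹ ^ n * ((n + 1) * B) + n * (B * A)) + B * |weightConst σ j|)
      (fun j _ => by positivity) (Finset.mem_range.2 hj))
    refine (abs_add_le _ _).trans ?_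
    rw [abs_mul, abs_mul]
    have h1 := h.abs_integral_tail_mul_inv_le hc hB hj
    have h2 : |∑ l ∈ Finset.range n, taylorCoef ad l * powPrim l j X| ≤ n * (B * A) := by
      refine (Finset.abs_sum_le_sum_abs _ _).trans ?_
      calc _ ≤ ∑ l ∈ Finset.range n, B * A := by
            apply Finset.sum_le_sum
            intro l hl
            rw [Finset.mem_range] at hl
            rw [abs_mul]
            have := h.abs_taylorCoef_le hc.le hl.le
            have := hAb l hl j hj X ⟨h.le_X, h.X_le⟩
            gcongr
        _ = _ := by simp
    have h3 := h.abs_taylorCoef_le hc.le hj.le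
    gcongr
    exact (abs_add_le _ _).trans (add_le_add (by exact_mod_cast h1) h2)

end CollidingWaves

end

noncomputable section

namespace CollidingWaves

open Set MeasureTheory Filter Topology

open scoped Convolution

/-! ### Regularity of Abel integrals -/

/-- The kernel `1 / √τ` on `(0, 2]`, extended by zero. -/
def abelKer : ℝ → ℝ := (Ioc (0 : ℝ) 2).indicator (fun τ => 1 / √τ)

lemma integrable_abelKer : Integrable abelKer :=
  (integrable_indicator_iff measurableSet_Ioc).2 (integrableOn_inv_sqrt 2)

lemma abelKer_eq {τ : ℝ} (h : τ ≤ 2) : abelKer τ = 1 / √τ := by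
  unfold abelKer
  rcases le_or_gt τ 0 with h1 | h1
  · rw [indicator_of_notMem (fun h' => absurd h'.1 (not_lt.2 h1)), Real.sqrt_eq_zero_of_nonpos h1]
    simp
  · rw [indicator_of_mem (show τ ∈ Ioc (0 : ℝ) 2 from ⟨h1, h⟩)]

lemma abelKer_of_nonpos {τ : ℝ} (h : τ ≤ 0) : abelKer τ = 0 :=
  indicator_of_notMem (fun h' => absurd h'.1 (not_lt.2 h)) _

lemma abelKer_nonneg (τ : ℝ) : 0 ≤ abelKer τ :=
  indicator_nonneg (fun _ _ => by positivity) _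

lemma measurable_abelKer : Measurable abelKer :=
  Measurable.indicator (by fun_prop) measurableSet_Ioc

/-- The Abel integral `∫_0^k g(t) / √(k - t) dt`. -/
def abelInt (g : ℝ → ℝ) (k : ℝ) : ℝ := ∫ t in (0 : ℝ)..k, g t / √(k - t)

/-- This makes the Abel integral a convolution over the whole line: the upper limit `k` is enforced
by the vanishing of the kernel on nonpositive numbers, and the truncation of `g` at `b` is not felt
for `k < b`. -/
lemma abelInt_eq {b : ℝ} (hb : b ≤ 1) (g : ℝ → ℝ) {k : ℝ} (hk : k ∈ Ioo 0 b) :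
    abelInt g k = ∫ t, (Ioo 0 b).indicator g t * abelKer (k - t) := by
  unfold abelInt
  rw [intervalIntegral.integral_of_le hk.1.le, integral_Ioc_eq_integral_Ioo,
    ← integral_indicator measurableSet_Ioo]
  congr 1
  ext t
  by_cases h : t ∈ Ioo 0 k
  · rw [indicator_of_mem h, indicator_of_mem (show t ∈ Ioo 0 b from ⟨h.1, h.2.trans hk.2⟩),
      abelKer_eq (by linarith [h.1, hk.2])]
    ring
  · rw [indicator_of_notMem h]
    rcases le_or_gt t 0 with h1 | h1
    · rw [indicator_of_notMem (fun h' => absurd h'.1 (not_lt.2 h1)), zero_mul]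
    · have : k ≤ t := by
        by_contra h2
        exact h ⟨h1, not_le.1 h2⟩
      rw [abelKer_of_nonpos (by linarith), mul_zero]

lemma integrable_indicator_of {g : ℝ → ℝ} {b : ℝ} (hg : IntegrableOn g (Ioo 0 b)) :
    Integrable ((Ioo 0 b).indicator g) :=
  (integrable_indicator_iff measurableSet_Ioo).2 hg

lemma integrableOn_abelInt {b : ℝ} (hb : b ≤ 1) {g : ℝ → ℝ} (hg : IntegrableOn g (Ioo 0 b)) :
    IntegrableOn (abelInt g) (Ioo 0 b) := by
  have h1 := (integrable_indicator_of hg).integrable_convolution (ContinuousLinearMap.mul ℝ ℝ)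
    integrable_abelKer
  refine h1.integrableOn.congr_fun (fun k hk => ?_) measurableSet_Ioo
  rw [abelInt_eq hb g hk]
  rfl

/-- A smooth compactly supported function agreeing with `1 / √τ` for `r ≤ |τ| ≤ 1`. -/
lemma exists_smooth_abelKer {r : ℝ} (hr : 0 < r) : ∃ ψ : ℝ → ℝ, (∀ n : ℕ, ContDiff ℝ n ψ) ∧
    HasCompactSupport ψ ∧ ∀ τ : ℝ, r ≤ |τ| → |τ| ≤ 1 → ψ τ = abelKer τ := by
  let χ2 : ContDiffBump (0 : ℝ) := ⟨r / 2, r, by linarith, by linarith⟩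
  let χ3 : ContDiffBump (0 : ℝ) := ⟨2, 3, by norm_num, by norm_num⟩
  refine ⟨fun τ => (1 / √τ * (1 - χ2 τ)) * χ3 τ, fun n => ?_, χ3.hasCompactSupport.mul_left, ?_⟩
  · rw [contDiff_iff_contDiffAt]
    intro τ
    apply ContDiffAt.mul _ χ3.contDiffAt
    rcases lt_trichotomy τ 0 with h | h | h
    · have : (fun τ => 1 / √τ * (1 - χ2 τ)) =ᶠ[𝓝 τ] fun _ => 0 := by
        filter_upwards [gt_mem_nhds h] with s hs
        rw [Real.sqrt_eq_zero_of_nonpos hs.le]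
        simp
      exact contDiffAt_const.congr_of_eventuallyEq this
    · have : (fun τ => 1 / √τ * (1 - χ2 τ)) =ᶠ[𝓝 τ] fun _ => 0 := by
        rw [h]
        filter_upwards [χ2.eventuallyEq_one] with s hs
        rw [hs]
        simp
      exact contDiffAt_const.congr_of_eventuallyEq this
    · apply ContDiffAt.mul _ (contDiffAt_const.sub χ2.contDiffAt)
      apply contDiffAt_const.div (Real.contDiffAt_sqrt h.ne')
      positivity
  · intro τ h1 h2
    have e2 : χ2 τ = 0 := χ2.zero_of_le_dist (by simpa using h1)
    have e3 : χ3 τ = 1 := χ3.one_of_mem_closedBall (by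
      rw [mem_closedBall_zero_iff]
      exact h2.trans (by norm_num))
    beta_reduce
    rw [e2, e3, abelKer_eq (by linarith [le_abs_self τ])]
    ring

/-- Differentiating the kernel would destroy integrability, so near `k₀` the density is cut in two.
The part close to `k₀` is smooth with compact support and takes the derivatives itself; for the
rest, `k - t` stays away from `0` and the kernel may be replaced by a smooth one. -/
lemma contDiffOn_abelInt {m : ℕ} {g : ℝ → ℝ} (hg : ContDiffOn ℝ m g (Ioo 0 1))
    (hI : ∀ b < 1, IntegrableOn g (Ioo 0 b)) : ContDiffOn ℝ m (abelInt g) (Ioo 0 1) := by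
  intro k₀ hk₀
  apply ContDiffAt.contDiffWithinAt
  obtain ⟨r, hr, hr1, hr2⟩ : ∃ r > 0, 4 * r < k₀ ∧ k₀ + 4 * r < 1 := by
    refine ⟨min k₀ (1 - k₀) / 5, ?_, ?_, ?_⟩
    · have := lt_min hk₀.1 (sub_pos.2 hk₀.2)
      positivity
    · have := min_le_left k₀ (1 - k₀)
      linarith [hk₀.1]
    · have := min_le_right k₀ (1 - k₀)
      linarith [hk₀.2]
  set b := k₀ + 3 * r with hb
  have hb1 : b < 1 := by linarith
  set g1 := (Ioo 0 b).indicator g with hg1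
  have hg1I : Integrable g1 := integrable_indicator_of (hI b hb1)
  let χ : ContDiffBump k₀ := ⟨r, 2 * r, hr, by linarith⟩
  -- For `|t - k₀| > r` and `|k - k₀| ≤ r / 2` one has `|k - t| ≥ r / 2`, so `ψ` agrees with the
  -- Abel kernel wherever it is evaluated against a nonzero density.
  obtain ⟨ψ, hψ, hψc, hψe⟩ := exists_smooth_abelKer (r := r / 2) (by linarith)
  have hG : ContDiff ℝ m (fun t => g1 t * χ t) := by
    rw [contDiff_iff_contDiffAt]
    intro t
    by_cases ht : t ∈ Ioo 0 b
    · apply ContDiffAt.mul _ χ.contDiffAt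
      have h1 : ContDiffAt ℝ m g t :=
        hg.contDiffAt (Ioo_mem_nhds ht.1 (ht.2.trans hb1))
      refine h1.congr_of_eventuallyEq ?_
      filter_upwards [Ioo_mem_nhds ht.1 ht.2] with s hs
      exact indicator_of_mem hs _
    · have h1 : t ∈ (Metric.closedBall k₀ (2 * r))ᶜ := by
        intro h2
        rw [Metric.mem_closedBall, Real.dist_eq, abs_le] at h2
        exact ht ⟨by linarith [h2.1], by linarith [h2.2]⟩
      refine (contDiffAt_const (c := (0 : ℝ))).congr_of_eventuallyEq ?_
      filter_upwards [Metric.isClosed_closedBall.isOpen_compl.mem_nhds h1] with s hs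
      have h3 : χ s = 0 := χ.zero_of_le_dist (by
        rw [mem_compl_iff, Metric.mem_closedBall, not_le] at hs
        exact hs.le)
      rw [h3, mul_zero]
  have hGc : HasCompactSupport (fun t => g1 t * χ t) := χ.hasCompactSupport.mul_left
  have hF1 : ContDiff ℝ m (abelKer ⋆[ContinuousLinearMap.mul ℝ ℝ, volume] (fun t => g1 t * χ t)) :=
    hGc.contDiff_convolution_right _ integrable_abelKer.locallyIntegrable hG
  have hg2I : Integrable (fun t => g1 t * (1 - χ t)) := by
    refine hg1I.mul_bdd (c := 1) (continuous_const.sub χ.continuous).aestronglyMeasurable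
      (Eventually.of_forall fun t => ?_)
    rw [Real.norm_eq_abs, abs_le]
    exact ⟨by linarith [χ.le_one (x := t)], by linarith [χ.nonneg (x := t)]⟩
  have hF2 : ContDiff ℝ m ((fun t => g1 t * (1 - χ t)) ⋆[ContinuousLinearMap.mul ℝ ℝ, volume] ψ) :=
    hψc.contDiff_convolution_right _ hg2I.locallyIntegrable (hψ m)
  refine (hF1.add hF2).contDiffAt.congr_of_eventuallyEq ?_
  filter_upwards [Ioo_mem_nhds (show k₀ - r / 2 < k₀ by linarith)
    (show k₀ < k₀ + r / 2 by linarith)] with k hk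
  have hk' : k ∈ Ioo 0 b := ⟨by linarith [hk.1], by linarith [hk.2]⟩
  have e1 : (abelKer ⋆[ContinuousLinearMap.mul ℝ ℝ, volume] (fun t => g1 t * χ t)) k
      = ∫ t, (g1 t * χ t) * abelKer (k - t) := by
    rw [convolution_def, ← integral_sub_left_eq_self _ volume k]
    congr 1
    ext t
    simp only [ContinuousLinearMap.mul_apply', sub_sub_cancel]
    ring
  have pw : ∀ t, g1 t * (1 - χ t) * ψ (k - t) = g1 t * (1 - χ t) * abelKer (k - t) := by
    intro t
    by_cases ht : t ∈ Ioo 0 b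
    · by_cases ht2 : t ∈ Metric.closedBall k₀ r
      · have : χ t = 1 := χ.one_of_mem_closedBall ht2
        rw [this]
        ring
      · rw [Metric.mem_closedBall, Real.dist_eq, not_le] at ht2
        rw [hψe]
        · have h1 : |t - k₀| ≤ |k - t| + |k - k₀| := by
            rw [abs_sub_comm k t]
            calc |t - k₀| = |(t - k) + (k - k₀)| := by ring_nf
              _ ≤ _ := abs_add_le _ _
          have h2 : |k - k₀| ≤ r / 2 := abs_le.2 ⟨by linarith [hk.1], by linarith [hk.2]⟩
          linarith
        · rw [abs_le]
          exact ⟨by linarith [hk'.1, ht.2], by linarith [hk'.2, ht.1]⟩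
    · have : g1 t = 0 := indicator_of_notMem ht _
      rw [this]
      ring
  have e2 : ((fun t => g1 t * (1 - χ t)) ⋆[ContinuousLinearMap.mul ℝ ℝ, volume] ψ) k
      = ∫ t, (g1 t * (1 - χ t)) * abelKer (k - t) := by
    simp_rw [← pw]
    rfl
  have hGI : Integrable (fun t => (g1 t * χ t) * abelKer (k - t)) := by
    have h1 : Continuous (fun t => g1 t * χ t) := hG.continuous
    obtain ⟨C, hC⟩ := hGc.exists_bound_of_continuous h1
    exact (integrable_abelKer.comp_sub_left k).bdd_mul h1.aestronglyMeasurable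
      (Eventually.of_forall hC)
  have hGI2 : Integrable (fun t => (g1 t * (1 - χ t)) * abelKer (k - t)) := by
    obtain ⟨C, hC⟩ := hψc.exists_bound_of_continuous (hψ 0).continuous
    have h1 : Integrable (fun t => (g1 t * (1 - χ t)) * ψ (k - t)) :=
      hg2I.mul_bdd (c := C) (((hψ 0).continuous.comp (by fun_prop)).aestronglyMeasurable)
        (Eventually.of_forall fun t => hC _)
    simpa only [pw] using h1
  rw [abelInt_eq hb1.le g hk', e1, e2, ← integral_add hGI hGI2]
  congr 1
  ext t
  ring

end CollidingWaves

end

noncomputable section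

namespace CollidingWaves

open Set MeasureTheory Filter Topology

/-! ### Abel inversion -/

/-- The Beta integral `∫_t^x dk / √((k - t) (x - k)) = π`, with an arcsine as antiderivative. The
bound `x - t ≤ 2` keeps the arguments within the truncation of `abelKer`. -/
lemma integral_abelKer_mul {t x : ℝ} (h : t < x) (h' : x - t ≤ 2) :
    Integrable (fun k => abelKer (k - t) * abelKer (x - k)) ∧
      ∫ k, abelKer (k - t) * abelKer (x - k) = Real.pi := by
  have hd : 0 < x - t := sub_pos.2 h
  set F : ℝ → ℝ := fun k => Real.arcsin ((2 * k - t - x) / (x - t)) with hF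
  set f : ℝ → ℝ := fun k => abelKer (k - t) * abelKer (x - k) with hf
  have hcont : Continuous F := Real.continuous_arcsin.comp (by fun_prop)
  have hderiv : ∀ k ∈ Ioo t x, HasDerivAt F (f k) k := by
    intro k hk
    have h1 : 0 < k - t := sub_pos.2 hk.1
    have h2 : 0 < x - k := sub_pos.2 hk.2
    have h3 : HasDerivAt (fun k : ℝ => (2 * k - t - x) / (x - t)) (2 / (x - t)) k := by
      have := ((((hasDerivAt_id k).const_mul 2).sub_const t).sub_const x).div_const (x - t)
      simpa using this
    have h4 := (Real.hasDerivAt_arcsin (x := (2 * k - t - x) / (x - t))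
      (by rw [ne_eq, div_eq_iff hd.ne']; intro h; linarith)
      (by rw [ne_eq, div_eq_iff hd.ne']; intro h; linarith)).comp k h3
    refine h4.congr_deriv ?_
    have h5 : 1 - ((2 * k - t - x) / (x - t)) ^ 2 = (2 / (x - t)) ^ 2 * ((k - t) * (x - k)) := by
      field_simp
      ring
    rw [h5, Real.sqrt_mul (by positivity), Real.sqrt_sq (by positivity), Real.sqrt_mul h1.le]
    simp only [hf]
    rw [abelKer_eq (by linarith), abelKer_eq (by linarith)]
    field_simp
  have hI : IntervalIntegrable f volume t x := by
    -- A nonnegative derivative of a function continuous up to the endpoints is integrable, so the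
    -- endpoint singularities need no separate estimate.
    apply intervalIntegral.intervalIntegrable_deriv_of_nonneg hcont.continuousOn
    · rw [min_eq_left h.le, max_eq_right h.le]
      exact hderiv
    · exact fun k _ => mul_nonneg (abelKer_nonneg _) (abelKer_nonneg _)
  have hint := intervalIntegral.integral_eq_sub_of_hasDerivAt_of_le h.le hcont.continuousOn hderiv hI
  have hF1 : F x = Real.pi / 2 := by
    simp only [hF]
    rw [show (2 * x - t - x) / (x - t) = 1 by rw [div_eq_one_iff_eq hd.ne']; ring, Real.arcsin_one]
  have hF2 : F t = -(Real.pi / 2) := by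
    simp only [hF]
    rw [show (2 * t - t - x) / (x - t) = -1 by rw [div_eq_iff hd.ne']; ring, Real.arcsin_neg_one]
  have hind : f = (Ioc t x).indicator f := by
    ext k
    by_cases hk : k ∈ Ioc t x
    · rw [indicator_of_mem hk]
    · rw [indicator_of_notMem hk]
      simp only [hf]
      rcases le_or_gt k t with h1 | h1
      · rw [abelKer_of_nonpos (by linarith), zero_mul]
      · have : x < k := by
          by_contra h2
          exact hk ⟨h1, not_lt.1 h2⟩
        rw [abelKer_of_nonpos (τ := x - k) (by linarith), mul_zero]
  rw [intervalIntegrable_iff_integrableOn_Ioc_of_le h.le] at hI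
  constructor
  · rw [hind]
    exact (integrable_indicator_iff measurableSet_Ioc).2 hI
  · rw [hind, integral_indicator measurableSet_Ioc, ← intervalIntegral.integral_of_le h.le, hint,
      hF1, hF2]
    ring

/-- Integrating the absolute value in `k` gives `π |g(t)|` by the Beta integral, which is integrable
in `t`; this justifies Fubini in the Abel inversion. -/
lemma integrable_abel_prod {x : ℝ} (hx1 : x ≤ 1) {g : ℝ → ℝ} (hg : IntegrableOn g (Ioo 0 x)) :
    Integrable (fun p : ℝ × ℝ => (Ioo 0 x).indicator g p.2 * abelKer (p.1 - p.2) * abelKer (x - p.1))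
      (volume.prod volume) := by
  have hg1 := integrable_indicator_of hg
  have hm : AEStronglyMeasurable (fun p : ℝ × ℝ => (Ioo 0 x).indicator g p.2
      * abelKer (p.1 - p.2) * abelKer (x - p.1)) (volume.prod volume) := by
    refine (hg1.aestronglyMeasurable.comp_snd.mul ?_).mul ?_
    · exact (measurable_abelKer.comp (by fun_prop)).aestronglyMeasurable
    · exact (measurable_abelKer.comp (by fun_prop)).aestronglyMeasurable
  rw [integrable_prod_iff' hm]
  have key : ∀ t, Integrable (fun k => (Ioo 0 x).indicator g t * abelKer (k - t) * abelKer (x - k)) ∧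
      ∫ k, ‖(Ioo 0 x).indicator g t * abelKer (k - t) * abelKer (x - k)‖
        = ‖(Ioo 0 x).indicator g t‖ * Real.pi := by
    intro t
    by_cases ht : t ∈ Ioo 0 x
    · obtain ⟨h1, h2⟩ := integral_abelKer_mul ht.2 (by linarith [ht.1])
      constructor
      · simp_rw [mul_assoc]
        exact h1.const_mul _
      · simp_rw [mul_assoc, norm_mul _ (abelKer _ * abelKer _)]
        rw [integral_const_mul, ← h2]
        congr 2
        ext k
        rw [Real.norm_eq_abs, abs_of_nonneg (mul_nonneg (abelKer_nonneg _) (abelKer_nonneg _))]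
    · simp [indicator_of_notMem ht]
  refine ⟨Eventually.of_forall fun t => (key t).1, ?_⟩
  simp_rw [fun t => (key t).2]
  exact hg1.norm.mul_const _

lemma abelInt_mul_abelKer {x : ℝ} (hx1 : x ≤ 1) (g : ℝ → ℝ) {k : ℝ} :
    ∫ t, (Ioo 0 x).indicator g t * abelKer (k - t) * abelKer (x - k)
      = (Ioo 0 x).indicator (fun k => abelInt g k * abelKer (x - k)) k := by
  by_cases hk : k ∈ Ioo 0 x
  · rw [indicator_of_mem hk, integral_mul_const, abelInt_eq hx1 g hk]
  · rw [indicator_of_notMem hk]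
    have : ∀ t, (Ioo 0 x).indicator g t * abelKer (k - t) * abelKer (x - k) = 0 := by
      intro t
      rcases le_or_gt x k with h1 | h1
      · rw [abelKer_of_nonpos (τ := x - k) (by linarith), mul_zero]
      · have h2 : k ≤ 0 := by
          by_contra h2
          exact hk ⟨not_le.1 h2, h1⟩
        rcases le_or_gt t 0 with h3 | h3
        · rw [indicator_of_notMem (fun h' => absurd h'.1 (not_lt.2 h3))]
          ring
        · rw [abelKer_of_nonpos (τ := k - t) (by linarith)]
          ring
    simp_rw [this]
    simp

/-- Abel inversion: after exchanging the order of integration, the inner integral over `k` is the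
Beta integral, equal to `π` for every `t`. -/
lemma integral_abelInt_mul {x : ℝ} (hx1 : x ≤ 1) {g : ℝ → ℝ} (hg : IntegrableOn g (Ioo 0 x)) :
    IntegrableOn (fun k => abelInt g k * abelKer (x - k)) (Ioo 0 x) ∧
      ∫ k in Ioo 0 x, abelInt g k * abelKer (x - k) = Real.pi * ∫ t in Ioo 0 x, g t := by
  have h1 := integrable_abel_prod hx1 hg
  have h2 := h1.integral_prod_left
  simp_rw [abelInt_mul_abelKer hx1] at h2
  refine ⟨(integrable_indicator_iff measurableSet_Ioo).1 h2, ?_⟩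
  rw [← integral_indicator measurableSet_Ioo]
  simp_rw [← abelInt_mul_abelKer hx1]
  rw [integral_integral_swap h1, ← integral_indicator measurableSet_Ioo, ← integral_const_mul]
  congr 1
  ext t
  by_cases ht : t ∈ Ioo 0 x
  · simp_rw [mul_assoc]
    rw [integral_const_mul, (integral_abelKer_mul ht.2 (by linarith [ht.1])).2]
    ring
  · simp [indicator_of_notMem ht]

lemma abs_abelInt_le (g : ℝ → ℝ) {k : ℝ} (hk : 0 ≤ k) :
    |abelInt g k| ≤ abelInt (fun t => |g t|) k := by
  unfold abelInt
  refine (intervalIntegral.abs_integral_le_integral_abs hk).trans (le_of_eq ?_)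
  congr 1
  ext t
  rw [abs_div, abs_of_nonneg (Real.sqrt_nonneg _)]

/-! ### Boundary functions -/

lemma integrableOn_of_weighted {α b : ℝ} (hα : α < 1) (hb : b < 1) {g : ℝ → ℝ}
    (hm : Measurable g)
    (h : ExtendsContinuously (fun x => x ^ α * g x) (Ioo 0 1) (Ico 0 1)) :
    IntegrableOn g (Ioo 0 b) := by
  obtain ⟨φ, hφ, he⟩ := h
  obtain ⟨C, hC⟩ := isCompact_Icc.exists_bound_of_continuousOn (s := Icc 0 b)
    (hφ.mono fun t ht => ⟨ht.1, ht.2.trans_lt hb⟩)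
  have h1 : IntegrableOn (fun t : ℝ => C * t ^ (-α)) (Ioo 0 b) := by
    rcases le_or_gt b 0 with h0 | h0
    · simp [Ioo_eq_empty_of_le h0]
    · have h1 := intervalIntegral.intervalIntegrable_rpow' (a := 0) (b := b)
        (r := -α) (by linarith)
      rw [intervalIntegrable_iff_integrableOn_Ioc_of_le h0.le] at h1
      exact (h1.mono_set Ioo_subset_Ioc_self).const_mul C
  refine Integrable.mono' h1 hm.aestronglyMeasurable ?_
  filter_upwards [ae_restrict_mem measurableSet_Ioo] with t ht
  have h2 := he (show t ∈ Ioo (0 : ℝ) 1 from ⟨ht.1, ht.2.trans hb⟩)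
  have h3 := hC t ⟨ht.1.le, ht.2.le⟩
  have h4 : 0 < t ^ α := Real.rpow_pos_of_pos ht.1 α
  rw [h2, norm_mul, Real.norm_eq_abs, abs_of_pos h4] at h3
  rw [Real.rpow_neg ht.1.le]
  rw [← div_eq_mul_inv, le_div_iff₀ h4, mul_comm]
  exact h3

namespace IsBoundaryFunction

variable {n : ℕ} {α : ℝ} {U : ℝ → ℝ}

lemma integrableOn_deriv (h : IsBoundaryFunction n α U) (hα : α < 1) {b : ℝ} (hb : b < 1) :
    IntegrableOn (deriv U) (Ioo 0 b) :=
  integrableOn_of_weighted hα hb (measurable_deriv U) h.deriv_weighted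

lemma contDiffOn_deriv (h : IsBoundaryFunction (n + 1) α U) :
    ContDiffOn ℝ n (deriv U) (Ioo 0 1) := by
  have := h.contDiffOn
  push_cast at this
  exact ((contDiffOn_succ_iff_deriv_of_isOpen isOpen_Ioo).1 this).2.2

lemma integral_deriv (h : IsBoundaryFunction (n + 1) α U) (hα : α < 1) {x : ℝ} (hx0 : 0 ≤ x)
    (hx : x < 1) : ∫ t in Ioo 0 x, deriv U t = U x := by
  have hI : IntervalIntegrable (deriv U) volume 0 x := by
    rw [intervalIntegrable_iff_integrableOn_Ioo_of_le hx0]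
    exact h.integrableOn_deriv hα hx
  have h1 := intervalIntegral.integral_eq_sub_of_hasDerivAt_of_le hx0
    (h.continuousOn.mono fun t ht => ⟨ht.1, ht.2.trans_lt hx⟩)
    (fun t ht => by
      have h2 := h.contDiffOn.contDiffAt (Ioo_mem_nhds ht.1 (ht.2.trans hx))
      exact (h2.differentiableAt (by simp)).hasDerivAt) hI
  rw [h.map_zero, sub_zero, intervalIntegral.integral_of_le hx0, integral_Ioc_eq_integral_Ioo] at h1
  exact h1

/-- The only derivative lost is that from `U` to `U'`; the Abel transform preserves the class. -/
lemma contDiffOn_h₀ (h : IsBoundaryFunction (n + 1) α U) (hα : α < 1) :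
    ContDiffOn ℝ n (h₀ U) (Ioo 0 1) := by
  have h1 : ContDiffOn ℝ n (fun k : ℝ => √(1 - k)) (Ioo 0 1) := by
    apply ContDiffOn.sqrt (by fun_prop)
    intro k hk
    have := hk.2
    linarith
  exact h1.mul (contDiffOn_abelInt h.contDiffOn_deriv fun b hb => h.integrableOn_deriv hα hb)

lemma integrableOn_h₀ (h : IsBoundaryFunction n α U) (hα : α < 1) {b : ℝ} (hb : b < 1) :
    IntegrableOn (h₀ U) (Ioo 0 b) := by
  refine (integrableOn_abelInt hb.le (h.integrableOn_deriv hα hb)).bdd_mul (c := 1)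
    (f := fun k : ℝ => √(1 - k)) (by fun_prop) ?_
  filter_upwards [ae_restrict_mem measurableSet_Ioo] with k hk
  rw [Real.norm_eq_abs, abs_of_nonneg (Real.sqrt_nonneg _)]
  apply Real.sqrt_le_one.2
  linarith [hk.1]

end IsBoundaryFunction

lemma h₁_eq (U : ℝ → ℝ) (k : ℝ) : h₁ U k = h₀ U (1 - k) := by
  unfold h₁ h₀
  rw [sub_sub_cancel]

end CollidingWaves

end

noncomputable section

namespace CollidingWaves

open Set MeasureTheory Filter Topology

/-! ### Superpositions of elementary solutions -/

/-- The superposition `∫_0^x h(k) / √((x - k) (1 - y - k)) dk` of elementary solutions. -/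
def superpos (h : ℝ → ℝ) (x y : ℝ) : ℝ :=
  ∫ k in Ioo 0 x, h k * abelKer (x - k) * (1 / √(1 - y - k))

lemma continuousOn_inv_sqrt_sub {x y : ℝ} (hxy : x + y < 1) :
    ContinuousOn (fun k : ℝ => 1 / √(1 - y - k)) (Icc 0 x) := by
  have : ∀ k ∈ Icc 0 x, √(1 - y - k) ≠ 0 := fun k hk =>
    (Real.sqrt_pos.2 (by linarith [hk.2])).ne'
  fun_prop (disch := assumption)

lemma integrableOn_mul_continuousOn {x : ℝ} {f φ : ℝ → ℝ} (hf : IntegrableOn f (Ioo 0 x))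
    (hφ : ContinuousOn φ (Icc 0 x)) : IntegrableOn (fun k => f k * φ k) (Ioo 0 x) := by
  rw [← integrableOn_Icc_iff_integrableOn_Ioo] at hf ⊢
  exact hf.mul_continuousOn hφ isCompact_Icc

lemma integral_abelKer_sub {k x : ℝ} (hk : k ∈ Ioo 0 x) (hx : x ≤ 1) :
    ∫ s in Ioo 0 x, abelKer (s - k) = 2 * √(x - k) := by
  have h1 : ∫ s in Ioo 0 x, abelKer (s - k) = ∫ s in Ioc k x, abelKer (s - k) := by
    rw [← integral_Ioc_eq_integral_Ioo]
    symm
    refine (setIntegral_eq_of_subset_of_forall_sdiff_eq_zero measurableSet_Ioc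
      (Ioc_subset_Ioc_left hk.1.le) ?_).symm
    intro s hs
    apply abelKer_of_nonpos
    by_contra h
    exact hs.2 ⟨by linarith, hs.1.2⟩
  have h2 := intervalIntegral.integral_comp_sub_right (a := k) (b := x) abelKer k
  rw [sub_self, intervalIntegral.integral_of_le hk.2.le] at h2
  have hxk : 0 < x - k := sub_pos.2 hk.2
  rw [h1, h2]
  have h3 := intervalIntegral.integral_eq_sub_of_hasDerivAt_of_le (f := fun s => 2 * √s)
    (f' := abelKer) hxk.le (by fun_prop) (fun s hs => by
      have := (Real.hasDerivAt_sqrt hs.1.ne').const_mul 2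
      refine this.congr_deriv ?_
      rw [abelKer_eq (by linarith [hs.2, hk.1])]
      field_simp) integrable_abelKer.intervalIntegrable
  rw [h3]
  simp

lemma integral_inv_sqrt_sub {k x y : ℝ} (hk : k < x) (hy : 0 ≤ y) (hxy : x + y < 1) :
    ∫ t in Ioo 0 y, 1 / √(1 - t - k) = 2 * (√(1 - k) - √(1 - y - k)) := by
  rw [← integral_Ioc_eq_integral_Ioo, ← intervalIntegral.integral_of_le hy]
  have hpos : ∀ t ∈ uIcc 0 y, 0 < 1 - t - k := fun t ht => by
    rw [uIcc_of_le hy] at ht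
    linarith [ht.2]
  have h3 := intervalIntegral.integral_eq_sub_of_hasDerivAt (a := 0) (b := y)
    (f := fun t => -(2 * √(1 - t - k))) (f' := fun t => 1 / √(1 - t - k)) (fun t ht => by
      have h1 : HasDerivAt (fun t : ℝ => 1 - t - k) (-1) t := by
        simpa using ((hasDerivAt_id t).const_sub 1).sub_const k
      refine ((h1.sqrt (hpos t ht).ne').const_mul 2).neg.congr_deriv ?_
      have := Real.sqrt_pos.2 (hpos t ht)
      field_simp) (by
      apply ContinuousOn.intervalIntegrable
      have : ∀ t ∈ uIcc 0 y, √(1 - t - k) ≠ 0 := fun t ht => (Real.sqrt_pos.2 (hpos t ht)).ne'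
      fun_prop (disch := assumption))
  rw [h3]
  simp only [sub_zero]
  ring

section

variable {h : ℝ → ℝ} {x y : ℝ}

lemma integral_superpos_right (hK : IntegrableOn (fun k => h k * abelKer (x - k)) (Ioo 0 x))
    (hy : 0 ≤ y) (hxy : x + y < 1) :
    IntegrableOn (fun t => superpos h x t) (Ioo 0 y) ∧
    ∫ t in Ioo 0 y, superpos h x t
      = ∫ k in Ioo 0 x, h k * abelKer (x - k) * (2 * (√(1 - k) - √(1 - y - k))) := by
  have hF : Integrable (fun p : ℝ × ℝ => h p.2 * abelKer (x - p.2) * (1 / √(1 - p.1 - p.2)))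
      ((volume.restrict (Ioo 0 y)).prod (volume.restrict (Ioo 0 x))) := by
    have h1 : Integrable (fun p : ℝ × ℝ => h p.2 * abelKer (x - p.2))
      ((volume.restrict (Ioo 0 y)).prod (volume.restrict (Ioo 0 x))) := hK.comp_snd _
    refine h1.mul_bdd (c := 1 / √(1 - x - y)) ?_ ?_
    · exact Measurable.aestronglyMeasurable (by fun_prop)
    · rw [Measure.prod_restrict]
      filter_upwards [ae_restrict_mem (measurableSet_Ioo.prod measurableSet_Ioo)] with p hp
      have h2 : 0 < √(1 - x - y) := Real.sqrt_pos.2 (by linarith)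
      rw [Real.norm_eq_abs, abs_of_nonneg (by positivity)]
      apply one_div_le_one_div_of_le h2
      apply Real.sqrt_le_sqrt
      linarith [hp.1.2, hp.2.2]
  refine ⟨hF.integral_prod_left, ?_⟩
  unfold superpos
  rw [integral_integral_swap hF]
  refine setIntegral_congr_fun measurableSet_Ioo (fun k hk => ?_)
  rw [integral_const_mul, integral_inv_sqrt_sub hk.2 hy hxy]

/-- Integrating the kernel in `s` gives `2 √(x - k)`, written as `2 (x - k) / √(x - k)` so that all
terms of the weak equation share the factor `abelKer (x - k)`. -/
lemma integral_superpos_left (hh : IntegrableOn h (Ioo 0 x)) (hy : 0 ≤ y) (hxy : x + y < 1) :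
    IntegrableOn (fun s => superpos h s y) (Ioo 0 x) ∧
    ∫ s in Ioo 0 x, superpos h s y
      = ∫ k in Ioo 0 x, h k * abelKer (x - k) * (2 * (x - k) / √(1 - y - k)) := by
  set q : ℝ → ℝ := fun k => h k * (1 / √(1 - y - k)) with hq
  have hqI : IntegrableOn q (Ioo 0 x) :=
    integrableOn_mul_continuousOn hh (continuousOn_inv_sqrt_sub hxy)
  have hF : Integrable (fun p : ℝ × ℝ => q p.2 * abelKer (p.1 - p.2))
      ((volume.restrict (Ioo 0 x)).prod (volume.restrict (Ioo 0 x))) := by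
    have h1 := (integrable_indicator_of hqI).convolution_integrand
      (ContinuousLinearMap.mul ℝ ℝ) integrable_abelKer
    rw [Measure.prod_restrict]
    refine h1.integrableOn.congr_fun (fun p hp => ?_) (measurableSet_Ioo.prod measurableSet_Ioo)
    simp only [ContinuousLinearMap.mul_apply']
    rw [indicator_of_mem hp.2]
  have hs : ∀ s ∈ Ioo 0 x, ∫ k in Ioo 0 x, q k * abelKer (s - k) = superpos h s y := by
    intro s hs
    unfold superpos
    rw [setIntegral_eq_of_subset_of_forall_sdiff_eq_zero measurableSet_Ioo
      (Ioo_subset_Ioo_right hs.2.le)]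
    · congr 1
      ext k
      simp only [hq]
      ring
    · intro k hk
      rw [abelKer_of_nonpos, mul_zero]
      by_contra h'
      exact hk.2 ⟨hk.1.1, by linarith⟩
  refine ⟨IntegrableOn.congr_fun hF.integral_prod_left hs measurableSet_Ioo, ?_⟩
  rw [← setIntegral_congr_fun measurableSet_Ioo hs, integral_integral_swap hF]
  refine setIntegral_congr_fun measurableSet_Ioo (fun k hk => ?_)
  rw [integral_const_mul, integral_abelKer_sub hk (by linarith)]
  simp only [hq]
  have hpos : 0 < x - k := sub_pos.2 hk.2
  rw [abelKer_eq (by linarith [hk.1])]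
  have h1 := Real.sqrt_pos.2 hpos
  have h2 := Real.mul_self_sqrt hpos.le
  have h3 : 2 * (x - k) = 2 * √(x - k) * √(x - k) := by rw [mul_assoc, h2]
  rw [h3]
  field_simp

/-- After Fubini every term is an integral over `k` against the same density, and the combined
integrand vanishes identically: the identity is that of the single elementary solution. No
derivative of the superposition or of `h` is taken. -/
lemma superpos_weak (hh : IntegrableOn h (Ioo 0 x))
    (hK : IntegrableOn (fun k => h k * abelKer (x - k)) (Ioo 0 x))
    (hy : 0 ≤ y) (hxy : x + y < 1) :
    2 * (1 - x - y) * superpos h x y - 2 * (1 - x) * superpos h x 0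
      + (∫ t in Ioo 0 y, superpos h x t) + (∫ s in Ioo 0 x, superpos h s y)
      - ∫ s in Ioo 0 x, superpos h s 0 = 0 := by
  rw [(integral_superpos_right hK hy hxy).2, (integral_superpos_left hh hy hxy).2,
    (integral_superpos_left hh le_rfl (by linarith : x + 0 < 1)).2]
  unfold superpos
  have hx0 : x + 0 < 1 := by linarith
  have c1 := continuousOn_inv_sqrt_sub hxy
  have c2 := continuousOn_inv_sqrt_sub hx0
  have i1 := integrableOn_mul_continuousOn hK c1
  have i2 := integrableOn_mul_continuousOn hK c2
  have i3 := integrableOn_mul_continuousOn hK (φ := fun k => 2 * (√(1 - k) - √(1 - y - k)))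
    (by fun_prop)
  have i4 := integrableOn_mul_continuousOn hK (φ := fun k => 2 * (x - k) / √(1 - y - k)) (by
    have := (show ContinuousOn (fun k : ℝ => 2 * (x - k)) (Icc 0 x) by fun_prop).mul c1
    refine this.congr fun k _ => ?_
    simp [div_eq_mul_inv])
  have i5 := integrableOn_mul_continuousOn hK (φ := fun k => 2 * (x - k) / √(1 - 0 - k)) (by
    have := (show ContinuousOn (fun k : ℝ => 2 * (x - k)) (Icc 0 x) by fun_prop).mul c2
    refine this.congr fun k _ => ?_
    simp [div_eq_mul_inv])
  rw [← integral_const_mul, ← integral_const_mul]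
  have j1 := i1.const_mul (2 * (1 - x - y))
  have j2 := i2.const_mul (2 * (1 - x))
  have j12 := j1.sub j2
  have j123 := j12.add i3
  have j1234 := j123.add i4
  simp only [Pi.add_def, Pi.sub_def] at j12 j123 j1234
  rw [← integral_sub j1 j2, ← integral_add j12 i3, ← integral_add j123 i4,
    ← integral_sub j1234 i5]
  rw [setIntegral_congr_fun (g := fun _ => 0) measurableSet_Ioo]
  · simp
  · intro k hk
    have hp : 0 < x - k := sub_pos.2 hk.2
    have hm : 0 < 1 - y - k := by linarith
    have hn : 0 < 1 - k := by linarith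
    simp only [sub_zero]
    have s2 := Real.mul_self_sqrt hm.le
    have s3 := Real.mul_self_sqrt hn.le
    have t2 := Real.sqrt_pos.2 hm
    have t3 := Real.sqrt_pos.2 hn
    -- Expressing `1 - x - y` and `1 - x` through the square roots turns the identity into a
    -- polynomial one.
    have e1 : 1 - x - y = √(1 - y - k) * √(1 - y - k) - (x - k) := by rw [s2]; ring
    have e2 : 1 - x = √(1 - k) * √(1 - k) - (x - k) := by rw [s3]; ring
    rw [e1, e2]
    field_simp
    ring

end

/-! ### The representation of the solution -/

namespace IsBoundaryFunction

variable {n : ℕ} {α : ℝ} {U : ℝ → ℝ}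

lemma integrableOn_h₀_mul (h : IsBoundaryFunction n α U) (hα : α < 1) {x : ℝ} (hx : x < 1) :
    IntegrableOn (fun k => h₀ U k * abelKer (x - k)) (Ioo 0 x) := by
  have h1 := (integral_abelInt_mul hx.le (h.integrableOn_deriv hα hx)).1
  refine (integrableOn_mul_continuousOn h1 (φ := fun k => √(1 - k)) (by fun_prop)).congr_fun
    (fun k _ => ?_) measurableSet_Ioo
  simp only [h₀, abelInt]
  ring

/-- On the axis the factor `√(1 - k)` in the density cancels the second factor of the kernel, and
what remains is Abel inversion. -/
lemma superpos_zero (h : IsBoundaryFunction (n + 1) α U) (hα : α < 1) {x : ℝ} (hx0 : 0 ≤ x)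
    (hx : x < 1) : superpos (h₀ U) x 0 = Real.pi * U x := by
  rw [← h.integral_deriv hα hx0 hx, ← (integral_abelInt_mul hx.le (h.integrableOn_deriv hα hx)).2]
  unfold superpos
  refine setIntegral_congr_fun measurableSet_Ioo (fun k hk => ?_)
  have h1 : 0 < √(1 - k) := Real.sqrt_pos.2 (by linarith [hk.2])
  simp only [h₀, abelInt, sub_zero]
  field_simp

/-- The density is dominated by the Abel transform of `|U'|`, and Abel inversion applied to `|U'|`
gives a bound uniform down to `x = 0`. -/
lemma abs_superpos_le (h : IsBoundaryFunction n α U) (hα : α < 1) {η : ℝ} (hη : 0 < η) :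
    ∃ C : ℝ, ∀ x y : ℝ, 0 ≤ x → 0 ≤ y → x + y ≤ 1 - η → |superpos (h₀ U) x y| ≤ C := by
  refine ⟨1 / √η * (Real.pi * ∫ t in Ioo 0 (1 - η), |deriv U t|), fun x y hx hy hxy => ?_⟩
  have hx1 : x ≤ 1 - η := by linarith
  have hI := h.integrableOn_deriv hα (b := 1 - η) (by linarith)
  have hI' : IntegrableOn (fun t => |deriv U t|) (Ioo 0 x) :=
    (hI.mono_set (Ioo_subset_Ioo_right hx1)).abs
  obtain ⟨h1, h2⟩ := integral_abelInt_mul (x := x) (by linarith) hI'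
  have h3 : ‖superpos (h₀ U) x y‖
      ≤ ∫ k in Ioo 0 x, 1 / √η * (abelInt (fun t => |deriv U t|) k * abelKer (x - k)) := by
    apply norm_integral_le_of_norm_le (h1.const_mul _)
    filter_upwards [ae_restrict_mem measurableSet_Ioo] with k hk
    rw [norm_mul, norm_mul]
    have e1 : ‖h₀ U k‖ ≤ abelInt (fun t => |deriv U t|) k := by
      have a1 : |√(1 - k)| ≤ 1 := by
        rw [abs_of_nonneg (Real.sqrt_nonneg _)]
        exact Real.sqrt_le_one.2 (by linarith [hk.1])
      have a2 := abs_abelInt_le (deriv U) hk.1.le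
      change |√(1 - k) * abelInt (deriv U) k| ≤ _
      rw [abs_mul]
      calc _ ≤ 1 * |abelInt (deriv U) k| := by gcongr
        _ ≤ _ := by rw [one_mul]; exact a2
    have e2 : ‖1 / √(1 - y - k)‖ ≤ 1 / √η := by
      rw [Real.norm_eq_abs, abs_of_nonneg (by positivity)]
      apply one_div_le_one_div_of_le (Real.sqrt_pos.2 hη)
      apply Real.sqrt_le_sqrt
      linarith [hk.2]
    have e3 : ‖abelKer (x - k)‖ = abelKer (x - k) := by
      rw [Real.norm_eq_abs, abs_of_nonneg (abelKer_nonneg _)]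
    have e4 := abelKer_nonneg (x - k)
    rw [e3]
    calc _ ≤ abelInt (fun t => |deriv U t|) k * abelKer (x - k) * (1 / √η) := by
          gcongr
          exact mul_nonneg ((norm_nonneg _).trans e1) e4
      _ = _ := by ring
  rw [integral_const_mul, h2] at h3
  refine h3.trans ?_
  have h4 : ∫ t in Ioo 0 x, |deriv U t| ≤ ∫ t in Ioo 0 (1 - η), |deriv U t| :=
    setIntegral_mono_set hI.abs (Eventually.of_forall fun t => abs_nonneg _)
      (Ioo_subset_Ioo_right hx1).eventuallyLE
  have := Real.pi_pos
  gcongr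

end IsBoundaryFunction

end CollidingWaves

end

noncomputable section

namespace CollidingWaves

open Set MeasureTheory Filter Topology

/-! ### The weak form of the Euler--Darboux equation -/

lemma mem_interior_triangle {x y : ℝ} (hx : 0 < x) (hy : 0 < y) (hxy : x + y < 1) :
    (x, y) ∈ interior triangle := by
  have h1 : IsOpen {p : ℝ × ℝ | 0 < p.1 ∧ 0 < p.2 ∧ p.1 + p.2 < 1} :=
    (isOpen_lt continuous_const continuous_fst).inter
      ((isOpen_lt continuous_const continuous_snd).inter
        (isOpen_lt (continuous_fst.add continuous_snd) continuous_const))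
  have h2 : {p : ℝ × ℝ | 0 < p.1 ∧ 0 < p.2 ∧ p.1 + p.2 < 1} ⊆ triangle :=
    fun p hp => ⟨hp.1.le, hp.2.1.le, hp.2.2⟩
  exact interior_maximal h2 h1 ⟨hx, hy, hxy⟩

/-- `V` is a classical solution of the Euler--Darboux equation in the interior of the triangle. -/
structure IsClassicalSolution (V : ℝ → ℝ → ℝ) : Prop where
  contDiffOn : ContDiffOn ℝ 2 (fun p : ℝ × ℝ => V p.1 p.2) (interior triangle)
  equation : ∀ x y : ℝ, (x, y) ∈ interior triangle →
      partialY (partialX V) x y - (partialX V x y + partialY V x y) / (2 * (1 - x - y)) = 0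

namespace IsClassicalSolution

variable {V : ℝ → ℝ → ℝ}

lemma contDiffAt (h : IsClassicalSolution V) {p : ℝ × ℝ} (hp : p ∈ interior triangle) :
    ContDiffAt ℝ 2 (fun p : ℝ × ℝ => V p.1 p.2) p :=
  h.contDiffOn.contDiffAt (isOpen_interior.mem_nhds hp)

lemma hasFDerivAt (h : IsClassicalSolution V) {p : ℝ × ℝ} (hp : p ∈ interior triangle) :
    HasFDerivAt (fun p : ℝ × ℝ => V p.1 p.2) (fderiv ℝ (fun p : ℝ × ℝ => V p.1 p.2) p) p :=
  ((h.contDiffAt hp).differentiableAt (by norm_num)).hasFDerivAt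

lemma hasFDerivAt_fderiv (h : IsClassicalSolution V) {p : ℝ × ℝ} (hp : p ∈ interior triangle) :
    HasFDerivAt (fderiv ℝ (fun p : ℝ × ℝ => V p.1 p.2))
      (fderiv ℝ (fderiv ℝ (fun p : ℝ × ℝ => V p.1 p.2)) p) p := by
  have h1 : ContDiffAt ℝ 1 (fderiv ℝ (fun p : ℝ × ℝ => V p.1 p.2)) p :=
    (h.contDiffAt hp).fderiv_right (by norm_num)
  exact (h1.differentiableAt (by norm_num)).hasFDerivAt

lemma hasDerivAt_fst (h : IsClassicalSolution V) {x y : ℝ} (hp : (x, y) ∈ interior triangle) :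
    HasDerivAt (fun s => V s y) (fderiv ℝ (fun p : ℝ × ℝ => V p.1 p.2) (x, y) (1, 0)) x :=
  HasFDerivAt.comp_hasDerivAt (f := fun s : ℝ => (s, y)) x (h.hasFDerivAt hp)
    ((hasDerivAt_id' x).prodMk (hasDerivAt_const x y))

lemma hasDerivAt_snd (h : IsClassicalSolution V) {x y : ℝ} (hp : (x, y) ∈ interior triangle) :
    HasDerivAt (fun t => V x t) (fderiv ℝ (fun p : ℝ × ℝ => V p.1 p.2) (x, y) (0, 1)) y :=
  HasFDerivAt.comp_hasDerivAt (f := fun t : ℝ => (x, t)) y (h.hasFDerivAt hp)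
    ((hasDerivAt_const y x).prodMk (hasDerivAt_id' y))

lemma partialX_eq (h : IsClassicalSolution V) {x y : ℝ} (hp : (x, y) ∈ interior triangle) :
    partialX V x y = fderiv ℝ (fun p : ℝ × ℝ => V p.1 p.2) (x, y) (1, 0) :=
  (h.hasDerivAt_fst hp).deriv

lemma partialY_eq (h : IsClassicalSolution V) {x y : ℝ} (hp : (x, y) ∈ interior triangle) :
    partialY V x y = fderiv ℝ (fun p : ℝ × ℝ => V p.1 p.2) (x, y) (0, 1) :=
  (h.hasDerivAt_snd hp).deriv

lemma partialY_partialX_eq (h : IsClassicalSolution V) {x y : ℝ}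
    (hp : (x, y) ∈ interior triangle) : partialY (partialX V) x y =
      fderiv ℝ (fderiv ℝ (fun p : ℝ × ℝ => V p.1 p.2)) (x, y) (0, 1) (1, 0) := by
  have h1 : (fun t => partialX V x t) =ᶠ[𝓝 y]
      fun t => fderiv ℝ (fun p : ℝ × ℝ => V p.1 p.2) (x, t) (1, 0) := by
    have : ∀ᶠ t in 𝓝 y, (x, t) ∈ interior triangle :=
      (show Continuous fun t : ℝ => (x, t) by fun_prop).continuousAt.eventually_mem
        (isOpen_interior.mem_nhds hp)
    filter_upwards [this] with t ht using h.partialX_eq ht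
  have h2 := (h.hasFDerivAt_fderiv hp).comp_hasDerivAt y
    ((hasDerivAt_const y x).prodMk (hasDerivAt_id y))
  have h3 := h2.clm_apply (hasDerivAt_const y ((1, 0) : ℝ × ℝ))
  unfold partialY
  rw [h1.deriv_eq]
  simpa using h3.deriv

/-- The weak form on a rectangle in the interior. -/
lemma weak_rectangle (h : IsClassicalSolution V) {a b x y : ℝ} (ha : 0 < a) (hb : 0 < b)
    (hax : a ≤ x) (hby : b ≤ y) (hxy : x + y < 1) :
    2 * ((1 - x - y) * V x y - (1 - x - b) * V x b - (1 - a - y) * V a y + (1 - a - b) * V a b)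
      + ((∫ t in b..y, V x t) - ∫ t in b..y, V a t)
      + ((∫ s in a..x, V s y) - ∫ s in a..x, V s b) = 0 := by
  set F : ℝ × ℝ → ℝ := fun p => V p.1 p.2 with hF
  have hmem : ∀ s ∈ Icc a x, ∀ t ∈ Icc b y, (s, t) ∈ interior triangle := fun s hs t ht =>
    mem_interior_triangle (ha.trans_le hs.1) (hb.trans_le ht.1) (by linarith [hs.2, ht.2])
  -- The field `(ρ V_y, ρ V_x)` has divergence `2 ρ V_xy - V_x - V_y`, which the equation makes
  -- zero.
  set f : ℝ × ℝ → ℝ := fun p => (1 - p.1 - p.2) * fderiv ℝ F p (0, 1) with hf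
  set g : ℝ × ℝ → ℝ := fun p => (1 - p.1 - p.2) * fderiv ℝ F p (1, 0) with hg
  set D : ℝ × ℝ → (ℝ × ℝ →L[ℝ] ℝ × ℝ →L[ℝ] ℝ) := fderiv ℝ (fderiv ℝ F) with hD
  set ρ' : ℝ × ℝ →L[ℝ] ℝ := -ContinuousLinearMap.fst ℝ ℝ ℝ - ContinuousLinearMap.snd ℝ ℝ ℝ with hρ'
  have hρ : ∀ p : ℝ × ℝ, HasFDerivAt (fun p : ℝ × ℝ => 1 - p.1 - p.2) ρ' p := by
    intro p
    have := ((hasFDerivAt_fst (𝕜 := ℝ) (p := p)).const_sub 1).sub (hasFDerivAt_snd (𝕜 := ℝ) (p := p))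
    exact this
  have happ : ∀ (w : ℝ × ℝ) (p : ℝ × ℝ), p ∈ interior triangle →
      HasFDerivAt (fun p => fderiv ℝ F p w) ((D p).flip w) p := by
    intro w p hp
    have := (h.hasFDerivAt_fderiv hp).clm_apply (hasFDerivAt_const w p)
    refine this.congr_fderiv ?_
    ext <;> simp [hD, hF]
  have hdf : ∀ p ∈ interior triangle, HasFDerivAt f
      ((1 - p.1 - p.2) • (D p).flip (0, 1) + fderiv ℝ F p (0, 1) • ρ') p := fun p hp =>
    (hρ p).mul (happ (0, 1) p hp)
  have hdg : ∀ p ∈ interior triangle, HasFDerivAt g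
      ((1 - p.1 - p.2) • (D p).flip (1, 0) + fderiv ℝ F p (1, 0) • ρ') p := fun p hp =>
    (hρ p).mul (happ (1, 0) p hp)
  have hsub : uIcc a x ×ˢ uIcc b y ⊆ interior triangle := by
    rw [uIcc_of_le hax, uIcc_of_le hby]
    rintro ⟨s, t⟩ ⟨hs, ht⟩
    exact hmem s hs t ht
  have hzero : ∀ p ∈ interior triangle,
      ((1 - p.1 - p.2) • (D p).flip (0, 1) + fderiv ℝ F p (0, 1) • ρ') (1, 0)
        + ((1 - p.1 - p.2) • (D p).flip (1, 0) + fderiv ℝ F p (1, 0) • ρ') (0, 1) = 0 := by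
    intro p hp
    obtain ⟨s, t⟩ := p
    have hsymm : D (s, t) (1, 0) (0, 1) = D (s, t) (0, 1) (1, 0) :=
      ((h.contDiffAt hp).isSymmSndFDerivAt (by simp)).eq (1, 0) (0, 1)
    have hρ0 : 1 - s - t ≠ 0 := by
      have := (interior_subset hp).2.2
      simp only at this
      intro h0
      linarith
    have he := h.equation s t hp
    rw [h.partialY_partialX_eq hp, h.partialX_eq hp, h.partialY_eq hp, ← hF, ← hD] at he
    simp only [hρ', add_apply, smul_apply,
      ContinuousLinearMap.flip_apply, sub_apply, neg_apply,
      ContinuousLinearMap.coe_fst', ContinuousLinearMap.coe_snd', smul_eq_mul, hsymm]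
    field_simp at he
    linarith
  have hInn : ∀ p ∈ Ioo (min a x) (max a x) ×ˢ Ioo (min b y) (max b y) \ (∅ : Set (ℝ × ℝ)),
      p ∈ interior triangle := by
    rw [min_eq_left hax, max_eq_right hax, min_eq_left hby, max_eq_right hby]
    rintro ⟨s, t⟩ ⟨⟨hs, ht⟩, _⟩
    exact hmem s (Ioo_subset_Icc_self hs) t (Ioo_subset_Icc_self ht)
  have hdiv := integral2_divergence_prod_of_hasFDerivAt_off_countable f g
    (fun p => (1 - p.1 - p.2) • (D p).flip (0, 1) + fderiv ℝ F p (0, 1) • ρ')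
    (fun p => (1 - p.1 - p.2) • (D p).flip (1, 0) + fderiv ℝ F p (1, 0) • ρ')
    a b x y ∅ countable_empty
    (fun p hp => (hdf p (hsub hp)).continuousAt.continuousWithinAt)
    (fun p hp => (hdg p (hsub hp)).continuousAt.continuousWithinAt)
    (fun p hp => hdf p (hInn p hp)) (fun p hp => hdg p (hInn p hp))
    (by
      refine (integrableOn_zero (s := uIcc a x ×ˢ uIcc b y)).congr_fun (fun p hp => ?_)
        (measurableSet_uIcc.prod measurableSet_uIcc)
      exact (hzero p (hsub hp)).symm)
  have hlhs : (∫ s in a..x, ∫ t in b..y,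
      ((1 - (s, t).1 - (s, t).2) • (D (s, t)).flip (0, 1) + fderiv ℝ F (s, t) (0, 1) • ρ') (1, 0)
      + ((1 - (s, t).1 - (s, t).2) • (D (s, t)).flip (1, 0)
        + fderiv ℝ F (s, t) (1, 0) • ρ') (0, 1)) = 0 := by
    rw [intervalIntegral.integral_congr (g := fun _ => (0 : ℝ))]
    · simp
    · intro s hs
      simp only
      rw [intervalIntegral.integral_congr (g := fun _ => (0 : ℝ))]
      · simp
      · intro t ht
        exact hzero (s, t) (hsub ⟨hs, ht⟩)
  rw [hlhs] at hdiv
  have hcontF : ContinuousOn F (interior triangle) := h.contDiffOn.continuousOn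
  have hcontf : ContinuousOn f (interior triangle) := fun p hp =>
    (hdf p hp).continuousAt.continuousWithinAt
  have hcontg : ContinuousOn g (interior triangle) := fun p hp =>
    (hdg p hp).continuousAt.continuousWithinAt
  -- Integration by parts along a side, where `ρ` has slope `-1`, removes the derivative of `V` from
  -- the flux.
  have vert : ∀ s ∈ Icc a x, ∫ t in b..y, f (s, t)
      = (1 - s - y) * V s y - (1 - s - b) * V s b + ∫ t in b..y, V s t := by
    intro s hs
    have hm : MapsTo (fun t : ℝ => (s, t)) (uIcc b y) (interior triangle) := fun t ht => by
      rw [uIcc_of_le hby] at ht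
      exact hmem s hs t ht
    have i1 : IntervalIntegrable (fun t => f (s, t)) volume b y :=
      (hcontf.comp (by fun_prop) hm).intervalIntegrable
    have i2 : IntervalIntegrable (fun t => V s t) volume b y :=
      (hcontF.comp (f := fun t : ℝ => (s, t)) (by fun_prop) hm).intervalIntegrable
    have := intervalIntegral.integral_eq_sub_of_hasDerivAt (a := b) (b := y)
      (f := fun t => (1 - s - t) * V s t) (f' := fun t => f (s, t) - V s t) (fun t ht => by
        have h1 : HasDerivAt (fun t : ℝ => 1 - s - t) (-1) t := by
          simpa using (hasDerivAt_id t).const_sub (1 - s)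
        refine (h1.mul (h.hasDerivAt_snd (hm ht))).congr_deriv ?_
        simp only [hf, hF]
        ring) (i1.sub i2)
    rw [intervalIntegral.integral_sub i1 i2] at this
    linarith
  have horiz : ∀ t ∈ Icc b y, ∫ s in a..x, g (s, t)
      = (1 - x - t) * V x t - (1 - a - t) * V a t + ∫ s in a..x, V s t := by
    intro t ht
    have hm : MapsTo (fun s : ℝ => (s, t)) (uIcc a x) (interior triangle) := fun s hs => by
      rw [uIcc_of_le hax] at hs
      exact hmem s hs t ht
    have i1 : IntervalIntegrable (fun s => g (s, t)) volume a x :=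
      (hcontg.comp (by fun_prop) hm).intervalIntegrable
    have i2 : IntervalIntegrable (fun s => V s t) volume a x :=
      (hcontF.comp (f := fun s : ℝ => (s, t)) (by fun_prop) hm).intervalIntegrable
    have := intervalIntegral.integral_eq_sub_of_hasDerivAt (a := a) (b := x)
      (f := fun s => (1 - s - t) * V s t) (f' := fun s => g (s, t) - V s t) (fun s hs => by
        have h1 : HasDerivAt (fun s : ℝ => 1 - s - t) (-1) s := by
          simpa using ((hasDerivAt_id s).const_sub 1).sub_const t
        refine (h1.mul (h.hasDerivAt_fst (hm hs))).congr_deriv ?_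
        simp only [hg, hF]
        ring) (i1.sub i2)
    rw [intervalIntegral.integral_sub i1 i2] at this
    linarith
  rw [horiz y (right_mem_Icc.2 hby), horiz b (left_mem_Icc.2 hby), vert x (right_mem_Icc.2 hax),
    vert a (left_mem_Icc.2 hax)] at hdiv
  linarith

/-- The weak form on a rectangle with a corner at the origin. -/
lemma weak (h : IsClassicalSolution V)
    (hc : ContinuousOn (fun p : ℝ × ℝ => V p.1 p.2) triangle) {x y : ℝ} (hx : 0 < x) (hy : 0 < y)
    (hxy : x + y < 1) :
    2 * ((1 - x - y) * V x y - (1 - x) * V x 0 - (1 - y) * V 0 y + V 0 0)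
      + ((∫ t in (0 : ℝ)..y, V x t) - ∫ t in (0 : ℝ)..y, V 0 t)
      + ((∫ s in (0 : ℝ)..x, V s y) - ∫ s in (0 : ℝ)..x, V s 0) = 0 := by
  -- Projecting onto the rectangle extends `V` continuously to the plane, so integrals with a moving
  -- limit and parameter are continuous in `η`.
  set W : ℝ → ℝ → ℝ := fun s t => V (projIcc 0 x hx.le s) (projIcc 0 y hy.le t) with hW
  have hWc : Continuous (fun p : ℝ × ℝ => W p.1 p.2) := by
    refine hc.comp_continuous (f := fun p : ℝ × ℝ =>
      (((projIcc 0 x hx.le p.1 : Icc 0 x) : ℝ), ((projIcc 0 y hy.le p.2 : Icc 0 y) : ℝ)))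
      (by fun_prop) (fun p => ?_)
    have h1 := (projIcc 0 x hx.le p.1).2
    have h2 := (projIcc 0 y hy.le p.2).2
    exact ⟨h1.1, h2.1, by linarith [h1.2, h2.2]⟩
  have hWe : ∀ s ∈ Icc 0 x, ∀ t ∈ Icc 0 y, W s t = V s t := by
    intro s hs t ht
    simp only [hW]
    rw [projIcc_of_mem hx.le hs, projIcc_of_mem hy.le ht]
  set E : ℝ → ℝ := fun η =>
    2 * ((1 - x - y) * W x y - (1 - x - η) * W x η - (1 - η - y) * W η y + (1 - η - η) * W η η)
      + ((∫ t in η..y, W x t) - ∫ t in η..y, W η t)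
      + ((∫ s in η..x, W s y) - ∫ s in η..x, W s η) with hE
  have c1 : Continuous fun η => W x η := hWc.comp (f := fun η : ℝ => (x, η)) (by fun_prop)
  have c2 : Continuous fun η => W η y := hWc.comp (f := fun η : ℝ => (η, y)) (by fun_prop)
  have c3 : Continuous fun η => W η η := hWc.comp (f := fun η : ℝ => (η, η)) (by fun_prop)
  have cpar : ∀ (f : ℝ → ℝ → ℝ) (z : ℝ), Continuous (Function.uncurry f) →
      Continuous fun η => ∫ t in η..z, f η t := by
    intro f z hf
    have := (intervalIntegral.continuous_parametric_intervalIntegral_of_continuous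
      (μ := volume) (a₀ := z) hf continuous_id).neg
    refine this.congr fun η => ?_
    exact (intervalIntegral.integral_symm _ _).symm
  have hEc : Continuous E := by
    have d1 := cpar (fun _ t => W x t) y (hWc.comp (f := fun p : ℝ × ℝ => (x, p.2)) (by fun_prop))
    have d2 := cpar (fun η t => W η t) y hWc
    have d3 := cpar (fun _ s => W s y) x (hWc.comp (f := fun p : ℝ × ℝ => (p.2, y)) (by fun_prop))
    have d4 := cpar (fun η s => W s η) x (hWc.comp (f := fun p : ℝ × ℝ => (p.2, p.1)) (by fun_prop))
    simp only [hE]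
    fun_prop
  have hI : ∀ (η : ℝ), 0 ≤ η → η ≤ x → η ≤ y →
      E η = 2 * ((1 - x - y) * V x y - (1 - x - η) * V x η - (1 - η - y) * V η y
        + (1 - η - η) * V η η) + ((∫ t in η..y, V x t) - ∫ t in η..y, V η t)
      + ((∫ s in η..x, V s y) - ∫ s in η..x, V s η) := by
    intro η h0 h1 h2
    have mx : x ∈ Icc 0 x := ⟨hx.le, le_rfl⟩
    have my : y ∈ Icc 0 y := ⟨hy.le, le_rfl⟩
    have mη : η ∈ Icc 0 x := ⟨h0, h1⟩
    have mη' : η ∈ Icc 0 y := ⟨h0, h2⟩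
    have v : ∀ s ∈ Icc 0 x, ∫ t in η..y, W s t = ∫ t in η..y, V s t := by
      intro s hs
      apply intervalIntegral.integral_congr
      intro t ht
      rw [uIcc_of_le h2] at ht
      exact hWe s hs t ⟨h0.trans ht.1, ht.2⟩
    have w : ∀ t ∈ Icc 0 y, ∫ s in η..x, W s t = ∫ s in η..x, V s t := by
      intro t ht
      apply intervalIntegral.integral_congr
      intro s hs
      rw [uIcc_of_le h1] at hs
      exact hWe s ⟨h0.trans hs.1, hs.2⟩ t ht
    simp only [hE]
    rw [v x mx, v η mη, w y my, w η mη', hWe x mx y my, hWe x mx η mη', hWe η mη y my,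
      hWe η mη η mη']
  have hE0 : ∀ η ∈ Ioo 0 (min x y), E η = 0 := by
    intro η hη
    have h1 := hη.2.le.trans (min_le_left x y)
    have h2 := hη.2.le.trans (min_le_right x y)
    rw [hI η hη.1.le h1 h2]
    exact h.weak_rectangle hη.1 hη.1 h1 h2 hxy
  -- The weak form contains only values of `V`, which is continuous up to the axes, so the corner
  -- `(η, η)` may tend to the origin whatever the derivatives do there.
  have hlim : E 0 = 0 := by
    have hm : 0 < min x y := lt_min hx hy
    have t1 : Tendsto E (𝓝[>] 0) (𝓝 (E 0)) := hEc.continuousAt.mono_left nhdsWithin_le_nhds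
    have t2 : Tendsto E (𝓝[>] 0) (𝓝 0) := by
      refine tendsto_const_nhds.congr' ?_
      filter_upwards [Ioo_mem_nhdsGT hm] with η hη using (hE0 η hη).symm
    exact tendsto_nhds_unique t1 t2
  rw [hI 0 le_rfl hx.le hy.le] at hlim
  simpa using hlim

end IsClassicalSolution

end CollidingWaves

end

noncomputable section

namespace CollidingWaves

open Set MeasureTheory Filter Topology

/-! ### Uniqueness and the representation formula -/

lemma integral_exp_le {lam x y : ℝ} (hl : 0 < lam) (hy : 0 ≤ y) :
    ∫ t in Ioo 0 y, Real.exp (lam * (x + t)) ≤ Real.exp (lam * (x + y)) / lam := by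
  rw [← integral_Ioc_eq_integral_Ioo, ← intervalIntegral.integral_of_le hy]
  have hd : ∀ t ∈ uIcc 0 y, HasDerivAt (fun t => Real.exp (lam * (x + t)) / lam)
      (Real.exp (lam * (x + t))) t := by
    intro t _
    have h1 : HasDerivAt (fun t : ℝ => lam * (x + t)) lam t := by
      simpa using ((hasDerivAt_id t).const_add x).const_mul lam
    refine (h1.exp.div_const lam).congr_deriv ?_
    field_simp
  rw [intervalIntegral.integral_eq_sub_of_hasDerivAt hd
    (Continuous.intervalIntegrable (by fun_prop) _ _)]
  have : 0 < Real.exp (lam * (x + 0)) / lam := by positivity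
  linarith

lemma abs_integral_le_exp {lam x y K : ℝ} (hl : 0 < lam) (hy : 0 ≤ y) (hK : 0 ≤ K) {w : ℝ → ℝ}
    (hw : ∀ t ∈ Ioo 0 y, |w t| ≤ K * Real.exp (lam * (x + t))) :
    |∫ t in Ioo 0 y, w t| ≤ K * (Real.exp (lam * (x + y)) / lam) := by
  have hint : IntegrableOn (fun t => K * Real.exp (lam * (x + t))) (Ioo 0 y) :=
    (Continuous.integrableOn_Icc (by fun_prop)).mono_set Ioo_subset_Icc_self
  refine (norm_integral_le_of_norm_le hint
    ((ae_restrict_iff' measurableSet_Ioo).2 (Eventually.of_forall fun t ht => (Real.norm_eq_abs _).trans_le (hw t ht)))).trans ?_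
  rw [integral_const_mul]
  exact mul_le_mul_of_nonneg_left (integral_exp_le hl hy) hK

/-- A bounded solution of the homogeneous weak equation vanishes. -/
lemma eq_zero_of_weak {W : ℝ → ℝ → ℝ} {η C : ℝ} (hη : 0 < η)
    (hb : ∀ x y, 0 ≤ x → 0 ≤ y → x + y ≤ 1 - η → |W x y| ≤ C)
    (he : ∀ x y, 0 ≤ x → 0 ≤ y → x + y ≤ 1 - η →
      2 * (1 - x - y) * W x y + (∫ t in Ioo 0 y, W x t) + ∫ s in Ioo 0 x, W s y = 0)
    {x y : ℝ} (hx : 0 ≤ x) (hy : 0 ≤ y) (hxy : x + y ≤ 1 - η) : W x y = 0 := by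
  have hC : 0 ≤ C := (abs_nonneg _).trans (hb x y hx hy hxy)
  -- In the weighted norm with exponent `2 / η` each integral gains a factor `η / 2`, and division
  -- by `2 (1 - x - y) ≥ 2 η` leaves a total factor `1/2` at each iteration.
  have hl : 0 < 2 / η := by positivity
  have key : ∀ n : ℕ, ∀ x y, 0 ≤ x → 0 ≤ y → x + y ≤ 1 - η →
      |W x y| ≤ C / 2 ^ n * Real.exp (2 / η * (x + y)) := by
    intro n
    induction n with
    | zero =>
      intro x y hx hy hxy
      refine (hb x y hx hy hxy).trans ?_
      rw [pow_zero, div_one]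
      exact le_mul_of_one_le_right hC (Real.one_le_exp (by positivity))
    | succ n ih =>
      intro x y hx hy hxy
      have h1 : |∫ t in Ioo 0 y, W x t| ≤ _ := abs_integral_le_exp (x := x) hl hy
        (by positivity : 0 ≤ C / 2 ^ n)
        (fun t ht => ih x t hx ht.1.le (by linarith [ht.2]))
      have h2 : |∫ s in Ioo 0 x, W s y| ≤ _ := abs_integral_le_exp (x := y) hl hx
        (by positivity : 0 ≤ C / 2 ^ n)
        (fun s hs => (ih s y hs.1.le hy (by linarith [hs.2])).trans_eq (by rw [add_comm s y]))
      have h3 := he x y hx hy hxy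
      have hρ : η ≤ 1 - x - y := by linarith
      have h4 : 2 * (1 - x - y) * |W x y| ≤
          |∫ t in Ioo 0 y, W x t| + |∫ s in Ioo 0 x, W s y| := by
        have : 2 * (1 - x - y) * W x y = -((∫ t in Ioo 0 y, W x t) + ∫ s in Ioo 0 x, W s y) := by
          linarith
        calc 2 * (1 - x - y) * |W x y| = |2 * (1 - x - y) * W x y| := by
              rw [abs_mul, abs_of_pos (by linarith : 0 < 2 * (1 - x - y))]
          _ = |(∫ t in Ioo 0 y, W x t) + ∫ s in Ioo 0 x, W s y| := by rw [this, abs_neg]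
          _ ≤ _ := abs_add_le _ _
      have h5 : 2 * η * |W x y| ≤ 2 * (1 - x - y) * |W x y| :=
        mul_le_mul_of_nonneg_right (by linarith) (abs_nonneg _)
      rw [add_comm y x] at h2
      have h6 : 2 * η * |W x y| ≤ 2 * η * (C / 2 ^ (n + 1) * Real.exp (2 / η * (x + y))) := by
        refine (h5.trans (h4.trans (add_le_add h1 h2))).trans_eq ?_
        field_simp
        ring
      exact le_of_mul_le_mul_left h6 (by positivity)
  have hlim : Tendsto (fun n : ℕ => C / 2 ^ n * Real.exp (2 / η * (x + y))) atTop (𝓝 0) := by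
    have := ((tendsto_pow_atTop_nhds_zero_of_lt_one (by norm_num : (0 : ℝ) ≤ 1 / 2)
      (by norm_num)).const_mul C).mul_const (Real.exp (2 / η * (x + y)))
    rw [mul_zero, zero_mul] at this
    refine this.congr fun n => ?_
    rw [div_pow, one_pow]
    ring
  have := ge_of_tendsto' hlim fun n => key n x y hx hy hxy
  exact abs_nonpos_iff.1 this

lemma superpos_zero_left (h : ℝ → ℝ) (y : ℝ) : superpos h 0 y = 0 := by
  simp [superpos]

/-- The representation of a solution of the Goursat problem by elementary solutions. -/
theorem eq_superpos {n : ℕ} {α : ℝ} (hα : α < 1) {V₀ V₁ : ℝ → ℝ} {V : ℝ → ℝ → ℝ}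
    (h0 : IsBoundaryFunction (n + 1) α V₀) (h1 : IsBoundaryFunction (n + 1) α V₁)
    (hV : IsClassicalSolution V)
    (hc : ContinuousOn (fun p : ℝ × ℝ => V p.1 p.2) triangle)
    (hV0 : ∀ x ∈ Ico (0 : ℝ) 1, V x 0 = V₀ x) (hV1 : ∀ y ∈ Ico (0 : ℝ) 1, V 0 y = V₁ y)
    {x y : ℝ} (hx : 0 ≤ x) (hy : 0 ≤ y) (hxy : x + y < 1) :
    V x y = 1 / Real.pi * (superpos (h₀ V₀) x y + superpos (h₀ V₁) y x) := by
  have hpi : Real.pi ≠ 0 := Real.pi_ne_zero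
  obtain ⟨η, hη, hxyη⟩ : ∃ η, 0 < η ∧ x + y ≤ 1 - η := ⟨1 - x - y, by linarith, by linarith⟩
  obtain ⟨C0, hC0⟩ := h0.abs_superpos_le hα hη
  obtain ⟨C1, hC1⟩ := h1.abs_superpos_le hα hη
  have hK : IsCompact {p : ℝ × ℝ | 0 ≤ p.1 ∧ 0 ≤ p.2 ∧ p.1 + p.2 ≤ 1 - η} := by
    have hcl : IsClosed {p : ℝ × ℝ | 0 ≤ p.1 ∧ 0 ≤ p.2 ∧ p.1 + p.2 ≤ 1 - η} :=
      (isClosed_le continuous_const continuous_fst).inter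
        ((isClosed_le continuous_const continuous_snd).inter
          (isClosed_le (continuous_fst.add continuous_snd) continuous_const))
    refine (isCompact_Icc (a := ((0 : ℝ), (0 : ℝ))) (b := ((1 : ℝ), (1 : ℝ)))).of_isClosed_subset hcl ?_
    rintro ⟨s, t⟩ ⟨h1, h2, h3⟩
    simp only at h1 h2 h3
    exact ⟨⟨h1, h2⟩, ⟨by simp only; linarith, by simp only; linarith⟩⟩
  obtain ⟨C2, hC2⟩ := hK.exists_bound_of_continuousOn
    (hc.mono fun p hp => ⟨hp.1, hp.2.1, by linarith [hp.2.2]⟩)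
  set W : ℝ → ℝ → ℝ := fun x y =>
    V x y - 1 / Real.pi * (superpos (h₀ V₀) x y + superpos (h₀ V₁) y x) with hW
  have hWx : ∀ y, 0 ≤ y → y < 1 → W 0 y = 0 := by
    intro y hy hy1
    simp only [hW]
    rw [superpos_zero_left, h1.superpos_zero hα hy hy1, hV1 y ⟨hy, hy1⟩]
    field_simp
    ring
  have hWy : ∀ x, 0 ≤ x → x < 1 → W x 0 = 0 := by
    intro x hx hx1
    simp only [hW]
    rw [superpos_zero_left, h0.superpos_zero hα hx hx1, hV0 x ⟨hx, hx1⟩]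
    field_simp
    ring
  have hres : W x y = 0 := by
    refine eq_zero_of_weak hη (C := C2 + 1 / Real.pi * (C0 + C1)) ?_ ?_ hx hy hxyη
    · intro x y hx hy hxy
      have e1 := hC2 (x, y) ⟨hx, hy, hxy⟩
      have e2 := hC0 x y hx hy hxy
      have e3 := hC1 y x hy hx (by linarith)
      simp only [hW]
      refine (abs_sub _ _).trans (add_le_add e1 ?_)
      rw [abs_mul, abs_of_pos (by positivity : 0 < 1 / Real.pi)]
      exact mul_le_mul_of_nonneg_left ((abs_add_le _ _).trans (add_le_add e2 e3)) (by positivity)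
    · intro x y hx hy hxyη
      -- On the axes the difference is zero together with its integral along the axis; the weak form
      -- of `V` is needed only for positive `x` and `y`.
      rcases hx.eq_or_lt with rfl | hx0
      · rw [hWx y hy (by linarith), setIntegral_congr_fun (g := fun _ => (0 : ℝ)) measurableSet_Ioo
          (fun t ht => hWx t ht.1.le (by linarith [ht.2]))]
        simp
      rcases hy.eq_or_lt with rfl | hy0
      · rw [hWy x hx (by linarith), setIntegral_congr_fun (g := fun _ => (0 : ℝ)) measurableSet_Ioo
          (fun t ht => hWy t ht.1.le (by linarith [ht.2]))]
        simp
      have hxy : x + y < 1 := by linarith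
      have hyx : y + x < 1 := by linarith
      have hx1 : x < 1 := by linarith
      have hy1 : y < 1 := by linarith
      have w := hV.weak hc hx0 hy0 hxy
      have iK0 := h0.integrableOn_h₀_mul hα hx1
      have iK1 := h1.integrableOn_h₀_mul hα hy1
      have ih0 := h0.integrableOn_h₀ hα hx1
      have ih1 := h1.integrableOn_h₀ hα hy1
      have w0 := superpos_weak ih0 iK0 hy hxy
      have w1 := superpos_weak ih1 iK1 hx hyx
      rw [h0.superpos_zero hα hx hx1, setIntegral_congr_fun (g := fun s => Real.pi * V₀ s)
        measurableSet_Ioo (fun s hs => h0.superpos_zero hα hs.1.le (by linarith [hs.2])),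
        integral_const_mul] at w0
      rw [h1.superpos_zero hα hy hy1, setIntegral_congr_fun (g := fun s => Real.pi * V₁ s)
        measurableSet_Ioo (fun s hs => h1.superpos_zero hα hs.1.le (by linarith [hs.2])),
        integral_const_mul] at w1
      rw [hV0 x ⟨hx, hx1⟩, hV1 y ⟨hy, hy1⟩, hV0 0 ⟨le_rfl, one_pos⟩, h0.map_zero,
        intervalIntegral.integral_of_le hy, intervalIntegral.integral_of_le hx,
        intervalIntegral.integral_of_le hy, intervalIntegral.integral_of_le hx,
        integral_Ioc_eq_integral_Ioo, integral_Ioc_eq_integral_Ioo, integral_Ioc_eq_integral_Ioo,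
        integral_Ioc_eq_integral_Ioo,
        setIntegral_congr_fun (g := V₀) measurableSet_Ioo
          (fun s (hs : s ∈ Ioo 0 x) => hV0 s ⟨hs.1.le, by linarith [hs.2]⟩),
        setIntegral_congr_fun (g := V₁) measurableSet_Ioo
          (fun s (hs : s ∈ Ioo 0 y) => hV1 s ⟨hs.1.le, by linarith [hs.2]⟩)] at w
      have a1 := (integral_superpos_right iK0 hy hxy).1
      have a2 := (integral_superpos_left ih0 hy hxy).1
      have b1 := (integral_superpos_right iK1 hx hyx).1
      have b2 := (integral_superpos_left ih1 hx hyx).1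
      have v1 : IntegrableOn (fun t => V x t) (Ioo 0 y) := by
        refine (ContinuousOn.integrableOn_Icc ?_).mono_set Ioo_subset_Icc_self
        exact hc.comp (f := fun t : ℝ => (x, t)) (by fun_prop)
          fun t ht => ⟨hx, ht.1, by simp only; linarith [ht.2]⟩
      have v2 : IntegrableOn (fun s => V s y) (Ioo 0 x) := by
        refine (ContinuousOn.integrableOn_Icc ?_).mono_set Ioo_subset_Icc_self
        exact hc.comp (f := fun s : ℝ => (s, y)) (by fun_prop)
          fun t ht => ⟨ht.1, hy, by simp only; linarith [ht.2]⟩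
      simp only [hW]
      have s1 := integral_sub v1 ((a1.add b2).const_mul (1 / Real.pi))
      have s2 := integral_sub v2 ((a2.add b1).const_mul (1 / Real.pi))
      simp only [Pi.add_apply] at s1 s2
      rw [integral_const_mul, integral_add a1 b2] at s1
      rw [integral_const_mul, integral_add a2 b1] at s2
      rw [s1, s2]
      have hp : 1 / Real.pi * Real.pi = 1 := by field_simp
      -- The boundary terms of `V` and of the superpositions agree once `(1 / π) π = 1` is used, so
      -- the difference satisfies the homogeneous weak equation.
      linear_combination w - 1 / Real.pi * w0 - 1 / Real.pi * w1
        - (2 * (1 - x) * V₀ x + 2 * (1 - y) * V₁ y + (∫ s in Ioo 0 x, V₀ s) +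
          ∫ s in Ioo 0 y, V₁ s) * hp
  simp only [hW] at hres
  linarith

end CollidingWaves

end

noncomputable section

namespace CollidingWaves

open Set MeasureTheory Filter Topology

/-! ### The germ of a density at a boundary point -/

/-- The derivatives of `t ↦ h (x - t)`. -/
def germ (h : ℝ → ℝ) (x : ℝ) (i : ℕ) (t : ℝ) : ℝ := (-1) ^ i * iteratedDeriv i h (x - t)

lemma germ_zero (h : ℝ → ℝ) (x t : ℝ) : germ h x 0 t = h (x - t) := by simp [germ]

lemma taylorCoef_germ (h : ℝ → ℝ) (x : ℝ) (l : ℕ) :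
    taylorCoef (germ h x) l = (-1) ^ l * iteratedDeriv l h x / (l.factorial : ℝ) := by
  simp [taylorCoef, germ]

lemma integral_comp_reflect {x : ℝ} (hx : 0 ≤ x) (F : ℝ → ℝ) :
    ∫ t in Ioc 0 x, F (x - t) = ∫ k in Ioo 0 x, F k := by
  have := intervalIntegral.integral_comp_sub_left (a := 0) (b := x) F x
  rw [sub_self, sub_zero, intervalIntegral.integral_of_le hx,
    intervalIntegral.integral_of_le hx] at this
  rw [this, integral_Ioc_eq_integral_Ioo]

lemma hasDerivAt_iteratedDeriv {h : ℝ → ℝ} {n i : ℕ} {s : Set ℝ} (hs : IsOpen s)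
    (hh : ContDiffOn ℝ n h s) (hi : i < n) {x : ℝ} (hx : x ∈ s) :
    HasDerivAt (iteratedDeriv i h) (iteratedDeriv (i + 1) h x) x := by
  have h1 : DifferentiableAt ℝ (iteratedDeriv i h) x :=
    (((hh.differentiableOn_iteratedDerivWithin (by exact_mod_cast hi) hs.uniqueDiffOn).congr
      (iteratedDerivWithin_of_isOpen hs).symm) x hx).differentiableAt (hs.mem_nhds hx)
  rw [iteratedDeriv_succ]
  exact h1.hasDerivAt

lemma continuousOn_iteratedDeriv {h : ℝ → ℝ} {n i : ℕ} {s : Set ℝ} (hs : IsOpen s)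
    (hh : ContDiffOn ℝ n h s) (hi : i ≤ n) : ContinuousOn (iteratedDeriv i h) s := by
  refine (hh.continuousOn_iteratedDerivWithin (by exact_mod_cast hi) hs.uniqueDiffOn).congr ?_
  exact (iteratedDerivWithin_of_isOpen hs).symm

/-- For `x ∈ [δ, 1 - δ]` and `t ≤ δ / 2` the point `x - t` stays in the compact set `[δ / 2, 1 - δ]`
of the open interval where the density is smooth. The bound `B` depends on `δ` but not on `x`, which
is the source of uniformity away from the corners. -/
lemma IsBoundaryFunction.exists_taylorData {n : ℕ} {α : ℝ} {U : ℝ → ℝ}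
    (hU : IsBoundaryFunction (n + 1) α U) (hα : α < 1) {δ : ℝ} (hδ : 0 < δ) :
    ∃ B : ℝ, 0 ≤ B ∧ ∀ x ∈ Icc δ (1 - δ), TaylorData n (δ / 2) B x (germ (h₀ U) x) := by
  have hcd := hU.contDiffOn_h₀ hα
  have hsub : Icc (δ / 2) (1 - δ) ⊆ Ioo (0 : ℝ) 1 := fun t ht =>
    ⟨by linarith [ht.1], by linarith [ht.2]⟩
  have hbd : ∀ i : ℕ, ∃ C, i ≤ n → ∀ t ∈ Icc (δ / 2) (1 - δ), |iteratedDeriv i (h₀ U) t| ≤ C := by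
    intro i
    by_cases hi : i ≤ n
    · obtain ⟨C, hC⟩ := isCompact_Icc.exists_bound_of_continuousOn
        ((continuousOn_iteratedDeriv isOpen_Ioo hcd hi).mono hsub)
      exact ⟨C, fun _ => hC⟩
    · exact ⟨0, fun h => absurd h hi⟩
  choose C hC using hbd
  have hint := hU.integrableOn_h₀ hα (b := 1 - δ) (by linarith)
  set I := ∫ k in Ioo 0 (1 - δ), |h₀ U k|
  have hI : 0 ≤ I := integral_nonneg fun _ => abs_nonneg _
  have hS : 0 ≤ ∑ i ∈ Finset.range (n + 1), |C i| := Finset.sum_nonneg fun _ _ => abs_nonneg _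
  refine ⟨I + ∑ i ∈ Finset.range (n + 1), |C i|, add_nonneg hI hS, fun x hx => ?_⟩
  have hx0 : 0 ≤ x := hδ.le.trans hx.1
  have hintx := hint.mono_set (Ioo_subset_Ioo_right hx.2)
  have hmem : ∀ t ∈ Icc 0 (δ / 2), x - t ∈ Icc (δ / 2) (1 - δ) := fun t ht =>
    ⟨by linarith [hx.1, ht.2], by linarith [hx.2, ht.1]⟩
  refine ⟨by linarith [hx.1], by linarith [hx.2], ?_, ?_, ?_, ?_⟩
  · have h1 : IntervalIntegrable (h₀ U) volume 0 x :=
      (intervalIntegrable_iff_integrableOn_Ioo_of_le hx0).2 hintx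
    have h2 := (h1.comp_sub_left x).symm
    rw [sub_self, sub_zero, intervalIntegrable_iff_integrableOn_Ioc_of_le hx0] at h2
    exact h2.congr_fun (fun t _ => (germ_zero _ _ _).symm) measurableSet_Ioc
  · simp only [germ_zero]
    rw [integral_comp_reflect hx0 (fun k => |h₀ U k|)]
    have : ∫ k in Ioo 0 x, |h₀ U k| ≤ I :=
      setIntegral_mono_set hint.abs (Eventually.of_forall fun _ => abs_nonneg _)
        (Ioo_subset_Ioo_right hx.2).eventuallyLE
    linarith
  · intro i hi t ht
    have h1 := hasDerivAt_iteratedDeriv isOpen_Ioo hcd hi (hsub (hmem t ht))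
    have h2 : HasDerivAt (fun t => x - t) (-1) t := by simpa using (hasDerivAt_id t).const_sub x
    refine ((h1.comp t h2).const_mul ((-1) ^ i)).congr_deriv ?_
    simp only [germ, pow_succ]
    ring
  · intro i hi t ht
    have h1 := hC i hi _ (hmem t ht)
    have h2 : |C i| ≤ ∑ i ∈ Finset.range (n + 1), |C i| :=
      Finset.single_le_sum (f := fun i => |C i|) (fun _ _ => abs_nonneg _)
        (Finset.mem_range.2 (by omega))
    simp only [germ]
    rw [abs_mul, abs_pow, abs_neg, abs_one, one_pow, one_mul]
    linarith [le_abs_self (C i)]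

/-- With `t = x - k` on the normal line the second factor becomes `1 - y - k = t + ε`, hence `σ =
-1`. -/
lemma superpos_eq_inner {h : ℝ → ℝ} {x ε : ℝ} (hx : 0 ≤ x) (hx1 : x ≤ 1) :
    superpos h x (1 - x - ε) = ∫ t in Ioc 0 x, germ h x 0 t * kern (-1) ε t := by
  unfold superpos
  rw [← integral_comp_reflect hx]
  refine setIntegral_congr_fun measurableSet_Ioc fun t ht => ?_
  simp only [germ_zero, kern]
  rw [sub_sub_cancel, abelKer_eq (by linarith [ht.2]),
    show 1 - (1 - x - ε) - (x - t) = t - -1 * ε by ring, mul_assoc, one_div_mul_one_div_rev]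

/-- For the reflected superposition `t = y - k` gives the kernel with `σ = 1`. The integral may be
extended from `y - ε` to `y`, because the kernel takes the value `0` where its square root has a
nonpositive argument. -/
lemma superpos_eq_outer {h : ℝ → ℝ} {y ε : ℝ} (hε : 0 ≤ ε) (hεy : ε ≤ y) (hy1 : y ≤ 1) :
    superpos h (y - ε) (1 - y) = ∫ t in Ioc 0 y, germ h y 0 t * kern 1 ε t := by
  have hy : 0 ≤ y := hε.trans hεy
  have h1 : ∀ t, germ h y 0 t * kern 1 ε t
      = (fun k => h k * (1 / (√(y - k - ε) * √(y - k)))) (y - t) := by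
    intro t
    simp only [germ_zero, kern, sub_sub_cancel, one_mul]
  simp only [h1]
  rw [integral_comp_reflect hy (fun k => h k * (1 / (√(y - k - ε) * √(y - k))))]
  unfold superpos
  rw [← integral_Ioc_eq_integral_Ioo, ← integral_Ioc_eq_integral_Ioo]
  symm
  rw [setIntegral_eq_of_subset_of_forall_sdiff_eq_zero measurableSet_Ioc
    (Ioc_subset_Ioc_right (by linarith : y - ε ≤ y))]
  · refine setIntegral_congr_fun measurableSet_Ioc fun k hk => ?_
    rw [abelKer_eq (by linarith [hk.1]), show y - ε - k = y - k - ε by ring,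
      show 1 - (1 - y) - k = y - k by ring, mul_assoc, one_div_mul_one_div_rev, mul_comm √(y - k)]
  · intro k hk
    have : y - k - ε ≤ 0 := by
      by_contra h0
      exact hk.2 ⟨hk.1.1, by linarith⟩
    rw [Real.sqrt_eq_zero_of_nonpos this]
    simp

end CollidingWaves

end

noncomputable section

namespace CollidingWaves

open Set MeasureTheory Filter Topology

/-! ### Identification of the coefficients -/

lemma zpow_neg_sub_one (v : ℝ) (l : ℕ) : v ^ (-(l : ℤ) - 1) = v⁻¹ ^ (l + 1) := by
  rw [show -(l : ℤ) - 1 = -((l + 1 : ℕ) : ℤ) by push_cast; ring, zpow_neg, zpow_natCast, inv_pow]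

lemma sum_mul_powPrim (ac : ℕ → ℝ) (j : ℕ) (X : ℝ) :
    ∑ l ∈ Finset.range (j + 1), ac l * powPrim l j X
      = ∑ l ∈ Finset.range j, ac l * (X ^ ((l : ℤ) - j) / ((l : ℝ) - j)) + ac j * Real.log X := by
  rw [Finset.sum_range_succ]
  congr 1
  · refine Finset.sum_congr rfl fun l hl => ?_
    have : j ≠ l := (Finset.mem_range.1 hl).ne'
    simp [powPrim, this]
  · simp [powPrim]

/-- The substitution `t = x - k` identifies the integrals. The sign `(-1)^j` enters the first part
through the binomial coefficient for `σ = -1`, and the second through the derivatives of the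
reflected germ. -/
lemma neg_one_pow_mul_coeffA (h : ℝ → ℝ) {x : ℝ} (hx : 0 < x) (j : ℕ) :
    (-1) ^ j * coeffA h j x
      = regCoef (-1) (germ h x 0) (taylorCoef (germ h x)) x j := by
  have e1 : ∫ k in (0 : ℝ)..x, taylorRem₀ h j x k / (x - k) ^ (j + 1)
      = ∫ t in Ioc 0 x, (germ h x 0 t - ∑ l ∈ Finset.range (j + 1),
          taylorCoef (germ h x) l * t ^ l) * t⁻¹ ^ (j + 1) := by
    rw [intervalIntegral.integral_of_le hx.le, integral_Ioc_eq_integral_Ioo,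
      ← integral_comp_reflect hx.le]
    refine setIntegral_congr_fun measurableSet_Ioc fun t _ => ?_
    simp only [taylorRem₀, sub_sub_cancel, germ_zero, taylorCoef_germ, inv_pow, div_eq_mul_inv]
    congr 2
    refine Finset.sum_congr rfl fun l _ => ?_
    ring
  have e2 : ∑ l ∈ Finset.range j, taylorCoef (germ h x) l * (x ^ ((l : ℤ) - j) / ((l : ℝ) - j))
      = ∑ l ∈ Finset.range j, (-1) ^ l / ((l.factorial : ℝ) * ((l : ℝ) - j)) * iteratedDeriv l h x
              * x ^ ((l : ℤ) - j) := by
    refine Finset.sum_congr rfl fun l _ => ?_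
    rw [taylorCoef_germ, div_mul_eq_div_div]
    ring
  have e3 : ∫ v in (0 : ℝ)..1, v ^ j * weight (-1) v
      = ∫ v in (0 : ℝ)..1, v ^ j / (√(v + 1) * √v) := by
    simp only [weight, sub_neg_eq_add, mul_one_div]
  have e4 : ∫ v in Ioi (1 : ℝ), v ^ j * weightTail (-1) (j + 1) v
      = ∫ v in Ioi (1 : ℝ), v ^ j * (1 / (√(v + 1) * √v) - ∑ l ∈ Finset.range (j + 1),
          1 / (l.factorial : ℝ) * (-1) ^ l * cst l * v ^ (-(l : ℤ) - 1)) := by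
    refine setIntegral_congr_fun measurableSet_Ioi fun v _ => ?_
    simp only [weightTail, weight, sub_neg_eq_add, zpow_neg_sub_one, binCoeff]
    congr 2
    refine Finset.sum_congr rfl fun l _ => ?_
    ring
  have e5 : ∑ l ∈ Finset.range j, binCoeff (-1) l / ((l : ℝ) - j)
      = ∑ l ∈ Finset.range j, (-1) ^ l * (cst l / ((l.factorial : ℝ) * ((l : ℝ) - j))) := by
    refine Finset.sum_congr rfl fun l _ => ?_
    rw [binCoeff, div_mul_eq_div_div]
    ring
  unfold regCoef finitePart weightConst coeffA
  rw [sum_mul_powPrim, ← e1, e2, e3, e4, e5, taylorCoef_germ, binCoeff]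
  ring

lemma iteratedDeriv_reflect (h : ℝ → ℝ) (l : ℕ) (x : ℝ) :
    iteratedDeriv l (fun k => h (1 - k)) x = (-1) ^ l * iteratedDeriv l h (1 - x) := by
  simp only [iteratedDeriv_comp_const_sub, smul_eq_mul]

lemma coeffB_reflect (h : ℝ → ℝ) {x : ℝ} (hx : x < 1) (j : ℕ) :
    coeffB (fun k => h (1 - k)) j x
      = regCoef 1 (germ h (1 - x) 0) (taylorCoef (germ h (1 - x))) (1 - x) j := by
  have hx' : 0 ≤ 1 - x := by linarith
  have e1 : ∫ k in x..(1 : ℝ), taylorRem₁ (fun k => h (1 - k)) j x k / (k - x) ^ (j + 1)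
      = ∫ t in Ioc 0 (1 - x), (germ h (1 - x) 0 t - ∑ l ∈ Finset.range (j + 1),
          taylorCoef (germ h (1 - x)) l * t ^ l) * t⁻¹ ^ (j + 1) := by
    have := intervalIntegral.integral_comp_add_left (a := 0) (b := 1 - x)
      (fun k => taylorRem₁ (fun k => h (1 - k)) j x k / (k - x) ^ (j + 1)) x
    rw [add_zero, add_sub_cancel] at this
    rw [← this, intervalIntegral.integral_of_le hx']
    refine setIntegral_congr_fun measurableSet_Ioc fun t _ => ?_
    simp only [taylorRem₁, add_sub_cancel_left, germ_zero, taylorCoef_germ, inv_pow,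
      div_eq_mul_inv, iteratedDeriv_reflect, sub_sub]
  have e2 : ∑ l ∈ Finset.range j,
        taylorCoef (germ h (1 - x)) l * ((1 - x) ^ ((l : ℤ) - j) / ((l : ℝ) - j))
      = ∑ l ∈ Finset.range j, 1 / ((l.factorial : ℝ) * ((l : ℝ) - j))
          * iteratedDeriv l (fun k => h (1 - k)) x * (1 - x) ^ ((l : ℤ) - j) := by
    refine Finset.sum_congr rfl fun l _ => ?_
    rw [taylorCoef_germ, div_mul_eq_div_div, iteratedDeriv_reflect]
    ring
  -- The weight for `σ = 1` vanishes below `v = 1`, which is why `coeffB` has no counterpart of the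
  -- integral over `(0, 1)` in `coeffA`.
  have e3 : ∫ v in (0 : ℝ)..1, v ^ j * weight 1 v = 0 := by
    rw [intervalIntegral.integral_congr (g := fun _ => (0 : ℝ))]
    · simp
    · intro v hv
      rw [uIcc_of_le zero_le_one] at hv
      simp [weight, Real.sqrt_eq_zero_of_nonpos (by linarith [hv.2] : v - 1 ≤ 0)]
  have e4 : ∫ v in Ioi (1 : ℝ), v ^ j * weightTail 1 (j + 1) v
      = ∫ v in Ioi (1 : ℝ), v ^ j * (1 / (√(v - 1) * √v) - ∑ l ∈ Finset.range (j + 1),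
          cst l / (l.factorial : ℝ) * v ^ (-(l : ℤ) - 1)) := by
    simp only [weightTail, weight, zpow_neg_sub_one, binCoeff, one_pow, one_mul]
  have e5 : ∑ l ∈ Finset.range j, binCoeff 1 l / ((l : ℝ) - j)
      = ∑ l ∈ Finset.range j, cst l / ((l.factorial : ℝ) * ((l : ℝ) - j)) := by
    refine Finset.sum_congr rfl fun l _ => ?_
    rw [binCoeff, one_pow, one_mul, div_mul_eq_div_div]
  unfold regCoef finitePart weightConst coeffB
  rw [sum_mul_powPrim, ← e1, e2, e3, e4, e5, taylorCoef_germ, binCoeff, iteratedDeriv_reflect]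
  ring

lemma h₁_eq_reflect (U : ℝ → ℝ) : h₁ U = fun k => h₀ U (1 - k) := funext fun k => h₁_eq U k

lemma coeffG_eq (V₀ V₁ : ℝ → ℝ) {x : ℝ} (hx : 0 < x) (hx1 : x < 1) (j : ℕ) :
    coeffG V₀ V₁ j x = 1 / Real.pi *
      (regCoef (-1) (germ (h₀ V₀) x 0) (taylorCoef (germ (h₀ V₀) x)) x j
        + regCoef 1 (germ (h₀ V₁) (1 - x) 0) (taylorCoef (germ (h₀ V₁) (1 - x))) (1 - x) j) := by
  rw [coeffG, neg_one_pow_mul_coeffA _ hx, h₁_eq_reflect, coeffB_reflect _ hx1]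

lemma coeffF_eq (V₀ V₁ : ℝ → ℝ) (x : ℝ) (j : ℕ) :
    coeffF V₀ V₁ j x = 1 / Real.pi * (logCoef (-1) (taylorCoef (germ (h₀ V₀) x)) j
      + logCoef 1 (taylorCoef (germ (h₀ V₁) (1 - x))) j) := by
  have hpi := Real.pi_ne_zero
  have hf : (j.factorial : ℝ) ≠ 0 := by positivity
  have hs : ((-1 : ℝ) ^ j) ^ 2 = 1 := by rw [← pow_mul, mul_comm, pow_mul]; norm_num
  rw [coeffF, h₁_eq_reflect, iteratedDeriv_reflect, logCoef, logCoef, taylorCoef_germ,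
    taylorCoef_germ, binCoeff, binCoeff]
  field_simp
  rw [one_pow]
  linear_combination cst j * iteratedDeriv j (h₀ V₀) x * hs

/-! ### The expansion of the solution -/

/-- `V` is the superposition of elementary solutions with the densities given by the data. -/
def IsSuperposition (V₀ V₁ : ℝ → ℝ) (V : ℝ → ℝ → ℝ) : Prop :=
  ∀ x y : ℝ, 0 ≤ x → 0 ≤ y → x + y < 1 →
    V x y = 1 / Real.pi * (superpos (h₀ V₀) x y + superpos (h₀ V₁) y x)

lemma IsSuperposition.swap {V₀ V₁ : ℝ → ℝ} {V : ℝ → ℝ → ℝ} (h : IsSuperposition V₀ V₁ V) :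
    IsSuperposition V₁ V₀ (fun x y => V y x) := fun x y hx hy hxy => by
  simp only
  rw [h y x hy hx (by linarith), add_comm]

/-- The two superpositions are expanded with `σ = -1` at `x` and `σ = 1` at `1 - x`. Constants are
uniform in `x`, for the remainder and for the coefficients alike; the latter are needed for products
of expansions. -/
theorem IsSuperposition.exists_expansion {M : ℕ} {α : ℝ} (hα : α < 1) {V₀ V₁ : ℝ → ℝ}
    (h0 : IsBoundaryFunction (M + 3) α V₀) (h1 : IsBoundaryFunction (M + 3) α V₁)
    {V : ℝ → ℝ → ℝ} (hV : IsSuperposition V₀ V₁ V) {δ : ℝ} (hδ : 0 < δ) :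
    ∃ C ≥ 0, ∃ ε₀ > 0, ε₀ ≤ Real.exp (-1) ∧ ε₀ ≤ δ ∧ ∀ x ∈ Icc δ (1 - δ),
      IsSmall M C ε₀ (fun ε => V x (1 - x - ε) - ∑ j ∈ Finset.range (M + 2),
        (coeffG V₀ V₁ j x * ε ^ j + coeffF V₀ V₁ j x * (ε ^ j * Real.log ε))) ∧
      ∀ j < M + 2, |coeffG V₀ V₁ j x| ≤ C ∧ |coeffF V₀ V₁ j x| ≤ C := by
  obtain ⟨B0, hB0, hT0⟩ := h0.exists_taylorData (n := M + 2) hα hδ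
  obtain ⟨B1, hB1, hT1⟩ := h1.exists_taylorData (n := M + 2) hα hδ
  -- The Taylor scale is `c = δ / 2`, and the expansion requires `ε₀ ≤ c / 8`.
  set ε₀ := min (Real.exp (-1)) (δ / 16) with hε₀
  have hε₀pos : 0 < ε₀ := lt_min (Real.exp_pos _) (by linarith)
  have he1 : ε₀ ≤ Real.exp (-1) := min_le_left _ _
  have he2 : ε₀ ≤ δ / 2 / 8 := (min_le_right _ _).trans_eq (by ring)
  obtain ⟨C0, hC0, hE0⟩ := CollidingWaves.exists_expansion (σ := -1) (Or.inr rfl) M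
    (half_pos hδ) hB0 he1 he2
  obtain ⟨C1, hC1, hE1⟩ := CollidingWaves.exists_expansion (σ := 1) (Or.inl rfl) M
    (half_pos hδ) hB1 he1 he2
  set K : ℝ := ∑ j ∈ Finset.range (M + 2), (|binCoeff (-1) j| * B0 + |binCoeff 1 j| * B1) with hK
  have hK0 : 0 ≤ K := Finset.sum_nonneg fun j _ => by positivity
  have hpi : (0 : ℝ) < 1 / Real.pi := by positivity
  refine ⟨1 / Real.pi * (C0 + C1 + K), by positivity, ε₀, hε₀pos, he1, by linarith,
    fun x hx => ?_⟩
  have hx0 : 0 < x := hδ.trans_le hx.1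
  have hx1 : x < 1 := by linarith [hx.2]
  have t0 := hT0 x hx
  have t1 := hT1 (1 - x) ⟨by linarith [hx.2], by linarith [hx.1]⟩
  obtain ⟨s0, r0⟩ := hE0 _ _ t0
  obtain ⟨s1, r1⟩ := hE1 _ _ t1
  refine ⟨?_, fun j hj => ⟨?_, ?_⟩⟩
  · refine (((s0.add s1).const_mul (abs_of_pos hpi).le).mono
      (mul_le_mul_of_nonneg_left (by linarith) hpi.le) le_rfl).congr fun ε hε => ?_
    have hε1 : ε < 1 - x := by linarith [hε.2, hx.2]
    rw [hV x (1 - x - ε) hx0.le (by linarith) (by linarith [hε.1]),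
      superpos_eq_inner hx0.le hx1.le]
    have e := superpos_eq_outer (h := h₀ V₁) hε.1.le hε1.le (by linarith : 1 - x ≤ 1)
    rw [sub_sub_cancel] at e
    rw [e, ← sub_eq_zero]
    simp only [coeffG_eq V₀ V₁ hx0 hx1, coeffF_eq]
    have hsum : ∀ a b c d : ℕ → ℝ, ∑ j ∈ Finset.range (M + 2),
        (1 / Real.pi * (a j + b j) * ε ^ j + 1 / Real.pi * (c j + d j) * (ε ^ j * Real.log ε))
        = 1 / Real.pi * ((∑ j ∈ Finset.range (M + 2), (a j * ε ^ j + c j * (ε ^ j * Real.log ε)))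
          + ∑ j ∈ Finset.range (M + 2), (b j * ε ^ j + d j * (ε ^ j * Real.log ε))) := by
      intro a b c d
      rw [← Finset.sum_add_distrib, Finset.mul_sum]
      exact Finset.sum_congr rfl fun j _ => by ring
    rw [hsum]
    ring
  · rw [coeffG_eq V₀ V₁ hx0 hx1, abs_mul, abs_of_pos hpi]
    refine mul_le_mul_of_nonneg_left ((abs_add_le _ _).trans ?_) hpi.le
    linarith [r0 j hj, r1 j hj]
  · rw [coeffF_eq, abs_mul, abs_of_pos hpi]
    refine mul_le_mul_of_nonneg_left ((abs_add_le _ _).trans ?_) hpi.le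
    have a0 : |taylorCoef (germ (h₀ V₀) x) j| ≤ B0 := t0.abs_taylorCoef_le (half_pos hδ).le hj.le
    have a1 : |taylorCoef (germ (h₀ V₁) (1 - x)) j| ≤ B1 := t1.abs_taylorCoef_le (half_pos hδ).le hj.le
    have hle : |binCoeff (-1) j| * B0 + |binCoeff 1 j| * B1 ≤ K :=
      Finset.single_le_sum (f := fun j => |binCoeff (-1) j| * B0 + |binCoeff 1 j| * B1)
        (fun _ _ => by positivity) (Finset.mem_range.2 hj)
    simp only [logCoef, abs_neg, abs_mul]
    have := mul_le_mul_of_nonneg_left a0 (abs_nonneg (binCoeff (-1) j))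
    have := mul_le_mul_of_nonneg_left a1 (abs_nonneg (binCoeff 1 j))
    linarith

end CollidingWaves

end

noncomputable section

namespace CollidingWaves

open Set MeasureTheory Filter Topology

/-! ### Derivatives along the normal direction -/

/-- The function `p ε^m + q ε^m ln ε`. -/
def powLog (m : ℤ) (p q ε : ℝ) : ℝ := p * ε ^ m + q * (ε ^ m * Real.log ε)

lemma hasDerivAt_powLog (m : ℤ) (p q : ℝ) {ε : ℝ} (hε : 0 < ε) :
    HasDerivAt (powLog m p q) (powLog (m - 1) (m * p + q) (m * q) ε) ε := by
  have h1 := hasDerivAt_zpow m ε (Or.inl hε.ne')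
  have h2 := Real.hasDerivAt_log hε.ne'
  refine ((h1.const_mul p).add ((h1.mul h2).const_mul q)).congr_deriv ?_
  simp only [powLog]
  rw [show ε ^ m = ε ^ (m - 1) * ε by rw [← zpow_add_one₀ hε.ne', sub_add_cancel]]
  field_simp
  ring

lemma hasDerivAt_sum_powLog (n : ℕ) (m : ℕ → ℤ) (p q : ℕ → ℝ) {ε : ℝ} (hε : 0 < ε) :
    HasDerivAt (fun ε => ∑ j ∈ Finset.range n, powLog (m j) (p j) (q j) ε)
      (∑ j ∈ Finset.range n, powLog (m j - 1) (m j * p j + q j) (m j * q j) ε) ε :=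
  HasDerivAt.fun_sum fun j _ => hasDerivAt_powLog (m j) (p j) (q j) hε

/-- Term-by-term differentiation is legitimate because `IsSmall` controls the derivatives of the
remainder. The formula for `E'` holds on the whole interval, so it can be differentiated again. -/
lemma IsSmall.abs_deriv_sub_le {M n : ℕ} {C ε₀ : ℝ} {E : ℝ → ℝ} {g f : ℕ → ℝ}
    (h : IsSmall M C ε₀ (fun ε => E ε - ∑ j ∈ Finset.range n,
      (g j * ε ^ j + f j * (ε ^ j * Real.log ε)))) {ε : ℝ} (hε : ε ∈ Ioo 0 ε₀) :
    |deriv E ε - ∑ j ∈ Finset.range n, powLog ((j : ℤ) - 1) (j * g j + f j) (j * f j) ε|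
        ≤ C * (ε ^ (M + 1) * |Real.log ε|) ∧
    |deriv (deriv E) ε - ∑ j ∈ Finset.range n, powLog ((j : ℤ) - 2)
        (((j : ℝ) - 1) * (j * g j + f j) + j * f j) (((j : ℝ) - 1) * (j * f j)) ε|
        ≤ C * (ε ^ M * |Real.log ε|) := by
  obtain ⟨r1, r2, hr⟩ := h
  have hE : ∀ ε ∈ Ioo 0 ε₀, deriv E ε = r1 ε
      + ∑ j ∈ Finset.range n, powLog ((j : ℤ) - 1) (j * g j + f j) (j * f j) ε := by
    intro ε hε
    have h1 := (hr ε hε).1.add (hasDerivAt_sum_powLog n (fun j => (j : ℤ)) g f hε.1)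
    simp only [Int.cast_natCast] at h1
    refine (h1.congr_of_eventuallyEq (Eventually.of_forall fun ε => ?_)).deriv
    simp [powLog]
  refine ⟨?_, ?_⟩
  · rw [hE ε hε, add_sub_cancel_right]
    exact (hr ε hε).2.2.1
  · have hev : deriv E =ᶠ[𝓝 ε] fun ε => r1 ε
        + ∑ j ∈ Finset.range n, powLog ((j : ℤ) - 1) (j * g j + f j) (j * f j) ε := by
      filter_upwards [Ioo_mem_nhds hε.1 hε.2] with ε hε using hE ε hε
    have h1 := (hr ε hε).2.1.fun_add (hasDerivAt_sum_powLog n (fun j => (j : ℤ) - 1)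
      (fun j => j * g j + f j) (fun j => j * f j) hε.1)
    rw [hev.deriv_eq, HasDerivAt.deriv h1]
    push_cast
    simp only [sub_sub, one_add_one_eq_two, add_sub_cancel_right]
    exact (hr ε hε).2.2.2

/-- The restriction of `V` to the normal line through `(x, 1 - x)`. -/
def normalLine (V : ℝ → ℝ → ℝ) (x ε : ℝ) : ℝ := V x (1 - x - ε)

/-- Fixing `g` fixes `x = 1/2 - g`, and then `ε = f + g`: differentiation in `f` is differentiation
along the normal line, without the chain rule in two variables. -/
lemma partialX_inFG (V : ℝ → ℝ → ℝ) (f g : ℝ) :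
    partialX (inFG V) f g = deriv (normalLine V (1 / 2 - g)) (f + g) := by
  rw [partialX, ← deriv_comp_add_const]
  congr 1
  funext s
  simp only [inFG, normalLine]
  congr 1
  ring

lemma partialX_partialX_inFG (V : ℝ → ℝ → ℝ) (f g : ℝ) :
    partialX (partialX (inFG V)) f g = deriv (deriv (normalLine V (1 / 2 - g))) (f + g) := by
  rw [partialX, ← deriv_comp_add_const]
  congr 1
  funext s
  exact partialX_inFG V s g

/-- Exchanging `f` and `g` amounts to reflecting `V`, whose data are the interchanged ones. -/
lemma partialY_inFG (V : ℝ → ℝ → ℝ) (f g : ℝ) :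
    partialY (inFG V) f g = deriv (normalLine (fun x y => V y x) (1 / 2 - f)) (f + g) := by
  rw [add_comm, ← partialX_inFG]
  rfl

lemma partialY_partialY_inFG (V : ℝ → ℝ → ℝ) (f g : ℝ) :
    partialY (partialY (inFG V)) f g
      = deriv (deriv (normalLine (fun x y => V y x) (1 / 2 - f))) (f + g) := by
  rw [add_comm, ← partialX_partialX_inFG]
  rfl

/-! ### Truncated sums -/

/-- The truncated expansion of the normal derivative of `V`. -/
def derivSum (V₀ V₁ : ℝ → ℝ) (n : ℕ) (x ε : ℝ) : ℝ :=
  ∑ j ∈ Finset.range n, (j : ℝ) * coeffF V₀ V₁ j x * ε ^ ((j : ℤ) - 1) * Real.log ε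
    + ∑ j ∈ Finset.range n, coeffγ V₀ V₁ j x * ε ^ ((j : ℤ) - 1)

/-- The coefficient of `ε^(j-1)` in `derivSum`, including the logarithm. -/
def derivCoef (V₀ V₁ : ℝ → ℝ) (x ε : ℝ) (j : ℕ) : ℝ :=
  coeffγ V₀ V₁ j x + j * coeffF V₀ V₁ j x * Real.log ε

lemma derivSum_eq (V₀ V₁ : ℝ → ℝ) (n : ℕ) (x ε : ℝ) :
    derivSum V₀ V₁ n x ε = ∑ j ∈ Finset.range n, derivCoef V₀ V₁ x ε j * ε ^ ((j : ℤ) - 1) := by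
  rw [derivSum, ← Finset.sum_add_distrib]
  exact Finset.sum_congr rfl fun j _ => by rw [derivCoef]; ring

/-- The truncated expansion of `2 V'' + 3 V' / ε`, where `'` is the normal derivative. -/
def linearSum (V₀ V₁ : ℝ → ℝ) (n : ℕ) (x ε : ℝ) : ℝ :=
  ∑ j ∈ Finset.range n, (2 * coeffGG V₀ V₁ j x + 3 * coeffγ V₀ V₁ j x) * ε ^ ((j : ℤ) - 2)
    + ∑ j ∈ Finset.range n,
        (2 * (j : ℝ) + 1) * j * coeffF V₀ V₁ j x * ε ^ ((j : ℤ) - 2) * Real.log ε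

/-- The truncated product of the expansions of the two normal derivatives. -/
def productSum (V₀ V₁ : ℝ → ℝ) (n : ℕ) (x y ε : ℝ) : ℝ :=
  ∑ j ∈ Finset.range n,
      (∑ p ∈ Finset.HasAntidiagonal.antidiagonal j, coeffγ V₀ V₁ p.1 x * coeffγ V₁ V₀ p.2 y)
        * ε ^ ((j : ℤ) - 2)
    - 1 / ε ^ 2
    + ∑ j ∈ Finset.range n,
        (∑ p ∈ Finset.HasAntidiagonal.antidiagonal j,
          ((p.1 : ℝ) * coeffF V₀ V₁ p.1 x * coeffγ V₁ V₀ p.2 y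
            + (p.1 : ℝ) * coeffF V₁ V₀ p.1 y * coeffγ V₀ V₁ p.2 x))
        * ε ^ ((j : ℤ) - 2) * Real.log ε
    + ∑ j ∈ Finset.range n,
        (∑ p ∈ Finset.HasAntidiagonal.antidiagonal j,
          (p.1 : ℝ) * (p.2 : ℝ) * coeffF V₀ V₁ p.1 x * coeffF V₁ V₀ p.2 y)
        * ε ^ ((j : ℤ) - 2) * Real.log ε ^ 2

/-- Absorbing `ln ε` into the coefficients merges the three sums into one Cauchy product. The mixed
terms need the symmetry of the antidiagonal, since both of them are indexed with the logarithmic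
factor first. -/
lemma productSum_eq (V₀ V₁ : ℝ → ℝ) (n : ℕ) (x y ε : ℝ) :
    productSum V₀ V₁ n x y ε = (∑ j ∈ Finset.range n,
      ∑ p ∈ Finset.HasAntidiagonal.antidiagonal j,
        derivCoef V₀ V₁ x ε p.1 * derivCoef V₁ V₀ y ε p.2 * ε ^ (((p.1 + p.2 : ℕ) : ℤ) - 2))
      - 1 / ε ^ 2 := by
  have hswap : ∀ j : ℕ, ∑ p ∈ Finset.HasAntidiagonal.antidiagonal j,
      ((p.1 : ℝ) * coeffF V₀ V₁ p.1 x * coeffγ V₁ V₀ p.2 y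
        + (p.1 : ℝ) * coeffF V₁ V₀ p.1 y * coeffγ V₀ V₁ p.2 x)
      = ∑ p ∈ Finset.HasAntidiagonal.antidiagonal j,
        ((p.1 : ℝ) * coeffF V₀ V₁ p.1 x * coeffγ V₁ V₀ p.2 y
          + (p.2 : ℝ) * coeffF V₁ V₀ p.2 y * coeffγ V₀ V₁ p.1 x) := by
    intro j
    rw [Finset.sum_add_distrib, Finset.sum_add_distrib]
    congr 1
    exact (Finset.Nat.sum_antidiagonal_swap
      (f := fun p : ℕ × ℕ => (p.1 : ℝ) * coeffF V₁ V₀ p.1 y * coeffγ V₀ V₁ p.2 x)).symm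
  have hj : ∀ j : ℕ, ∑ p ∈ Finset.HasAntidiagonal.antidiagonal j,
        derivCoef V₀ V₁ x ε p.1 * derivCoef V₁ V₀ y ε p.2 * ε ^ (((p.1 + p.2 : ℕ) : ℤ) - 2)
      = (∑ p ∈ Finset.HasAntidiagonal.antidiagonal j, coeffγ V₀ V₁ p.1 x * coeffγ V₁ V₀ p.2 y)
          * ε ^ ((j : ℤ) - 2)
        + (∑ p ∈ Finset.HasAntidiagonal.antidiagonal j,
            ((p.1 : ℝ) * coeffF V₀ V₁ p.1 x * coeffγ V₁ V₀ p.2 y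
              + (p.2 : ℝ) * coeffF V₁ V₀ p.2 y * coeffγ V₀ V₁ p.1 x))
          * ε ^ ((j : ℤ) - 2) * Real.log ε
        + (∑ p ∈ Finset.HasAntidiagonal.antidiagonal j,
            (p.1 : ℝ) * (p.2 : ℝ) * coeffF V₀ V₁ p.1 x * coeffF V₁ V₀ p.2 y)
          * ε ^ ((j : ℤ) - 2) * Real.log ε ^ 2 := by
    intro j
    simp only [Finset.sum_mul]
    rw [← Finset.sum_add_distrib, ← Finset.sum_add_distrib]
    refine Finset.sum_congr rfl fun p hp => ?_
    rw [Finset.HasAntidiagonal.mem_antidiagonal.1 hp, derivCoef, derivCoef]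
    ring
  unfold productSum
  simp only [hswap, hj, Finset.sum_add_distrib]
  ring

/-- A square sum differs from its triangular part by the terms above the diagonal. -/
lemma abs_sum_sub_sum_antidiagonal_le (n : ℕ) (T : ℕ → ℕ → ℝ) {B : ℝ} (hB : 0 ≤ B)
    (hT : ∀ k < n, ∀ l < n, n ≤ k + l → |T k l| ≤ B) :
    |(∑ k ∈ Finset.range n, ∑ l ∈ Finset.range n, T k l) - ∑ j ∈ Finset.range n,
      ∑ p ∈ Finset.HasAntidiagonal.antidiagonal j, T p.1 p.2| ≤ n * (n * B) := by
  have h1 : ∑ j ∈ Finset.range n, ∑ p ∈ Finset.HasAntidiagonal.antidiagonal j, T p.1 p.2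
      = ∑ k ∈ Finset.range n, ∑ l ∈ Finset.range (n - k), T k l := by
    rw [← Finset.sum_range_diag_flip]
    exact Finset.sum_congr rfl fun j _ =>
      Finset.Nat.sum_antidiagonal_eq_sum_range_succ (fun k l => T k l) j
  rw [h1, ← Finset.sum_sub_distrib]
  have h2 : ∀ k ∈ Finset.range n,
      |∑ l ∈ Finset.range n, T k l - ∑ l ∈ Finset.range (n - k), T k l| ≤ n * B := by
    intro k hk
    rw [← Finset.sum_Ico_eq_sub _ (Nat.sub_le n k)]
    refine (Finset.abs_sum_le_sum_abs _ _).trans ?_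
    have h3 : ∑ l ∈ Finset.Ico (n - k) n, |T k l| ≤ ∑ _l ∈ Finset.Ico (n - k) n, B := by
      refine Finset.sum_le_sum fun l hl => ?_
      rw [Finset.mem_Ico] at hl
      rw [Finset.mem_range] at hk
      exact hT k hk l hl.2 (by omega)
    refine h3.trans ?_
    rw [Finset.sum_const, nsmul_eq_mul, Nat.card_Ico]
    exact mul_le_mul_of_nonneg_right (by exact_mod_cast Nat.sub_le _ _) hB
  refine (Finset.abs_sum_le_sum_abs _ _).trans ((Finset.sum_le_sum h2).trans_eq ?_)
  rw [Finset.sum_const, nsmul_eq_mul, Finset.card_range]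

end CollidingWaves

end

noncomputable section

namespace CollidingWaves

open Set MeasureTheory Filter Topology

/-! ### Remainder estimates -/

/-- The bounds satisfied by the normal derivatives of `V` at `x`. -/
structure NormalBound (M : ℕ) (V₀ V₁ : ℝ → ℝ) (V : ℝ → ℝ → ℝ) (K x ε : ℝ) : Prop where
  coef : ∀ j < M + 2, |derivCoef V₀ V₁ x ε j| ≤ K * |Real.log ε|
  sum : |ε * derivSum V₀ V₁ (M + 2) x ε| ≤ K
  first : |deriv (normalLine V x) ε - derivSum V₀ V₁ (M + 2) x ε|
    ≤ K * (ε ^ (M + 1) * |Real.log ε|)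
  linear : |2 * deriv (deriv (normalLine V x)) ε + 3 / ε * deriv (normalLine V x) ε
    - linearSum V₀ V₁ (M + 2) x ε| ≤ K * (ε ^ M * |Real.log ε|)
  deriv_le : |ε * deriv (normalLine V x) ε| ≤ K

lemma sum_powLog_eq_derivSum (V₀ V₁ : ℝ → ℝ) (n : ℕ) (x ε : ℝ) :
    ∑ j ∈ Finset.range n, powLog ((j : ℤ) - 1) (j * coeffG V₀ V₁ j x + coeffF V₀ V₁ j x)
      (j * coeffF V₀ V₁ j x) ε = derivSum V₀ V₁ n x ε := by
  rw [derivSum_eq]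
  exact Finset.sum_congr rfl fun j _ => by rw [powLog, derivCoef, coeffγ]; ring

lemma linearSum_eq (V₀ V₁ : ℝ → ℝ) (n : ℕ) (x : ℝ) {ε : ℝ} (hε : 0 < ε) :
    linearSum V₀ V₁ n x ε = 2 * ∑ j ∈ Finset.range n, powLog ((j : ℤ) - 2)
        (((j : ℝ) - 1) * (j * coeffG V₀ V₁ j x + coeffF V₀ V₁ j x) + j * coeffF V₀ V₁ j x)
        (((j : ℝ) - 1) * (j * coeffF V₀ V₁ j x)) ε
      + 3 / ε * derivSum V₀ V₁ n x ε := by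
  rw [linearSum, derivSum_eq, Finset.mul_sum, Finset.mul_sum, ← Finset.sum_add_distrib,
    ← Finset.sum_add_distrib]
  refine Finset.sum_congr rfl fun j _ => ?_
  rw [powLog, derivCoef, coeffGG, coeffγ,
    show (j : ℤ) - 1 = (j : ℤ) - 2 + 1 by ring, zpow_add_one₀ hε.ne']
  field_simp
  ring

lemma abs_mul_log_le {ε : ℝ} (hε : 0 < ε) (hε1 : ε ≤ 1) : |ε * Real.log ε| ≤ 1 := by
  rw [mul_comm]
  exact (Real.abs_log_mul_self_lt ε hε hε1).le

/-- The logarithmic coefficient of `ε^(j-1)` carries a factor `j`, so the most singular term is free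
of logarithms and `ε` times the truncated derivative is bounded. In the constant, `5 C` collects `2
C` from the second derivative and `3 C` from `3 / ε` times the first; the quadratic term bounds the
sums of coefficients. -/
lemma normalBound_of_isSmall {M : ℕ} {V₀ V₁ : ℝ → ℝ} {V : ℝ → ℝ → ℝ} {C ε₀ x ε : ℝ} (hC : 0 ≤ C)
    (hε₀ : ε₀ ≤ Real.exp (-1))
    (h : IsSmall M C ε₀ (fun ε => V x (1 - x - ε) - ∑ j ∈ Finset.range (M + 2),
        (coeffG V₀ V₁ j x * ε ^ j + coeffF V₀ V₁ j x * (ε ^ j * Real.log ε))))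
    (hb : ∀ j < M + 2, |coeffG V₀ V₁ j x| ≤ C ∧ |coeffF V₀ V₁ j x| ≤ C) (hε : ε ∈ Ioo 0 ε₀) :
    NormalBound M V₀ V₁ V (2 * (M + 3) ^ 2 * C + 5 * C) x ε := by
  have hε0 : 0 < ε := hε.1
  have hlog : 1 ≤ |Real.log ε| := one_le_abs_log hε.1 (hε.2.le.trans hε₀)
  have hε1 : ε ≤ 1 := (hε.2.le.trans hε₀).trans (Real.exp_le_one_iff.2 (by norm_num))
  obtain ⟨d1, d2⟩ := IsSmall.abs_deriv_sub_le (E := normalLine V x) h hε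
  rw [sum_powLog_eq_derivSum] at d1
  have hγ : ∀ j < M + 2, |coeffγ V₀ V₁ j x| ≤ (M + 2) * C := by
    intro j hj
    obtain ⟨b1, b2⟩ := hb j hj
    have hj' : (j : ℝ) ≤ M + 1 := by exact_mod_cast Nat.lt_succ_iff.1 hj
    calc |coeffγ V₀ V₁ j x| ≤ |(j : ℝ) * coeffG V₀ V₁ j x| + |coeffF V₀ V₁ j x| := abs_add_le _ _
      _ = j * |coeffG V₀ V₁ j x| + |coeffF V₀ V₁ j x| := by rw [abs_mul, Nat.abs_cast]
      _ ≤ (M + 1) * C + C := by gcongr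
      _ = _ := by ring
  have hf : ∀ j < M + 2, |(j : ℝ) * coeffF V₀ V₁ j x| ≤ (M + 1) * C := by
    intro j hj
    have hj' : (j : ℝ) ≤ M + 1 := by exact_mod_cast Nat.lt_succ_iff.1 hj
    rw [abs_mul, Nat.abs_cast]
    have := (hb j hj).2
    gcongr
  have hM : (0 : ℝ) ≤ M := Nat.cast_nonneg M
  have hMC : 0 ≤ M * C := mul_nonneg hM hC
  have hMMC : 0 ≤ (M : ℝ) * M * C := by positivity
  have hsum : |ε * derivSum V₀ V₁ (M + 2) x ε| ≤ (M + 2) * ((2 * M + 3) * C) := by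
    rw [derivSum_eq, Finset.mul_sum]
    refine (Finset.abs_sum_le_sum_abs _ _).trans ?_
    have : ∀ j ∈ Finset.range (M + 2),
        |ε * (derivCoef V₀ V₁ x ε j * ε ^ ((j : ℤ) - 1))| ≤ (2 * M + 3) * C := by
      intro j hj
      have hj := Finset.mem_range.1 hj
      have e : ε * (derivCoef V₀ V₁ x ε j * ε ^ ((j : ℤ) - 1))
          = coeffγ V₀ V₁ j x * ε ^ j + j * coeffF V₀ V₁ j x * (ε ^ j * Real.log ε) := by
        rw [derivCoef, ← zpow_natCast, show ε ^ (j : ℤ) = ε ^ ((j : ℤ) - 1) * ε by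
          rw [← zpow_add_one₀ hε0.ne', sub_add_cancel]]
        ring
      rw [e]
      have e1 : |coeffγ V₀ V₁ j x * ε ^ j| ≤ (M + 2) * C := by
        rw [abs_mul, abs_of_pos (pow_pos hε0 j)]
        exact (mul_le_of_le_one_right (abs_nonneg _) (pow_le_one₀ hε0.le hε1)).trans (hγ j hj)
      have e2 : |j * coeffF V₀ V₁ j x * (ε ^ j * Real.log ε)| ≤ (M + 1) * C := by
        cases j with
        | zero => simp; positivity
        | succ i =>
          rw [abs_mul]
          have : |ε ^ (i + 1) * Real.log ε| ≤ 1 := by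
            rw [pow_succ, mul_assoc, abs_mul, abs_of_pos (pow_pos hε0 i)]
            exact mul_le_one₀ (pow_le_one₀ hε0.le hε1) (abs_nonneg _) (abs_mul_log_le hε0 hε1)
          exact (mul_le_of_le_one_right (abs_nonneg _) this).trans (hf _ hj)
      refine (abs_add_le _ _).trans ((add_le_add e1 e2).trans_eq ?_)
      ring
    refine (Finset.sum_le_sum this).trans_eq ?_
    rw [Finset.sum_const, nsmul_eq_mul, Finset.card_range]
    push_cast
    ring
  have hsum' : (M + 2) * ((2 * M + 3) * C) ≤ 2 * (M + 3) ^ 2 * C := by nlinarith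
  have hdiff : |ε * (deriv (normalLine V x) ε - derivSum V₀ V₁ (M + 2) x ε)|
      ≤ C := by
    rw [abs_mul, abs_of_pos hε0]
    calc ε * |deriv (normalLine V x) ε - derivSum V₀ V₁ (M + 2) x ε|
        ≤ ε * (C * (ε ^ (M + 1) * |Real.log ε|)) := by gcongr
      _ = C * ε ^ (M + 1) * |ε * Real.log ε| := by rw [abs_mul, abs_of_pos hε0]; ring
      _ ≤ C * 1 * 1 := by
        gcongr
        · exact pow_le_one₀ hε0.le hε1
        · exact abs_mul_log_le hε0 hε1
      _ = C := by ring
  have hP1 : 0 ≤ ε ^ (M + 1) * |Real.log ε| := by positivity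
  have hP0 : 0 ≤ ε ^ M * |Real.log ε| := by positivity
  have hS : 0 ≤ 2 * ((M : ℝ) + 3) ^ 2 * C := by positivity
  refine ⟨fun j hj => ?_, hsum.trans (hsum'.trans (by linarith)), d1.trans ?_, ?_, ?_⟩
  · have hfl : |(j : ℝ) * coeffF V₀ V₁ j x * Real.log ε| ≤ (M + 1) * C * |Real.log ε| := by
      rw [abs_mul]
      exact mul_le_mul_of_nonneg_right (hf j hj) (abs_nonneg _)
    have hγl : |coeffγ V₀ V₁ j x| ≤ (M + 2) * C * |Real.log ε| :=
      (hγ j hj).trans (le_mul_of_one_le_right (by positivity) hlog)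
    refine (abs_add_le _ _).trans ((add_le_add hγl hfl).trans ?_)
    rw [← add_mul]
    refine mul_le_mul_of_nonneg_right ?_ (abs_nonneg _)
    nlinarith
  · exact mul_le_mul_of_nonneg_right (by linarith) hP1
  · rw [linearSum_eq V₀ V₁ (M + 2) x hε0]
    have e : ∀ a b c d : ℝ, 2 * a + 3 / ε * b - (2 * c + 3 / ε * d)
        = 2 * (a - c) + 3 / ε * (b - d) := fun a b c d => by ring
    rw [e]
    have e1 : |3 / ε * (deriv (normalLine V x) ε - derivSum V₀ V₁ (M + 2) x ε)|
        ≤ 3 * C * (ε ^ M * |Real.log ε|) := by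
      rw [abs_mul, abs_of_pos (by positivity : 0 < 3 / ε)]
      refine (mul_le_mul_of_nonneg_left d1 (by positivity)).trans_eq ?_
      rw [pow_succ]
      field_simp
    refine (abs_add_le _ _).trans ?_
    rw [abs_mul, abs_two]
    have : 0 ≤ 2 * ((M : ℝ) + 3) ^ 2 * C * (ε ^ M * |Real.log ε|) := mul_nonneg hS hP0
    linarith
  · have : ε * deriv (normalLine V x) ε
        = ε * (deriv (normalLine V x) ε - derivSum V₀ V₁ (M + 2) x ε)
          + ε * derivSum V₀ V₁ (M + 2) x ε := by ring
    rw [this]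
    refine (abs_add_le _ _).trans ((add_le_add hdiff (hsum.trans hsum')).trans ?_)
    linarith

/-- The remainder in the expansions of `Ψ₀` and `Ψ₄`. -/
def cubicRem (n : ℕ) (V₀ V₁ : ℝ → ℝ) (V : ℝ → ℝ → ℝ) (x ε : ℝ) : ℝ :=
  2 * deriv (deriv (normalLine V x)) ε + 3 / ε * deriv (normalLine V x) ε
    - ε * deriv (normalLine V x) ε ^ 3
    - (linearSum V₀ V₁ n x ε - ε * derivSum V₀ V₁ n x ε ^ 3)

/-- The remainder in the expansion of `Ψ₂`. -/
def productRem (n : ℕ) (V₀ V₁ : ℝ → ℝ) (V : ℝ → ℝ → ℝ) (x y ε : ℝ) : ℝ :=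
  deriv (normalLine V x) ε * deriv (normalLine (fun x y => V y x) y) ε - 1 / ε ^ 2
    - productSum V₀ V₁ n x y ε

lemma NormalBound.abs_cubicRem_le {M : ℕ} {V₀ V₁ : ℝ → ℝ} {V : ℝ → ℝ → ℝ} {K x ε : ℝ}
    (h : NormalBound M V₀ V₁ V K x ε) (hε : 0 < ε) (hε1 : ε ≤ Real.exp (-1)) :
    |cubicRem (M + 2) V₀ V₁ V x ε| ≤ (K + 3 * K ^ 3) * (ε ^ M * |Real.log ε| ^ 3) := by
  have hlog : 1 ≤ |Real.log ε| := one_le_abs_log hε hε1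
  have hK : 0 ≤ K := (abs_nonneg _).trans h.sum
  obtain ⟨-, hs, h1, h2, hd⟩ := h
  unfold cubicRem
  set D := deriv (normalLine V x) ε
  set S := derivSum V₀ V₁ (M + 2) x ε
  have e : ε * D ^ 3 - ε * S ^ 3
      -- Factoring the difference of cubes pairs every `D` and `S` in the quadratic factor with an
      -- `ε`, so that this factor is bounded.
      = (D - S) / ε * ((ε * D) * (ε * D) + (ε * D) * (ε * S) + (ε * S) * (ε * S)) := by
    field_simp
    ring
  have e1 : |(D - S) / ε| ≤ K * (ε ^ M * |Real.log ε|) := by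
    rw [abs_div, abs_of_pos hε, div_le_iff₀ hε]
    refine h1.trans_eq ?_
    ring
  have e2 : |(ε * D) * (ε * D) + (ε * D) * (ε * S) + (ε * S) * (ε * S)| ≤ 3 * K ^ 2 := by
    have a1 : |(ε * D) * (ε * D)| ≤ K * K := by rw [abs_mul]; gcongr
    have a2 : |(ε * D) * (ε * S)| ≤ K * K := by rw [abs_mul]; gcongr
    have a3 : |(ε * S) * (ε * S)| ≤ K * K := by rw [abs_mul]; gcongr
    refine (abs_add_three _ _ _).trans ?_
    linarith
  have e3 : |ε * D ^ 3 - ε * S ^ 3| ≤ K * (ε ^ M * |Real.log ε|) * (3 * K ^ 2) := by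
    rw [e, abs_mul]
    gcongr
  have e4 : ε ^ M * |Real.log ε| ≤ ε ^ M * |Real.log ε| ^ 3 :=
    mul_le_mul_of_nonneg_left (le_self_pow₀ hlog (by norm_num)) (by positivity)
  have e5 : ∀ a b c d f : ℝ, a + b - c - (d - f) = (a + b - d) - (c - f) := by intros; ring
  rw [e5]
  refine (abs_sub _ _).trans ((add_le_add h2 e3).trans ?_)
  calc _ = (K + 3 * K ^ 3) * (ε ^ M * |Real.log ε|) := by ring
    _ ≤ _ := by gcongr

/-- The error has two sources: replacing each derivative by its truncation, which costs one
logarithm, and dropping the terms of the Cauchy product beyond the truncation, which costs two. -/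
lemma abs_productRem_le {M : ℕ} {V₀ V₁ : ℝ → ℝ} {V : ℝ → ℝ → ℝ} {K x y ε : ℝ}
    (h : NormalBound M V₀ V₁ V K x ε) (h' : NormalBound M V₁ V₀ (fun x y => V y x) K y ε)
    (hε : 0 < ε) (hε1 : ε ≤ Real.exp (-1)) :
    |productRem (M + 2) V₀ V₁ V x y ε|
      ≤ (2 * K ^ 2 + (M + 2) ^ 2 * K ^ 2) * (ε ^ M * |Real.log ε| ^ 2) := by
  have hlog : 1 ≤ |Real.log ε| := one_le_abs_log hε hε1
  have hε1' : ε ≤ 1 := hε1.trans (Real.exp_le_one_iff.2 (by norm_num))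
  have hK : 0 ≤ K := (abs_nonneg _).trans h.sum
  obtain ⟨hc, hs, h1, -, hd⟩ := h
  obtain ⟨hc', hs', h1', -, hd'⟩ := h'
  have hB : 0 ≤ K ^ 2 * (ε ^ M * |Real.log ε| ^ 2) := by positivity
  -- Off the triangle `k + l ≥ M + 2`, so the power `ε^(k+l-2)` is at most `ε^M`.
  have htri := abs_sum_sub_sum_antidiagonal_le (M + 2)
    (fun k l => derivCoef V₀ V₁ x ε k * derivCoef V₁ V₀ y ε l * ε ^ (((k + l : ℕ) : ℤ) - 2)) hB
    (by
      intro k hk l hl hkl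
      obtain ⟨m, hm⟩ := Nat.exists_eq_add_of_le hkl
      have : ε ^ (((k + l : ℕ) : ℤ) - 2) = ε ^ M * ε ^ m := by
        rw [hm, ← pow_add, ← zpow_natCast]
        congr 1
        push_cast
        ring
      rw [this, abs_mul, abs_mul, abs_of_pos (by positivity : 0 < ε ^ M * ε ^ m)]
      calc _ ≤ (K * |Real.log ε|) * (K * |Real.log ε|) * (ε ^ M * 1) := by
            gcongr
            · exact hc k hk
            · exact hc' l hl
            · exact pow_le_one₀ hε.le hε1'
        _ = _ := by ring)
  have hprod : (∑ k ∈ Finset.range (M + 2), ∑ l ∈ Finset.range (M + 2),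
      derivCoef V₀ V₁ x ε k * derivCoef V₁ V₀ y ε l * ε ^ (((k + l : ℕ) : ℤ) - 2))
      = derivSum V₀ V₁ (M + 2) x ε * derivSum V₁ V₀ (M + 2) y ε := by
    rw [derivSum_eq, derivSum_eq, Finset.sum_mul_sum]
    refine Finset.sum_congr rfl fun k _ => Finset.sum_congr rfl fun l _ => ?_
    rw [show ((k + l : ℕ) : ℤ) - 2 = ((k : ℤ) - 1) + ((l : ℤ) - 1) by push_cast; ring,
      zpow_add₀ hε.ne']
    ring
  rw [hprod] at htri
  unfold productRem
  rw [productSum_eq]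
  set D := deriv (normalLine V x) ε
  set S := derivSum V₀ V₁ (M + 2) x ε
  set D' := deriv (normalLine (fun x y => V y x) y) ε
  set S' := derivSum V₁ V₀ (M + 2) y ε
  have q1 : |(D - S) * D'| ≤ K ^ 2 * (ε ^ M * |Real.log ε|) := by
    rw [show (D - S) * D' = (D - S) / ε * (ε * D') by field_simp, abs_mul, abs_div, abs_of_pos hε]
    calc _ ≤ K * (ε ^ (M + 1) * |Real.log ε|) / ε * K := by gcongr
      _ = _ := by rw [pow_succ]; field_simp
  have q2 : |S * (D' - S')| ≤ K ^ 2 * (ε ^ M * |Real.log ε|) := by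
    rw [show S * (D' - S') = (ε * S) * ((D' - S') / ε) by field_simp, abs_mul, abs_div,
      abs_of_pos hε]
    calc _ ≤ K * (K * (ε ^ (M + 1) * |Real.log ε|) / ε) := by gcongr
      _ = _ := by rw [pow_succ]; field_simp
  have e4 : ε ^ M * |Real.log ε| ≤ ε ^ M * |Real.log ε| ^ 2 :=
    mul_le_mul_of_nonneg_left (le_self_pow₀ hlog (by norm_num)) (by positivity)
  have e4' := mul_le_mul_of_nonneg_left e4 (sq_nonneg K)
  have e5 : ∀ T w : ℝ, D * D' - w - (T - w) = (D - S) * D' + S * (D' - S') + (S * S' - T) := by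
    intros
    ring
  rw [e5]
  refine (abs_add_three _ _ _).trans ((add_le_add (add_le_add q1 q2) htri).trans ?_)
  push_cast
  linarith

end CollidingWaves

end

noncomputable section

namespace CollidingWaves

open Set MeasureTheory Filter Topology

/-! ### Uniformity away from the corners -/

/-- Near the hypotenuse, distance at least `δ` from its two endpoints forces both coordinates to be
at least `δ / 2`: if `1 - x ≥ δ`, then `y = 1 - x - ε ≥ δ / 2` as soon as `ε < δ / 2`, and
symmetrically. -/
lemma uniformBigO_of_forall {R : ℝ → ℝ → ℝ} {b : ℝ → ℝ} (hb : ∀ ε, 0 < ε → 0 ≤ b ε)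
    (h : ∀ δ > (0 : ℝ), ∃ C ≥ 0, ∃ ε₀ > 0, ε₀ ≤ δ ∧ ∀ x ∈ Icc δ (1 - δ), ∀ y ∈ Icc δ (1 - δ),
      1 - x - y ∈ Ioo 0 ε₀ → |R x y| ≤ C * b (1 - x - y)) : UniformBigO R b := by
  intro δ hδ
  obtain ⟨C, hC, ε₀, hε₀, hε₀δ, hR⟩ := h (δ / 2) (half_pos hδ)
  refine ⟨C + 1, by linarith, ε₀, hε₀, fun x y hxy _ h10 h01 hlt => ?_⟩
  obtain ⟨hx, hy, hs⟩ := hxy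
  simp only at hx hy hs
  rw [Prod.dist_eq, Real.dist_eq, Real.dist_eq] at h10 h01
  simp only [sub_zero] at h10 h01
  have hy' : δ / 2 ≤ y := by
    rcases le_max_iff.1 h10 with h | h
    · rw [abs_of_nonpos (by linarith)] at h
      linarith
    · rw [abs_of_nonneg hy] at h
      linarith
  have hx' : δ / 2 ≤ x := by
    rcases le_max_iff.1 h01 with h | h
    · rw [abs_of_nonneg hx] at h
      linarith
    · rw [abs_of_nonpos (by linarith)] at h
      linarith
  have h0 : 0 < 1 - x - y := by linarith
  refine (hR x ⟨hx', by linarith⟩ y ⟨hy', by linarith⟩ ⟨h0, hlt⟩).trans ?_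
  exact mul_le_mul_of_nonneg_right (by linarith) (hb _ h0)

lemma IsSuperposition.exists_normalBound {M : ℕ} {α : ℝ} (hα : α < 1) {V₀ V₁ : ℝ → ℝ}
    (h0 : IsBoundaryFunction (M + 3) α V₀) (h1 : IsBoundaryFunction (M + 3) α V₁)
    {V : ℝ → ℝ → ℝ} (hV : IsSuperposition V₀ V₁ V) {δ : ℝ} (hδ : 0 < δ) :
    ∃ K ≥ 0, ∃ ε₀ > 0, ε₀ ≤ Real.exp (-1) ∧ ε₀ ≤ δ ∧ ∀ x ∈ Icc δ (1 - δ), ∀ ε ∈ Ioo 0 ε₀,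
      NormalBound M V₀ V₁ V K x ε := by
  obtain ⟨C, hC, ε₀, hε₀, he, hd, h⟩ := hV.exists_expansion hα h0 h1 hδ
  exact ⟨2 * (M + 3) ^ 2 * C + 5 * C, by positivity, ε₀, hε₀, he, hd, fun x hx ε hε =>
    normalBound_of_isSmall hC he (h x hx).1 (h x hx).2 hε⟩

lemma NormalBound.mono {M : ℕ} {V₀ V₁ : ℝ → ℝ} {V : ℝ → ℝ → ℝ} {K K' x ε : ℝ}
    (h : NormalBound M V₀ V₁ V K x ε) (hK : K ≤ K') (hε : 0 < ε) :
    NormalBound M V₀ V₁ V K' x ε where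
  coef j hj := (h.coef j hj).trans (mul_le_mul_of_nonneg_right hK (abs_nonneg _))
  sum := h.sum.trans hK
  first := h.first.trans (mul_le_mul_of_nonneg_right hK (by positivity))
  linear := h.linear.trans (mul_le_mul_of_nonneg_right hK (by positivity))
  deriv_le := h.deriv_le.trans hK

lemma IsSuperposition.uniformBigO_cubicRem {M : ℕ} {α : ℝ} (hα : α < 1) {V₀ V₁ : ℝ → ℝ}
    (h0 : IsBoundaryFunction (M + 3) α V₀) (h1 : IsBoundaryFunction (M + 3) α V₁)
    {V : ℝ → ℝ → ℝ} (hV : IsSuperposition V₀ V₁ V) :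
    UniformBigO (fun x y => cubicRem (M + 2) V₀ V₁ V x (1 - x - y))
      (fun ε => ε ^ M * |Real.log ε| ^ 3) := by
  refine uniformBigO_of_forall (fun ε hε => by positivity) fun δ hδ => ?_
  obtain ⟨K, hK, ε₀, hε₀, he, hd, h⟩ := hV.exists_normalBound hα h0 h1 hδ
  exact ⟨K + 3 * K ^ 3, by positivity, ε₀, hε₀, hd, fun x hx y _ hε =>
    (h x hx _ hε).abs_cubicRem_le hε.1 (hε.2.le.trans he)⟩

lemma UniformBigO.swap {R : ℝ → ℝ → ℝ} {b : ℝ → ℝ} (h : UniformBigO R b) :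
    UniformBigO (fun x y => R y x) b := by
  intro δ hδ
  obtain ⟨C, hC, ε₀, hε₀, hR⟩ := h δ hδ
  refine ⟨C, hC, ε₀, hε₀, fun x y hxy h00 h10 h01 hlt => ?_⟩
  have hs : ∀ a b : ℝ, dist (y, x) (a, b) = dist (x, y) (b, a) := fun a b => by
    simp only [Prod.dist_eq]
    exact max_comm _ _
  rw [sub_right_comm] at hlt ⊢
  refine hR y x ⟨hxy.2.1, hxy.1, ?_⟩ ?_ ?_ ?_ hlt
  · have := hxy.2.2
    simp only at this ⊢
    linarith
  · rwa [hs]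
  · rwa [hs]
  · rwa [hs]

lemma IsSuperposition.uniformBigO_productRem {M : ℕ} {α : ℝ} (hα : α < 1) {V₀ V₁ : ℝ → ℝ}
    (h0 : IsBoundaryFunction (M + 3) α V₀) (h1 : IsBoundaryFunction (M + 3) α V₁)
    {V : ℝ → ℝ → ℝ} (hV : IsSuperposition V₀ V₁ V) :
    UniformBigO (fun x y => productRem (M + 2) V₀ V₁ V x y (1 - x - y))
      (fun ε => ε ^ M * |Real.log ε| ^ 2) := by
  refine uniformBigO_of_forall (fun ε hε => by positivity) fun δ hδ => ?_
  obtain ⟨K, hK, ε₀, hε₀, he, hd, h⟩ := hV.exists_normalBound hα h0 h1 hδ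
  obtain ⟨K', hK', ε₁, hε₁, -, -, h'⟩ := hV.swap.exists_normalBound hα h1 h0 hδ
  refine ⟨2 * max K K' ^ 2 + (M + 2) ^ 2 * max K K' ^ 2, by positivity, min ε₀ ε₁,
    lt_min hε₀ hε₁, (min_le_left _ _).trans hd, fun x hx y hy hε => ?_⟩
  have i0 := hε.2.trans_le (min_le_left _ _)
  have i1 := hε.2.trans_le (min_le_right _ _)
  exact abs_productRem_le ((h x hx _ ⟨hε.1, i0⟩).mono (le_max_left _ _) hε.1)
    ((h' y hy _ ⟨hε.1, i1⟩).mono (le_max_right _ _) hε.1) hε.1 (i0.le.trans he)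

/-! ### The change of variables -/

/-- The power `(c w)^(n-1)` is rewritten in terms of `(c w)^n`, which is the coordinate `x` or `y`
itself. -/
lemma deriv_profile {c n w : ℝ} (hc : 0 < c) (hn : 0 < n) (hw : 0 < w) :
    deriv (profile c n) w = -(c * n * ((c * w) ^ n) ^ (1 - 1 / n)) := by
  have hcw : 0 < c * w := mul_pos hc hw
  have h1 : HasDerivAt (fun w : ℝ => c * w) c w := by simpa using (hasDerivAt_id w).const_mul c
  have h2 := (h1.rpow_const (p := n) (Or.inl hcw.ne')).const_sub (1 / 2)
  have h3 : ((c * w) ^ n) ^ (1 - 1 / n) = (c * w) ^ (n - 1) := by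
    rw [← Real.rpow_mul hcw.le]
    congr 1
    field_simp
  rw [h3]
  exact h2.deriv

theorem IsGoursatSolution.isSuperposition {M : ℕ} {α : ℝ} (hα : α < 1) {V₀ V₁ : ℝ → ℝ}
    {V : ℝ → ℝ → ℝ} (h0 : IsBoundaryFunction (M + 3) α V₀) (h1 : IsBoundaryFunction (M + 3) α V₁)
    (hV : IsGoursatSolution (M + 2) V₀ V₁ V) : IsSuperposition V₀ V₁ V := by
  obtain ⟨_, _, _, hc, hd, heq, _, _, _, hV0, hV1⟩ := hV
  exact fun x y hx hy hxy => eq_superpos (n := M + 2) hα h0 h1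
    ⟨hd.of_le (by exact_mod_cast Nat.le_add_left 2 M), heq⟩ hc hV0 hV1 hx hy hxy

end CollidingWaves

end

/-! ### Assembly of the expansions of the Weyl components. -/

theorem mainTheorem3 (N : ℕ) (hN : 1 ≤ N) (α : ℝ) (hα₀ : 0 ≤ α) (hα₁ : α < 1)
    (V₀ V₁ : ℝ → ℝ)
    (hV₀ : IsBoundaryFunction (N + 2) α V₀) (hV₁ : IsBoundaryFunction (N + 2) α V₁)
    (V : ℝ → ℝ → ℝ) (hV : IsGoursatSolution (N + 1) V₀ V₁ V) :
    ∃ R₀ R₂ R₄ : ℝ → ℝ → ℝ,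
      UniformBigO R₀ (fun ε => ε ^ (N - 1) * |Real.log ε| ^ 3) ∧
      UniformBigO R₂ (fun ε => ε ^ (N - 1) * |Real.log ε| ^ 2) ∧
      UniformBigO R₄ (fun ε => ε ^ (N - 1) * |Real.log ε| ^ 3) ∧
      ∀ c₁ n₁ c₂ n₂ : ℝ, 0 < c₁ → 0 < n₁ → 0 < c₂ → 0 < n₂ →
      ∀ u v x y ε : ℝ, 0 < u → 0 < v → x = (c₂ * v) ^ n₂ → y = (c₁ * u) ^ n₁ →
        ε = 1 - x - y → 0 < ε →
        weylΨ₀ V (profile c₁ n₁) (profile c₂ n₂) u v =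
          -((c₂ * n₂ * x ^ (1 - 1 / n₂)) ^ 2 / 4) *
            (∑ j ∈ Finset.range (N + 1),
                (2 * coeffGG V₁ V₀ j y + 3 * coeffγ V₁ V₀ j y) * ε ^ ((j : ℤ) - 2)
              + ∑ j ∈ Finset.range (N + 1),
                  (2 * (j : ℝ) + 1) * j * coeffF V₁ V₀ j y * ε ^ ((j : ℤ) - 2) * Real.log ε
              - ε * (∑ j ∈ Finset.range (N + 1),
                        (j : ℝ) * coeffF V₁ V₀ j y * ε ^ ((j : ℤ) - 1) * Real.log ε
                      + ∑ j ∈ Finset.range (N + 1),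
                          coeffγ V₁ V₀ j y * ε ^ ((j : ℤ) - 1)) ^ 3
              + R₀ x y) ∧
        weylΨ₂ V (profile c₁ n₁) (profile c₂ n₂) u v =
          c₁ * n₁ * c₂ * n₂ * y ^ (1 - 1 / n₁) * x ^ (1 - 1 / n₂) *
            (∑ j ∈ Finset.range (N + 1),
                (∑ p ∈ Finset.HasAntidiagonal.antidiagonal j, coeffγ V₀ V₁ p.1 x * coeffγ V₁ V₀ p.2 y)
                  * ε ^ ((j : ℤ) - 2)
              - 1 / ε ^ 2
              + ∑ j ∈ Finset.range (N + 1),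
                  (∑ p ∈ Finset.HasAntidiagonal.antidiagonal j,
                    ((p.1 : ℝ) * coeffF V₀ V₁ p.1 x * coeffγ V₁ V₀ p.2 y
                      + (p.1 : ℝ) * coeffF V₁ V₀ p.1 y * coeffγ V₀ V₁ p.2 x))
                  * ε ^ ((j : ℤ) - 2) * Real.log ε
              + ∑ j ∈ Finset.range (N + 1),
                  (∑ p ∈ Finset.HasAntidiagonal.antidiagonal j,
                    (p.1 : ℝ) * (p.2 : ℝ) * coeffF V₀ V₁ p.1 x * coeffF V₁ V₀ p.2 y)
                  * ε ^ ((j : ℤ) - 2) * Real.log ε ^ 2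
              + R₂ x y) ∧
        weylΨ₄ V (profile c₁ n₁) (profile c₂ n₂) u v =
          -((c₁ * n₁ * y ^ (1 - 1 / n₁)) ^ 2 / 4) *
            (∑ j ∈ Finset.range (N + 1),
                (2 * coeffGG V₀ V₁ j x + 3 * coeffγ V₀ V₁ j x) * ε ^ ((j : ℤ) - 2)
              + ∑ j ∈ Finset.range (N + 1),
                  (2 * (j : ℝ) + 1) * j * coeffF V₀ V₁ j x * ε ^ ((j : ℤ) - 2) * Real.log ε
              - ε * (∑ j ∈ Finset.range (N + 1),
                        (j : ℝ) * coeffF V₀ V₁ j x * ε ^ ((j : ℤ) - 1) * Real.log ε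
                      + ∑ j ∈ Finset.range (N + 1),
                          coeffγ V₀ V₁ j x * ε ^ ((j : ℤ) - 1)) ^ 3
              + R₄ x y) := by
  -- Here `M = N - 1` is the power of `ε` in the errors and `M + 2 = N + 1` the number of terms.
  obtain ⟨M, rfl⟩ : ∃ M, N = M + 1 := ⟨N - 1, by omega⟩
  have hsup : IsSuperposition V₀ V₁ V := hV.isSuperposition hα₁ hV₀ hV₁
  -- The remainders are the exact differences in `V` alone; the profiles enter only through the
  -- factors `f'` and `g'` in front, so the remainders do not depend on `c₁`, `c₂`, `n₁`, `n₂`. The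
  -- one for `Ψ₀` is that of `Ψ₄` for the reflected solution.
  refine ⟨fun x y => cubicRem (M + 2) V₁ V₀ (fun x y => V y x) y (1 - y - x),
    fun x y => productRem (M + 2) V₀ V₁ V x y (1 - x - y),
    fun x y => cubicRem (M + 2) V₀ V₁ V x (1 - x - y),
    (hsup.swap.uniformBigO_cubicRem hα₁ hV₁ hV₀).swap,
    hsup.uniformBigO_productRem hα₁ hV₀ hV₁, hsup.uniformBigO_cubicRem hα₁ hV₀ hV₁, ?_⟩
  intro c₁ n₁ c₂ n₂ hc₁ hn₁ hc₂ hn₂ u v x y ε hu hv hx hy hε hε0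
  have hf : profile c₁ n₁ u = 1 / 2 - y := by rw [hy, profile]
  have hg : profile c₂ n₂ v = 1 / 2 - x := by rw [hx, profile]
  have hf' : deriv (profile c₁ n₁) u = -(c₁ * n₁ * y ^ (1 - 1 / n₁)) := by
    rw [deriv_profile hc₁ hn₁ hu, hy]
  have hg' : deriv (profile c₂ n₂) v = -(c₂ * n₂ * x ^ (1 - 1 / n₂)) := by
    rw [deriv_profile hc₂ hn₂ hv, hx]
  have hfg : 1 / 2 - y + (1 / 2 - x) = ε := by rw [hε]; ring
  have hyx : 1 - y - x = ε := by rw [hε]; ring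
  refine ⟨?_, ?_, ?_⟩
  · rw [weylΨ₀, partialY_partialY_inFG, partialY_inFG, hf, hg, hg', hfg, sub_sub_cancel]
    simp only [cubicRem, linearSum, derivSum, hyx]
    ring
  · rw [weylΨ₂, partialX_inFG, partialY_inFG, hf, hg, hf', hg', hfg, sub_sub_cancel,
      sub_sub_cancel]
    simp only [productRem, productSum, ← hε]
    ring
  · rw [weylΨ₄, partialX_partialX_inFG, partialX_inFG, hf, hg, hf', hfg, sub_sub_cancel]
    simp only [cubicRem, linearSum, derivSum, ← hε]
    ring
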